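/- Let $\Sigma$ be a compact oriented smooth 3-manifold with (possibly empty) boundary, $\imath_\partial:\partial\Sigma\hookrightarrow\Sigma$ the inclusion, and $\alpha_1,\dots,\alpha_5\in\mathbb R$ with $\alpha_1\neq\alpha_2$ and $4\alpha_2\alpha_3-\alpha_5^2\neq0$. Internal $\mathfrak{so}(3)$ indices $i,j,k\in\{1,2,3\}$ are moved with $\delta_{ij}$, and repeated indices are summed. The configuration variables are smooth $\mathfrak{so}(3)$-valued functions $A_\perp^i,e_\perp^i$ and one-forms $A^i,e^i$ on $\Sigma$. Put $D\tau^i=d\tau^i+\epsilon^i{}_{jk}A^j\tau^k$, $De^i=de^i+\epsilon^i{}_{jk}A^j\wedge e^k$, $F^i=dA^i+\tfrac12\epsilon^i{}_{jk}A^j\wedge A^k$, and $$\Pi_{A\,i}=\alpha_1\epsilon_{ijk}e^j\wedge e^k+2\alpha_3F_i+\alpha_5De_i,\qquad \Pi_{e\,i}=2\alpha_2De_i+\alpha_4\epsilon_{ijk}e^j\wedge e^k+\alpha_5F_i .$$ On the cotangent bundle of the configuration space, with momenta $\mathbf P_{\perp i},\mathbf P_i,\mathbf p_{\perp i},\mathbf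 p_i$ (linear functionals on $\mathfrak{so}(3)$-valued functions, resp. one-forms) and canonical symplectic form $\Omega$, consider the primary constraint functions $$\mathbf C_{\perp i}=\mathbf P_{\perp i},\quad \mathbf C_i=\mathbf P_i-\int_\Sigma\cdot\wedge\Pi_{A\,i},\quad \mathbf c_{\perp i}=\mathbf p_{\perp i},\quad \mathbf c_i=\mathbf p_i-\int_\Sigma\cdot\wedge\Pi_{e\,i}$$ and the Hamiltonian $$H=\int_\Sigma\Big(DA_\perp^i\wedge\Pi_{A\,i}-2\epsilon_{ijk}e_\perp^ie^j\wedge(\alpha_1F^k+\alpha_4De^k)-(\epsilon^i{}_{jk}A_\perp^je^k-De_\perp^i)\wedge\Pi_{e\,i}\Big).$$ A tangent vector $X$ at a phase space point is called Hamiltonian if it is tangent to the primary constraint submanifold and, for some multipliers $\lambda_\perp^i,\lambda^i,\mu_\perp^i,\mu^i$ and all tangent vectors $Y$, $\Omega(X,Y)=\mathbf dH(Y)+\langle\lambda_\perp^i|\mathbf d\mathbf C_{\perp i}\rangle(Y)+\langle\lambda^i|\mathbf d\mathbf C_i\rangle(Y)+\langle\mu_\perp^i|\mathbf d\mathbf c_{\perp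 i}\rangle(Y)+\langle\mu^i|\mathbf d\mathbf c_i\rangle(Y)$. Put $$\kappa=-\frac{2\alpha_1\alpha_2-\alpha_4\alpha_5}{4\alpha_2\alpha_3-\alpha_5^2},\qquad \theta=-\frac{2\alpha_3\alpha_4-\alpha_1\alpha_5}{4\alpha_2\alpha_3-\alpha_5^2}.$$ Let $t\mapsto\gamma(t)$, $t$ in an open set $J\subseteq\mathbb R$, be a curve in phase space whose velocity $X(t)$ at each time is Hamiltonian, and which runs in the set where the $e^i$ form a coframe at every point, the primary constraints vanish, the secondary constraints $$(\alpha_1-\alpha_2)\epsilon_{ijk}e^j\wedge F^k=0,\quad(\alpha_1-\alpha_2)\epsilon_{ijk}De^j\wedge e^k=0,\quad \imath_\partial^*(F^i-\kappa\,\epsilon^i{}_{jk}e^j\wedge e^k)=0,\quad \imath_\partial^*(De^i-\theta\,\epsilon^i{}_{jk}e^j\wedge e^k)=0$$ hold, and the sector condition $\imath_\partial^*(\epsilon_{ijk}e_\perp^ie^j\wedge e^k)=0$ holds. Write $\tau^i=A_\perp^i$ and $\rho^i=e_\perp^i$. Then for every $t\in J$: (1) $X_A^i=DA_\perp^i+V_A^i$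 and $X_e^i=De_\perp^i-\epsilon^i{}_{jk}A_\perp^je^k+V_e^i$ with smooth one-forms $V_A^i,V_e^i$ such that $\epsilon_{ijk}e^j\wedge V_A^k=\epsilon_{ijk}e_\perp^jF^k$, $\epsilon_{ijk}e^j\wedge V_e^k=\epsilon_{ijk}e_\perp^jDe^k$, and the remaining constraints $\imath_\partial^*(V_A^i-2\kappa\,\epsilon^i{}_{jk}e_\perp^je^k)=0$, $\imath_\partial^*(V_e^i-2\theta\,\epsilon^i{}_{jk}e_\perp^je^k)=0$ hold. The components $X_{A_\perp}$ and $X_{e_\perp}$ are not determined: replacing them by arbitrary smooth functions gives again a Hamiltonian vector. (2) There is a smooth vector field $\boldsymbol\rho$ on $\Sigma$ with $\imath_{\boldsymbol\rho}e^i=\rho^i$; it is tangent to $\partial\Sigma$, and $$\dot A^i=\pounds_{\boldsymbol\rho}A^i+D(\tau^i-\imath_{\boldsymbol\rho}A^i),\qquad \dot e^i=\pounds_{\boldsymbol\rho}e^i-\epsilon^i{}_{jk}(\tau^j-\imath_{\boldsymbol\rho}A^j)e^k .$$ (3) The pullbacks to the boundary (subscript $\partial$) satisfy $F_\partial^i=\kappa\,\epsilon^i{}_{jk}e_\partial^j\wedge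 e_\partial^k$, $D_\partial e_\partial^i=\theta\,\epsilon^i{}_{jk}e_\partial^j\wedge e_\partial^k$ and $$\dot A_\partial^i=D_\partial\tau_\partial^i+2\kappa\,\epsilon^i{}_{jk}\rho_\partial^je_\partial^k,\qquad \dot e_\partial^i=D_\partial\rho_\partial^i-\epsilon^i{}_{jk}\tau_\partial^je_\partial^k+2\theta\,\epsilon^i{}_{jk}\rho_\partial^je_\partial^k ,$$ that is, the $2+1$ form of the equations $F=\kappa\,\epsilon\, e\wedge e$, $De=\theta\,\epsilon\, e\wedge e$ of three-dimensional Euclidean gravity with torsion and cosmological constant on $\mathbb R\times\partial\Sigma$, for the connection $A_\partial^i+\tau_\partial^i\,dt$ and the triad $e_\partial^i+\rho_\partial^i\,dt$. If $2\alpha_3\alpha_4-\alpha_1\alpha_5=0$, these are the torsion-free equations ($\theta=0$, $\kappa=-\Lambda/2$) with cosmological constant $\Lambda=\frac{4\alpha_1\alpha_2-2\alpha_4\alpha_5}{4\alpha_2\alpha_3-\alpha_5^2}$. (4) (Partial gauge fixing.) At each point of $\partial\Sigma$ the sector condition on the value of $\rho_\partial$ is exactly one non-trivial homogeneous linear equation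 $n_i\rho_\partial^i=0$, $n\neq0$, so that two components of $\rho_\partial$ remain independent. -/

import Mathlib

open scoped Manifold ContDiff BigOperators

noncomputable section

namespace HKBoundary

/-! ### Internal indices and exterior calculus on a manifold with corners -/

/-- The totally antisymmetric symbol of `so(3)`: for `i, j, k ∈ {0, 1, 2}` this product is
`1`, `-1` or `0`, the sign of the permutation `(i, j, k)`. Internal indices are raised and lowered
with `δ`, so upper and lower indices are not distinguished. -/
def eps (i j k : Fin 3) : ℝ :=
  (((j : ℕ) : ℝ) - ((i : ℕ) : ℝ)) * (((k : ℕ) : ℝ) - ((i : ℕ) : ℝ)) *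
    (((k : ℕ) : ℝ) - ((j : ℕ) : ℝ)) / 2

section Forms

variable {E : Type*} [NormedAddCommGroup E] [NormedSpace ℝ E] {H : Type*} [TopologicalSpace H]

/-- (Not necessarily smooth) fields of covectors. -/
abbrev CovectorField (I : ModelWithCorners ℝ E H) (M : Type*) [TopologicalSpace M]
    [ChartedSpace H M] : Type _ :=
  ∀ x : M, TangentSpace I x →L[ℝ] ℝ

/-- Two-forms, written as functions of a point and two tangent vectors. -/
abbrev TwoForm (I : ModelWithCorners ℝ E H) (M : Type*) [TopologicalSpace M]
    [ChartedSpace H M] : Type _ :=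
  ∀ x : M, TangentSpace I x → TangentSpace I x → ℝ

/-- Three-forms, written as functions of a point and three tangent vectors. -/
abbrev ThreeForm (I : ModelWithCorners ℝ E H) (M : Type*) [TopologicalSpace M]
    [ChartedSpace H M] : Type _ :=
  ∀ x : M, TangentSpace I x → TangentSpace I x → TangentSpace I x → ℝ

variable {I : ModelWithCorners ℝ E H} {M : Type*} [TopologicalSpace M] [ChartedSpace H M]

/-- The differential of the inverse of the chart at `c`, at the coordinate point `y`. -/
def coordPush (I : ModelWithCorners ℝ E H) {M : Type*} [TopologicalSpace M] [ChartedSpace H M]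
    (c : M) (y : E) : E →L[ℝ] TangentSpace I ((extChartAt I c).symm y) :=
  mfderivWithin 𝓘(ℝ, E) I (extChartAt I c).symm (Set.range I) y

/-- The coordinate expression of a covector field in the chart at `c`. -/
def coordRep (a : CovectorField I M) (c : M) (y : E) : E →L[ℝ] ℝ :=
  (a ((extChartAt I c).symm y)).comp (coordPush I c y)

/-- The coordinate expression of a vector field in the chart at `c`. -/
def coordVec (ρ : ∀ x : M, TangentSpace I x) (c : M) (y : E) : E :=
  mfderiv I 𝓘(ℝ, E) (extChartAt I c) ((extChartAt I c).symm y) (ρ ((extChartAt I c).symm y))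

/-- The exterior derivative of a function. -/
def extD0 (I : ModelWithCorners ℝ E H) {M : Type*} [TopologicalSpace M] [ChartedSpace H M]
    (f : M → ℝ) : CovectorField I M :=
  fun x => mfderiv I 𝓘(ℝ, ℝ) f x

/-- The exterior derivative of a one-form: `(da)(u, v) = ∂_u a(v) - ∂_v a(u)` in the chart at the
point. -/
def extD1 (a : CovectorField I M) : TwoForm I M := fun x u v =>
  let φ := extChartAt I x
  let u' : E := mfderiv I 𝓘(ℝ, E) φ x u
  let v' : E := mfderiv I 𝓘(ℝ, E) φ x v
  fderivWithin ℝ (coordRep a x) (Set.range I) (φ x) u' v' -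
    fderivWithin ℝ (coordRep a x) (Set.range I) (φ x) v' u'

/-- The Lie derivative of a one-form along a vector field: in the chart at the point,
`(£_ρ a)_m = ρ^n ∂_n a_m + a_n ∂_m ρ^n`. -/
def lieD (ρ : ∀ x : M, TangentSpace I x) (a : CovectorField I M) (x : M)
    (v : TangentSpace I x) : ℝ :=
  let φ := extChartAt I x
  let v' : E := mfderiv I 𝓘(ℝ, E) φ x v
  fderivWithin ℝ (coordRep a x) (Set.range I) (φ x) (coordVec ρ x (φ x)) v' +
    coordRep a x (φ x) (fderivWithin ℝ (coordVec ρ x) (Set.range I) (φ x) v')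

/-- Wedge product of two one-forms. -/
def wedge11 (a b : CovectorField I M) : TwoForm I M := fun x u v => a x u * b x v - a x v * b x u

/-- Wedge product of a one-form and a two-form. -/
def wedge12 (a : CovectorField I M) (b : TwoForm I M) : ThreeForm I M := fun x u v w =>
  a x u * b x v w - a x v * b x u w + a x w * b x u v

/-- Wedge product of a two-form and a one-form. -/
def wedge21 (b : TwoForm I M) (a : CovectorField I M) : ThreeForm I M := fun x u v w =>
  b x u v * a x w - b x u w * a x v + b x v w * a x u

/-- `D τ^i = d τ^i + ε^i_{jk} A^j τ^k`. -/
def covD0 (A : Fin 3 → CovectorField I M) (τ : Fin 3 → M → ℝ) (i : Fin 3) : CovectorField I M :=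
  fun x => extD0 I (τ i) x + ∑ j, ∑ k, (eps i j k * τ k x) • A j x

/-- `D e^i = d e^i + ε^i_{jk} A^j ∧ e^k`. -/
def covD1 (A e : Fin 3 → CovectorField I M) (i : Fin 3) : TwoForm I M := fun x u v =>
  extD1 (e i) x u v + ∑ j, ∑ k, eps i j k * wedge11 (A j) (e k) x u v

/-- `F^i = d A^i + (1/2) ε^i_{jk} A^j ∧ A^k`. -/
def curv (A : Fin 3 → CovectorField I M) (i : Fin 3) : TwoForm I M := fun x u v =>
  extD1 (A i) x u v + (1 / 2) * ∑ j, ∑ k, eps i j k * wedge11 (A j) (A k) x u v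

/-- `ε_{ijk} e^j ∧ e^k`. -/
def epsWedge (e : Fin 3 → CovectorField I M) (i : Fin 3) : TwoForm I M := fun x u v =>
  ∑ j, ∑ k, eps i j k * wedge11 (e j) (e k) x u v

/-- `ε^i_{jk} r^j e^k` for `so(3)`-valued scalars `r`. -/
def epsContract (r : Fin 3 → M → ℝ) (e : Fin 3 → CovectorField I M) (i : Fin 3) :
    CovectorField I M :=
  fun x => ∑ j, ∑ k, (eps i j k * r j x) • e k x

/-- The forms `e^i` are a coframe at every point. -/
def IsCoframe (e : Fin 3 → CovectorField I M) : Prop :=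
  ∀ x : M, LinearIndependent ℝ (fun i => e i x)

/-- Pullback of a covector field along a map. -/
def pullback {E' : Type*} [NormedAddCommGroup E'] [NormedSpace ℝ E'] {H' : Type*}
    [TopologicalSpace H'] {I' : ModelWithCorners ℝ E' H'} {N : Type*} [TopologicalSpace N]
    [ChartedSpace H' N] (ι : N → M) (a : CovectorField I M) : CovectorField I' N :=
  fun y => (a (ι y)).comp (mfderiv I' I ι y)

end Forms

/-! ### The spatial manifold, its boundary, and integration -/

section Space

variable (S : Type*) [TopologicalSpace S] [ChartedSpace (EuclideanHalfSpace 3) S]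

/-- The atlas of `S` is oriented: all coordinate changes have positive Jacobian determinant. -/
def IsOrientedAtlas : Prop :=
  ∀ φ ∈ atlas (EuclideanHalfSpace 3) S, ∀ ψ ∈ atlas (EuclideanHalfSpace 3) S,
    ∀ x ∈ φ.source ∩ ψ.source,
      0 < (fderivWithin ℝ (ψ.extend (𝓡∂ 3) ∘ (φ.extend (𝓡∂ 3)).symm) (Set.range (𝓡∂ 3))
        (φ.extend (𝓡∂ 3) x)).det

variable {S}

/-- `ι : N → S` is the inclusion of the boundary surface: a smooth embedding (topological
embedding and immersion) whose image is the boundary of `S`. -/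
structure IsBoundaryInclusion {N : Type*} [TopologicalSpace N]
    [ChartedSpace (EuclideanSpace ℝ (Fin 2)) N] (ι : N → S) : Prop where
  isEmbedding : Topology.IsEmbedding ι
  contMDiff : ContMDiff (𝓡 2) (𝓡∂ 3) ∞ ι
  injective_mfderiv : ∀ y, Function.Injective (mfderiv (𝓡 2) (𝓡∂ 3) ι y)
  range_eq : Set.range ι = (𝓡∂ 3).boundary S

variable (S)
variable [IsManifold (𝓡∂ 3) ∞ S] [T2Space S] [CompactSpace S]

/-- A smooth partition of unity subordinate to the chart domains. -/
def chartPartition : SmoothPartitionOfUnity S (𝓡∂ 3) S :=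
  (SmoothPartitionOfUnity.exists_isSubordinate_chartAt_source (𝓡∂ 3) S).choose

variable {S}

/-- The integral of a three-form over `S` (whose atlas is meant to be oriented): the sum over the
charts `c` of `∫ ρ_c η(∂₀, ∂₁, ∂₂) dy` for a partition of unity `ρ` subordinate to the charts. -/
def integral (η : ThreeForm (𝓡∂ 3) S) : ℝ :=
  ∑ᶠ c : S, ∫ y in (extChartAt (𝓡∂ 3) c).target,
    chartPartition S c ((extChartAt (𝓡∂ 3) c).symm y) *
      η ((extChartAt (𝓡∂ 3) c).symm y)
        (coordPush (𝓡∂ 3) c y (EuclideanSpace.single 0 1))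
        (coordPush (𝓡∂ 3) c y (EuclideanSpace.single 1 1))
        (coordPush (𝓡∂ 3) c y (EuclideanSpace.single 2 1))

end Space

/-! ### Phase space, Hamiltonian, symplectic form -/

section PhaseSpace

variable (S : Type*) [TopologicalSpace S] [ChartedSpace (EuclideanHalfSpace 3) S]
  [IsManifold (𝓡∂ 3) ∞ S]

/-- Smooth functions on `S`. -/
abbrev ScalarField : Type _ := C^∞⟮𝓡∂ 3, S; 𝓘(ℝ, ℝ), ℝ⟯

/-- Smooth one-forms on `S`: smooth sections of the cotangent bundle. -/
abbrev OneForm : Type _ :=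
  ContMDiffSection (𝓡∂ 3) (EuclideanSpace ℝ (Fin 3) →L[ℝ] ℝ) ∞
    (fun x : S => TangentSpace (𝓡∂ 3) x →L[ℝ] Bundle.Trivial S ℝ x)

/-- Smooth vector fields on `S`. -/
abbrev SmoothVectorField : Type _ :=
  ContMDiffSection (𝓡∂ 3) (EuclideanSpace ℝ (Fin 3)) ∞
    (fun x : S => TangentSpace (𝓡∂ 3) x)

/-- Points `(A_⊥, A, e_⊥, e)` of the configuration space, a vector space, and also its tangent
vectors. -/
structure Fields where
  Aperp : Fin 3 → ScalarField S
  A : Fin 3 → OneForm S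
  eperp : Fin 3 → ScalarField S
  e : Fin 3 → OneForm S

/-- Momenta: linear functionals on `so(3)`-valued functions and one-forms; `P w` stands for
`P_i(w^i)` with the internal index summed. -/
structure Momenta where
  Pperp : Module.Dual ℝ (Fin 3 → ScalarField S)
  P : Module.Dual ℝ (Fin 3 → OneForm S)
  pperp : Module.Dual ℝ (Fin 3 → ScalarField S)
  p : Module.Dual ℝ (Fin 3 → OneForm S)

/-- Points of the cotangent bundle of the configuration space, and also its tangent vectors. -/
structure PhasePoint where
  q : Fields S
  m : Momenta S

/-- The five coupling constants. -/
structure Couplings where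
  α₁ : ℝ
  α₂ : ℝ
  α₃ : ℝ
  α₄ : ℝ
  α₅ : ℝ

variable {S}

/-- The covector fields underlying a triple of smooth one-forms. -/
def cov (a : Fin 3 → OneForm S) : Fin 3 → CovectorField (𝓡∂ 3) S := fun i x => a i x

/-- The functions underlying a triple of smooth functions. -/
def fn (f : Fin 3 → ScalarField S) : Fin 3 → S → ℝ := fun i x => f i x

/-- The straight line `q + s Y`. -/
def Fields.move (q : Fields S) (s : ℝ) (Y : Fields S) : Fields S :=
  ⟨q.Aperp + s • Y.Aperp, q.A + s • Y.A, q.eperp + s • Y.eperp, q.e + s • Y.e⟩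

/-- The straight line `z + s Y`. -/
def PhasePoint.move (z : PhasePoint S) (s : ℝ) (Y : PhasePoint S) : PhasePoint S :=
  ⟨z.q.move s Y.q, ⟨z.m.Pperp + s • Y.m.Pperp, z.m.P + s • Y.m.P, z.m.pperp + s • Y.m.pperp,
    z.m.p + s • Y.m.p⟩⟩

/-- The differential in phase space, at `z`, of a function `f`, in the direction `Y`. -/
def phaseD (f : PhasePoint S → ℝ) (z Y : PhasePoint S) : ℝ :=
  deriv (fun s : ℝ => f (z.move s Y)) 0

/-- `α₁ ε_{ijk} e^j ∧ e^k + 2 α₃ F_i + α₅ D e_i`. -/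
def PiA (α : Couplings) (q : Fields S) (i : Fin 3) : TwoForm (𝓡∂ 3) S := fun x u v =>
  α.α₁ * epsWedge (cov q.e) i x u v + 2 * α.α₃ * curv (cov q.A) i x u v +
    α.α₅ * covD1 (cov q.A) (cov q.e) i x u v

/-- `2 α₂ D e_i + α₄ ε_{ijk} e^j ∧ e^k + α₅ F_i`. -/
def PiE (α : Couplings) (q : Fields S) (i : Fin 3) : TwoForm (𝓡∂ 3) S := fun x u v =>
  2 * α.α₂ * covD1 (cov q.A) (cov q.e) i x u v + α.α₄ * epsWedge (cov q.e) i x u v +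
    α.α₅ * curv (cov q.A) i x u v

section Dynamics

variable [T2Space S] [CompactSpace S]

/-- The Hamiltonian
`∫ (D A_⊥^i ∧ Π_{A i} - 2 ε_{ijk} e_⊥^i e^j ∧ (α₁ F^k + α₄ D e^k)
  - (ε^i_{jk} A_⊥^j e^k - D e_⊥^i) ∧ Π_{e i})`. -/
def hamiltonian (α : Couplings) (z : PhasePoint S) : ℝ :=
  integral (S := S) fun x u v w =>
    (∑ i, wedge12 (covD0 (cov z.q.A) (fn z.q.Aperp) i) (PiA α z.q i) x u v w)
    - 2 * (∑ i, ∑ j, ∑ k, eps i j k * z.q.eperp i x *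
        wedge12 (cov z.q.e j)
          (fun x u v => α.α₁ * curv (cov z.q.A) k x u v +
            α.α₄ * covD1 (cov z.q.A) (cov z.q.e) k x u v) x u v w)
    - ∑ i, wedge12
        (fun x => epsContract (fn z.q.Aperp) (cov z.q.e) i x -
          covD0 (cov z.q.A) (fn z.q.eperp) i x)
        (PiE α z.q i) x u v w

/-- The primary constraint functions `C_{⊥ i}(w^i)`. -/
def primCAperp (w : Fin 3 → ScalarField S) (z : PhasePoint S) : ℝ := z.m.Pperp w

/-- The primary constraint functions `C_i(w^i)`. -/
def primCA (α : Couplings) (w : Fin 3 → OneForm S) (z : PhasePoint S) : ℝ :=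
  z.m.P w - integral (S := S) fun x a b c => ∑ i, wedge12 (cov w i) (PiA α z.q i) x a b c

/-- The primary constraint functions `c_{⊥ i}(w^i)`. -/
def primCeperp (w : Fin 3 → ScalarField S) (z : PhasePoint S) : ℝ := z.m.pperp w

/-- The primary constraint functions `c_i(w^i)`. -/
def primCe (α : Couplings) (w : Fin 3 → OneForm S) (z : PhasePoint S) : ℝ :=
  z.m.p w - integral (S := S) fun x a b c => ∑ i, wedge12 (cov w i) (PiE α z.q i) x a b c

/-- The canonical symplectic form of the cotangent bundle. -/
def symplecticForm (X Y : PhasePoint S) : ℝ :=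
  Y.m.Pperp X.q.Aperp - X.m.Pperp Y.q.Aperp + Y.m.P X.q.A - X.m.P Y.q.A +
    Y.m.pperp X.q.eperp - X.m.pperp Y.q.eperp + Y.m.p X.q.e - X.m.p Y.q.e

/-- `X` solves Dirac's equation at `z`: for some multipliers, for every tangent vector `Y`,
`Ω(X, Y) = dH(Y) + ⟨λ_⊥|dC_⊥⟩(Y) + ⟨λ|dC⟩(Y) + ⟨μ_⊥|dc_⊥⟩(Y) + ⟨μ|dc⟩(Y)`. -/
def SolvesDirac (α : Couplings) (z X : PhasePoint S) : Prop :=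
  ∃ (lamPerp : Fin 3 → ScalarField S) (lam : Fin 3 → OneForm S)
    (muPerp : Fin 3 → ScalarField S) (mu : Fin 3 → OneForm S),
    ∀ Y : PhasePoint S,
      symplecticForm X Y =
        phaseD (hamiltonian α) z Y + phaseD (primCAperp lamPerp) z Y +
          phaseD (primCA α lam) z Y + phaseD (primCeperp muPerp) z Y + phaseD (primCe α mu) z Y

/-- `X` is tangent at `z` to the submanifold defined by the primary constraints. -/
def TangentToPrimary (α : Couplings) (z X : PhasePoint S) : Prop :=
  (∀ w, phaseD (primCAperp w) z X = 0) ∧ (∀ w, phaseD (primCA α w) z X = 0) ∧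
    (∀ w, phaseD (primCeperp w) z X = 0) ∧ (∀ w, phaseD (primCe α w) z X = 0)

/-- `X` is a value at `z` of a Hamiltonian vector field of the constrained system. -/
def IsHamiltonianVector (α : Couplings) (z X : PhasePoint S) : Prop :=
  SolvesDirac α z X ∧ TangentToPrimary α z X

/-- The curve `γ` has velocity `X` at time `t`, component by component. -/
def HasVelocityAt (γ : ℝ → PhasePoint S) (X : PhasePoint S) (t : ℝ) : Prop :=
  (∀ i x, HasDerivAt (fun s => (γ s).q.Aperp i x) (X.q.Aperp i x) t) ∧
  (∀ i x v, HasDerivAt (fun s => cov (γ s).q.A i x v) (cov X.q.A i x v) t) ∧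
  (∀ i x, HasDerivAt (fun s => (γ s).q.eperp i x) (X.q.eperp i x) t) ∧
  (∀ i x v, HasDerivAt (fun s => cov (γ s).q.e i x v) (cov X.q.e i x v) t) ∧
  (∀ w, HasDerivAt (fun s => (γ s).m.Pperp w) (X.m.Pperp w) t) ∧
  (∀ w, HasDerivAt (fun s => (γ s).m.P w) (X.m.P w) t) ∧
  (∀ w, HasDerivAt (fun s => (γ s).m.pperp w) (X.m.pperp w) t) ∧
  (∀ w, HasDerivAt (fun s => (γ s).m.p w) (X.m.p w) t)

/-- The primary constraints. -/
def PrimaryConstraints (α : Couplings) (z : PhasePoint S) : Prop :=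
  (∀ w, primCAperp w z = 0) ∧ (∀ w, primCA α w z = 0) ∧
    (∀ w, primCeperp w z = 0) ∧ (∀ w, primCe α w z = 0)

end Dynamics

/-- The secondary constraints in the bulk,
`(α₁ - α₂) ε_{ijk} e^j ∧ F^k = 0` and `(α₁ - α₂) ε_{ijk} D e^j ∧ e^k = 0`. -/
def BulkConstraints (α : Couplings) (q : Fields S) : Prop :=
  ∀ (i : Fin 3) (x : S) (u v w : TangentSpace (𝓡∂ 3) x),
    (α.α₁ - α.α₂) * (∑ j, ∑ k, eps i j k *
        wedge12 (cov q.e j) (curv (cov q.A) k) x u v w) = 0 ∧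
    (α.α₁ - α.α₂) * (∑ j, ∑ k, eps i j k *
        wedge21 (covD1 (cov q.A) (cov q.e) j) (cov q.e k) x u v w) = 0

/-- The coefficient of `ε_{ijk} e^j ∧ e^k` in the boundary equation for the curvature. -/
def curvCoeff (α : Couplings) : ℝ :=
  (2 * α.α₁ * α.α₂ - α.α₄ * α.α₅) / (α.α₅ ^ 2 - 4 * α.α₂ * α.α₃)

/-- The coefficient of `ε_{ijk} e^j ∧ e^k` in the boundary equation for the torsion. -/
def torsionCoeff (α : Couplings) : ℝ :=
  (2 * α.α₃ * α.α₄ - α.α₁ * α.α₅) / (α.α₅ ^ 2 - 4 * α.α₂ * α.α₃)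

variable {N : Type*} [TopologicalSpace N] [ChartedSpace (EuclideanSpace ℝ (Fin 2)) N]

/-- The secondary constraints on the boundary: the pullbacks to the boundary of
`F^i - κ ε_{ijk} e^j ∧ e^k` and `D e^i - θ ε_{ijk} e^j ∧ e^k` vanish. -/
def BoundaryConstraints (α : Couplings) (ι : N → S) (q : Fields S) : Prop :=
  ∀ (i : Fin 3) (y : N) (u v : TangentSpace (𝓡 2) y),
    curv (cov q.A) i (ι y) (mfderiv (𝓡 2) (𝓡∂ 3) ι y u) (mfderiv (𝓡 2) (𝓡∂ 3) ι y v) =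
      curvCoeff α *
        epsWedge (cov q.e) i (ι y) (mfderiv (𝓡 2) (𝓡∂ 3) ι y u)
          (mfderiv (𝓡 2) (𝓡∂ 3) ι y v) ∧
    covD1 (cov q.A) (cov q.e) i (ι y) (mfderiv (𝓡 2) (𝓡∂ 3) ι y u)
        (mfderiv (𝓡 2) (𝓡∂ 3) ι y v) =
      torsionCoeff α *
        epsWedge (cov q.e) i (ι y) (mfderiv (𝓡 2) (𝓡∂ 3) ι y u)
          (mfderiv (𝓡 2) (𝓡∂ 3) ι y v)

/-- The one-forms `V_A`, `V_e` solve `ε_{ijk} e^j ∧ V_A^k = ε_{ijk} e_⊥^j F^k` and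
`ε_{ijk} e^j ∧ V_e^k = ε_{ijk} e_⊥^j D e^k`. -/
def AreMultiplierForms (q : Fields S) (VA Ve : Fin 3 → OneForm S) : Prop :=
  ∀ (i : Fin 3) (x : S) (u v : TangentSpace (𝓡∂ 3) x),
    (∑ j, ∑ k, eps i j k * wedge11 (cov q.e j) (cov VA k) x u v) =
      ∑ j, ∑ k, eps i j k * q.eperp j x * curv (cov q.A) k x u v ∧
    (∑ j, ∑ k, eps i j k * wedge11 (cov q.e j) (cov Ve k) x u v) =
      ∑ j, ∑ k, eps i j k * q.eperp j x * covD1 (cov q.A) (cov q.e) k x u v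

/-- The consistency constraints between bulk and boundary: the pullbacks to the boundary of
`V_A^i - 2 κ ε_{ijk} e_⊥^j e^k` and `V_e^i - 2 θ ε_{ijk} e_⊥^j e^k` vanish. -/
def ConsistencyConstraints (α : Couplings) (ι : N → S) (q : Fields S)
    (VA Ve : Fin 3 → OneForm S) : Prop :=
  ∀ (i : Fin 3) (y : N) (u : TangentSpace (𝓡 2) y),
    pullback (I' := 𝓡 2) ι (cov VA i) y u =
      2 * curvCoeff α * pullback (I' := 𝓡 2) ι (epsContract (fn q.eperp) (cov q.e) i) y u ∧
    pullback (I' := 𝓡 2) ι (cov Ve i) y u =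
      2 * torsionCoeff α * pullback (I' := 𝓡 2) ι (epsContract (fn q.eperp) (cov q.e) i) y u

/-- At the boundary point `ι y`, the value `r` of an `so(3)`-valued scalar satisfies
`ι^*(ε_{ijk} r^i e^j ∧ e^k) = 0`. -/
def SectorAt (ι : N → S) (e : Fin 3 → OneForm S) (y : N) (r : Fin 3 → ℝ) : Prop :=
  ∀ u v : TangentSpace (𝓡 2) y,
    ∑ i, r i * epsWedge (cov e) i (ι y) (mfderiv (𝓡 2) (𝓡∂ 3) ι y u)
      (mfderiv (𝓡 2) (𝓡∂ 3) ι y v) = 0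

/-- The sector condition `ι^*(ε_{ijk} e_⊥^i e^j ∧ e^k) = 0`. -/
def InSector (ι : N → S) (q : Fields S) : Prop :=
  ∀ y : N, SectorAt ι q.e y (fun i => q.eperp i (ι y))

end PhaseSpace

/-! ### Three-dimensional Euclidean gravity with torsion on the boundary -/

/-- The time-dependent fields `A`, `τ`, `e`, `r` on the surface `N` satisfy at time `t` the field
equations `F^i = κ ε^i_{jk} e^j ∧ e^k`, `D e^i = θ ε^i_{jk} e^j ∧ e^k` of three-dimensional
Euclidean gravity on `ℝ × N` for the connection `A^i + τ^i dt` and the triad `e^i + r^i dt`,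
decomposed into their spatial components (constraints) and their `dt` components (evolution). -/
structure IsEuclideanGravityAt {N : Type*} [TopologicalSpace N]
    [ChartedSpace (EuclideanSpace ℝ (Fin 2)) N] (κ θ : ℝ)
    (A : ℝ → Fin 3 → CovectorField (𝓡 2) N) (τ : ℝ → Fin 3 → N → ℝ)
    (e : ℝ → Fin 3 → CovectorField (𝓡 2) N) (r : ℝ → Fin 3 → N → ℝ) (t : ℝ) : Prop where
  curvature : ∀ i y u v, curv (A t) i y u v = κ * epsWedge (e t) i y u v
  torsion : ∀ i y u v, covD1 (A t) (e t) i y u v = θ * epsWedge (e t) i y u v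
  connection_evolution : ∀ i y u, HasDerivAt (fun s => A s i y u)
    (covD0 (A t) (τ t) i y u + 2 * κ * epsContract (r t) (e t) i y u) t
  triad_evolution : ∀ i y u, HasDerivAt (fun s => e s i y u)
    (covD0 (A t) (r t) i y u - epsContract (τ t) (e t) i y u +
      2 * θ * epsContract (r t) (e t) i y u) t

end HKBoundary

end

/-! Dirac's equation is an identity between integrals over `S`, linear in an arbitrary variation. In
the momentum directions the Hamiltonian and all the integrals are constant, so every linear
functional takes the same values on the multipliers λ, μ as on X_A, X_e; functionals separate
points, hence λ = X_A and μ = X_e (`SolvesDirac.multipliers`). In the directions (a, b) of A and e,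
tangency to the primary constraints eliminates the momentum components of X, and there remains ∫
`diracForm` = 0 for all a, b (`IsHamiltonianVector.integral_diracForm`).

Let V_A = X_A - D A_⊥ and V_e = X_e - D e_⊥ + ε A_⊥ e. Gauge covariance and the Ricci identity DDτ =
εFτ cancel every term in A_⊥, and the integrand splits into a bulk term and an exact term
(`diracForm_connection`, `diracForm_triad`): 2(α₁-α₂) a ∧ (ε e∧V_e - ε e_⊥ De) + d(W∧a), with W =
2α₃V_A + α₅V_e + 2α₁ ε e_⊥ e; -2(α₁-α₂) b ∧ (ε e∧V_A - ε e_⊥ F) + d(W'∧b), with W' = 2α₂V_e + α₅V_A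
+ 2α₄ ε e_⊥ e. Test forms ψ dy_m supported in one chart turn this into a variational statement on
the half-space. Interior test functions kill the bulk coefficient, which then vanishes up to the
boundary by continuity; the remaining flux through the boundary plane kills W and W' on tangent
vectors of the boundary (`halfSpace_fundamental_lemma`, `flux_localization`). There W = W' = 0 is a
linear system for V_A, V_e with determinant 4α₂α₃-α₅², and its solution is the pair of consistency
constraints.

In the bulk, the coframe turns e_⊥ into a vector field ρ with i_ρ e = e_⊥. Contracting the secondary
constraint ε e∧F = 0 with ρ gives ε e∧i_ρF = ε e_⊥ F, and ε e∧· is injective for a coframe, so V_A =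
i_ρF; in the same way V_e = i_ρ De (`multiplier_eq_contraction`). Cartan's formula then converts X_A
and X_e into Lie derivatives plus gauge transformations.

On the boundary, pulling back the formulas for X_A and X_e and inserting the consistency constraints
gives the evolution equations of three-dimensional gravity. The sector condition reads n·e_⊥ = 0,
where n is twice the cross product of the frame components of two tangent vectors; n ≠ 0, and Σ n_i
e^i is a functional whose kernel is the tangent plane of the boundary, so ρ is tangent to it. -/

namespace HKBoundary

open Set Filter Topology MeasureTheory

/-! ### Naturality of the exterior derivative in vector spaces. -/

section Calculus

variable {E : Type*} [NormedAddCommGroup E] [NormedSpace ℝ E]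
  {E' : Type*} [NormedAddCommGroup E'] [NormedSpace ℝ E']

/-- The exterior derivative of one-forms on vector spaces commutes with pullbacks. -/
theorem curl_pullback {s : Set E'} {t : Set E} {α : E → E →L[ℝ] ℝ} {β : E' → E' →L[ℝ] ℝ}
    {Φ : E' → E} {y : E'} (hΦ : ContDiffWithinAt ℝ 2 Φ s y) (hst : MapsTo Φ s t)
    (hα : DifferentiableWithinAt ℝ α t (Φ y)) (hs : UniqueDiffOn ℝ s) (hy : y ∈ s)
    (hys : y ∈ closure (interior s))
    (hβ : β =ᶠ[𝓝[s] y] fun y' => (α (Φ y')).comp (fderivWithin ℝ Φ s y')) (u v : E') :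
    fderivWithin ℝ β s y u v - fderivWithin ℝ β s y v u =
      fderivWithin ℝ α t (Φ y) (fderivWithin ℝ Φ s y u) (fderivWithin ℝ Φ s y v) -
        fderivWithin ℝ α t (Φ y) (fderivWithin ℝ Φ s y v) (fderivWithin ℝ Φ s y u) := by
  -- The product rule produces the pulled-back derivative of `α` and a term with the second
  -- derivative of `Φ`; the latter is symmetric and drops out on antisymmetrization.
  have hsym : IsSymmSndFDerivWithinAt ℝ Φ s y :=
    hΦ.isSymmSndFDerivWithinAt (by simp) hs hys hy
  have hΦ1 : DifferentiableWithinAt ℝ Φ s y := hΦ.differentiableWithinAt (by norm_num)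
  have hΦ2 : DifferentiableWithinAt ℝ (fderivWithin ℝ Φ s) s y :=
    (hΦ.fderivWithin_right (m := 1) hs (by norm_num) hy).differentiableWithinAt (by norm_num)
  have hU := hs y hy
  have hc : HasFDerivWithinAt (fun y' => α (Φ y')) ((fderivWithin ℝ α t (Φ y)).comp
      (fderivWithin ℝ Φ s y)) s y := hα.hasFDerivWithinAt.comp y hΦ1.hasFDerivWithinAt hst
  have key := (hc.clm_comp hΦ2.hasFDerivWithinAt).congr_of_eventuallyEq hβ
    (hβ.self_of_nhdsWithin hy)
  rw [key.fderivWithin hU]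
  have := hsym u v
  simp [this]

end Calculus

/-! ### Coordinate expressions of forms and independence of the chart. -/

section Coordinates

variable {E : Type*} [NormedAddCommGroup E] [NormedSpace ℝ E] {H : Type*} [TopologicalSpace H]
  {I : ModelWithCorners ℝ E H} {M : Type*} [TopologicalSpace M] [ChartedSpace H M]
  {E' : Type*} [NormedAddCommGroup E'] [NormedSpace ℝ E'] {H' : Type*} [TopologicalSpace H']
  {I' : ModelWithCorners ℝ E' H'} {N : Type*} [TopologicalSpace N] [ChartedSpace H' N]

/-- The fibres over `p` and `q` are different types that both unfold to the model space; the
ascription to `E` makes the equation well typed, so that base points such as `φ.symm (φ x)` and `x`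
can be exchanged. -/
theorem covectorField_congr (a : CovectorField I M) {p q : M} (h : p = q) :
    (show E →L[ℝ] ℝ from a p) = (show E →L[ℝ] ℝ from a q) := by
  subst h; rfl

theorem coordRep_comp_mfderiv [IsManifold I 1 M] (a : CovectorField I M) {c p : M}
    (hp : p ∈ (extChartAt I c).source) (v : E) :
    coordRep a c (extChartAt I c p) (mfderiv I 𝓘(ℝ, E) (extChartAt I c) p v) = a p v := by
  have h := mfderivWithin_extChartAt_symm_comp_mfderiv_extChartAt' (I := I) hp
  have h1 : coordPush I c (extChartAt I c p) (mfderiv I 𝓘(ℝ, E) (extChartAt I c) p v) = v :=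
    congrArg (fun f : E →L[ℝ] E => f v) h
  have h2 := covectorField_congr a ((extChartAt I c).left_inv hp)
  change (show E →L[ℝ] ℝ from a _) (coordPush I c (extChartAt I c p)
    (mfderiv I 𝓘(ℝ, E) (extChartAt I c) p v)) = _
  rw [h1]
  exact congrArg (fun f : E →L[ℝ] ℝ => f v) h2

theorem mfderiv_comp_coordPush [IsManifold I 1 M] {c : M} {y : E}
    (hy : y ∈ (extChartAt I c).target) (v : E) :
    mfderiv I 𝓘(ℝ, E) (extChartAt I c) ((extChartAt I c).symm y) (coordPush I c y v) = v :=
  congrArg (fun f : E →L[ℝ] E => f v)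
    (mfderiv_extChartAt_comp_mfderivWithin_extChartAt_symm (I := I) hy)

theorem coordPush_comp_mfderiv [IsManifold I 1 M] {c : M} {y : E}
    (hy : y ∈ (extChartAt I c).target) (v : E) :
    coordPush I c y
      (mfderiv I 𝓘(ℝ, E) (extChartAt I c) ((extChartAt I c).symm y) v) = v :=
  congrArg (fun f : E →L[ℝ] E => f v)
    (mfderivWithin_extChartAt_symm_comp_mfderiv_extChartAt (I := I) hy)

theorem mfderiv_chart_self [IsManifold I 1 M] (x : M) (v : E) :
    mfderiv I 𝓘(ℝ, E) (extChartAt I x) x v = v :=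
  congrArg (fun f : E →L[ℝ] E => f v) (mfderiv_extChartAt_self (I := I) (x := x))

theorem coordRep_self [IsManifold I 1 M] (a : CovectorField I M) (x : M) (v : E) :
    coordRep a x (extChartAt I x x) v = a x v := by
  have := coordRep_comp_mfderiv a (mem_extChartAt_source (I := I) x) v
  rwa [mfderiv_chart_self] at this

theorem extD1_eq [IsManifold I 1 M] (a : CovectorField I M) (x : M) (u v : E) :
    extD1 a x u v = fderivWithin ℝ (coordRep a x) (range I) (extChartAt I x x) u v -
      fderivWithin ℝ (coordRep a x) (range I) (extChartAt I x x) v u := by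
  have hu := mfderiv_chart_self (I := I) x u
  have hv := mfderiv_chart_self (I := I) x v
  simp only [extD1, hu, hv]

/-- A map written in extended charts. -/
noncomputable def chartMap (I' : ModelWithCorners ℝ E' H') (I : ModelWithCorners ℝ E H) (f : N → M) (d : N)
    (c : M) (y : E') : E :=
  extChartAt I c (f ((extChartAt I' d).symm y))

theorem chartMap_mapsTo (f : N → M) (d : N) (c : M) :
    MapsTo (chartMap I' I f d c) (range I') (range I) := fun y _ => by
  simp [chartMap]

theorem chartMap_contDiffWithinAt [IsManifold I ∞ M] [IsManifold I' ∞ N] {f : N → M}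
    (hf : ContMDiff I' I ∞ f) {d : N} {c : M} {y : E'} (hy : y ∈ (extChartAt I' d).target)
    (hc : f ((extChartAt I' d).symm y) ∈ (extChartAt I c).source) :
    ContDiffWithinAt ℝ ∞ (chartMap I' I f d c) (range I') y := by
  rw [← contMDiffWithinAt_iff_contDiffWithinAt]
  have h1 := contMDiffWithinAt_extChartAt_symm_range (I := I') (n := ∞) d hy
  have h2 : ContMDiffAt I 𝓘(ℝ, E) ∞ (extChartAt I c) (f ((extChartAt I' d).symm y)) :=
    contMDiffAt_extChartAt' (by simpa using hc)
  exact (h2.comp _ (hf _)).comp_contMDiffWithinAt y h1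

theorem fderivWithin_chartMap [IsManifold I ∞ M] [IsManifold I' ∞ N] {f : N → M}
    (hf : ContMDiff I' I ∞ f) {d : N} {c : M} {y : E'} (hy : y ∈ (extChartAt I' d).target)
    (hc : f ((extChartAt I' d).symm y) ∈ (extChartAt I c).source) (v : E') :
    fderivWithin ℝ (chartMap I' I f d c) (range I') y v =
      mfderiv I 𝓘(ℝ, E) (extChartAt I c) (f ((extChartAt I' d).symm y))
        (mfderiv I' I f ((extChartAt I' d).symm y) (coordPush I' d y v)) := by
  have : IsManifold I 1 M := .of_le (n := ∞) (by norm_cast)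
  have : IsManifold I' 1 N := .of_le (n := ∞) (by norm_cast)
  have hr := extChartAt_target_subset_range d hy
  have hU : UniqueMDiffWithinAt 𝓘(ℝ, E') (range I') y := by
    exact (I'.uniqueDiffOn y hr).uniqueMDiffWithinAt
  have h1 : HasMFDerivWithinAt 𝓘(ℝ, E') I' (extChartAt I' d).symm (range I') y
      (coordPush I' d y) := (mdifferentiableWithinAt_extChartAt_symm hy).hasMFDerivWithinAt
  have h2 := ((hf.mdifferentiable (by simp)) ((extChartAt I' d).symm y)).hasMFDerivAt
  have h3 : HasMFDerivAt I 𝓘(ℝ, E) (extChartAt I c) (f ((extChartAt I' d).symm y)) _ :=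
    (mdifferentiableAt_extChartAt (by simpa using hc)).hasMFDerivAt
  have h4 := (h3.comp _ h2).comp_hasMFDerivWithinAt y h1
  have h5 := h4.mfderivWithin hU
  rw [← mfderivWithin_eq_fderivWithin]
  exact congrArg (fun f : E' →L[ℝ] E => f v) h5

theorem coordRep_pullback [IsManifold I ∞ M] [IsManifold I' ∞ N] (a : CovectorField I M)
    {f : N → M} (hf : ContMDiff I' I ∞ f) {d : N} {c : M} {y : E'}
    (hy : y ∈ (extChartAt I' d).target)
    (hc : f ((extChartAt I' d).symm y) ∈ (extChartAt I c).source) :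
    coordRep (pullback (I' := I') f a) d y =
      (coordRep a c (chartMap I' I f d c y)).comp
        (fderivWithin ℝ (chartMap I' I f d c) (range I') y) := by
  have : IsManifold I 1 M := .of_le (n := ∞) (by norm_cast)
  ext v
  rw [ContinuousLinearMap.comp_apply, fderivWithin_chartMap hf hy hc]
  exact (coordRep_comp_mfderiv a hc _).symm

/-- Near `y` the coordinate expression of the pulled-back form is the Euclidean pullback by
`chartMap`, so `curl_pullback` applies. Both charts are arbitrary, which covers changes of charts as
well as maps between manifolds. -/
theorem extD1_pullback_chart [IsManifold I ∞ M] [IsManifold I' ∞ N] (a : CovectorField I M)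
    {f : N → M} (hf : ContMDiff I' I ∞ f) {d : N} {c : M} {y : E'}
    (hy : y ∈ (extChartAt I' d).target)
    (hc : f ((extChartAt I' d).symm y) ∈ (extChartAt I c).source)
    (ha : DifferentiableWithinAt ℝ (coordRep a c) (range I) (chartMap I' I f d c y)) (u v : E') :
    fderivWithin ℝ (coordRep (pullback (I' := I') f a) d) (range I') y u v -
        fderivWithin ℝ (coordRep (pullback (I' := I') f a) d) (range I') y v u =
      fderivWithin ℝ (coordRep a c) (range I) (chartMap I' I f d c y)
        (fderivWithin ℝ (chartMap I' I f d c) (range I') y u)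
        (fderivWithin ℝ (chartMap I' I f d c) (range I') y v) -
      fderivWithin ℝ (coordRep a c) (range I) (chartMap I' I f d c y)
        (fderivWithin ℝ (chartMap I' I f d c) (range I') y v)
        (fderivWithin ℝ (chartMap I' I f d c) (range I') y u) := by
  have hr := extChartAt_target_subset_range d hy
  refine curl_pullback ((chartMap_contDiffWithinAt hf hy hc).of_le (by norm_cast))
    (chartMap_mapsTo f d c) ha I'.uniqueDiffOn hr (I'.range_subset_closure_interior hr) ?_ u v
  have hcont : ContinuousWithinAt (fun y => f ((extChartAt I' d).symm y)) (range I') y :=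
    (hf.continuous.continuousAt).comp_continuousWithinAt
      ((contMDiffWithinAt_extChartAt_symm_range (I := I') (n := ∞) d hy).continuousWithinAt)
  filter_upwards [extChartAt_target_mem_nhdsWithin_of_mem hy,
    hcont ((isOpen_extChartAt_source (I := I) c).mem_nhds hc)] with z hz hz'
  exact coordRep_pullback a hf hz hz'

theorem pullback_id (a : CovectorField I M) : pullback (I' := I) id a = a := by
  funext x
  simp only [pullback, mfderiv_id]
  exact ContinuousLinearMap.comp_id _

/-- The exterior derivative of a one-form in an arbitrary chart. -/
theorem extD1_coordPush [IsManifold I ∞ M] (a : CovectorField I M) {c : M} {y : E}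
    (hy : y ∈ (extChartAt I c).target)
    (ha : DifferentiableWithinAt ℝ (coordRep a ((extChartAt I c).symm y)) (range I)
      (extChartAt I ((extChartAt I c).symm y) ((extChartAt I c).symm y))) (u v : E) :
    extD1 a ((extChartAt I c).symm y) (coordPush I c y u) (coordPush I c y v) =
      fderivWithin ℝ (coordRep a c) (range I) y u v -
        fderivWithin ℝ (coordRep a c) (range I) y v u := by
  have : IsManifold I 1 M := .of_le (n := ∞) (by norm_cast)
  have hsrc := mem_extChartAt_source (I := I) ((extChartAt I c).symm y)
  -- Pulling back along the identity, from the chart at `c` to the chart at the point itself, is a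
  -- change of charts.
  have h := extD1_pullback_chart (I' := I) a (f := id) contMDiff_id hy hsrc ha u v
  rw [pullback_id] at h
  have hd : ∀ w, fderivWithin ℝ (chartMap I I id c ((extChartAt I c).symm y)) (range I) y w =
      coordPush I c y w := fun w => by
    rw [fderivWithin_chartMap contMDiff_id hy hsrc]
    simp only [mfderiv_id, id]
    exact mfderiv_chart_self _ _
  rw [h, hd, hd]
  exact extD1_eq a _ _ _

/-- The exterior derivative commutes with pullbacks. -/
theorem extD1_pullback [IsManifold I ∞ M] [IsManifold I' ∞ N] (a : CovectorField I M)
    {f : N → M} (hf : ContMDiff I' I ∞ f) (x : N)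
    (ha : DifferentiableWithinAt ℝ (coordRep a (f x)) (range I) (extChartAt I (f x) (f x)))
    (u v : TangentSpace I' x) :
    extD1 (pullback (I' := I') f a) x u v = extD1 a (f x) (mfderiv I' I f x u)
      (mfderiv I' I f x v) := by
  have : IsManifold I 1 M := .of_le (n := ∞) (by norm_cast)
  have : IsManifold I' 1 N := .of_le (n := ∞) (by norm_cast)
  have hx := mem_extChartAt_target (I := I') x
  have hl : (extChartAt I' x).symm (extChartAt I' x x) = x := extChartAt_to_inv x
  have hc : f ((extChartAt I' x).symm (extChartAt I' x x)) ∈ (extChartAt I (f x)).source := by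
    rw [hl]; exact mem_extChartAt_source (f x)
  have hm : chartMap I' I f x (f x) (extChartAt I' x x) = extChartAt I (f x) (f x) := by
    simp only [chartMap, hl]
  have h := extD1_pullback_chart a hf hx hc (by rwa [hm]) u v
  have hd : ∀ w : E', fderivWithin ℝ (chartMap I' I f x (f x)) (range I') (extChartAt I' x x) w =
      mfderiv I' I f x w := fun w => by
    have h1 := fderivWithin_chartMap hf hx hc
      (mfderiv I' 𝓘(ℝ, E') (extChartAt I' x) ((extChartAt I' x).symm (extChartAt I' x x)) w)
    rw [coordPush_comp_mfderiv hx] at h1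
    rw [hl] at h1
    rw [mfderiv_chart_self] at h1
    exact h1.trans (mfderiv_chart_self _ _)
  refine (extD1_eq (E := E') _ x u v).trans (Eq.trans ?_ (extD1_eq (E := E) a (f x) _ _).symm)
  refine h.trans ?_
  rw [hm]
  exact congrArg₂ (fun p q : E => fderivWithin ℝ (coordRep a (f x)) (range I)
    (extChartAt I (f x) (f x)) p q - fderivWithin ℝ (coordRep a (f x)) (range I)
    (extChartAt I (f x) (f x)) q p) (hd u) (hd v)

end Coordinates

/-- The model vector space of the spatial manifold. -/
abbrev E3 : Type := EuclideanSpace ℝ (Fin 3)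

/-! ### Smooth sections in terms of their chart expressions. -/

section Smoothness

variable {S : Type*} [TopologicalSpace S] [ChartedSpace (EuclideanHalfSpace 3) S]

/-- The trivialization of the cotangent bundle at `c` is composition with the differential of the
inverse chart. This ties smooth sections of the bundle to the concrete `coordRep`. -/
theorem trivialization_covector [IsManifold (𝓡∂ 3) ∞ S]
    (a : CovectorField (𝓡∂ 3) S) (c x : S)
    (hx : x ∈ (extChartAt (𝓡∂ 3) c).source) :
    (trivializationAt (E3 →L[ℝ] ℝ)
      (fun x : S => TangentSpace (𝓡∂ 3) x →L[ℝ] Bundle.Trivial S ℝ x) c ⟨x, a x⟩).2 =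
      coordRep a c (extChartAt (𝓡∂ 3) c x) := by
  have : IsManifold (𝓡∂ 3) 1 S := .of_le (n := ∞) (by norm_cast)
  have hx' : x ∈ (chartAt (EuclideanHalfSpace 3) c).source := by simpa using hx
  rw [hom_trivializationAt_apply]
  simp only [ContinuousLinearMap.inCoordinates]
  rw [TangentBundle.symmL_trivializationAt hx']
  ext v
  have h2 := covectorField_congr a ((extChartAt (𝓡∂ 3) c).left_inv hx)
  have h3 : coordRep a c (extChartAt (𝓡∂ 3) c x) v =
    (show E3 →L[ℝ] ℝ from a ((extChartAt (𝓡∂ 3) c).symm (extChartAt (𝓡∂ 3) c x)))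
      (coordPush (𝓡∂ 3) c (extChartAt (𝓡∂ 3) c x) v) := rfl
  rw [h3, h2]
  simp
  rfl

theorem trivialization_vector [IsManifold (𝓡∂ 3) ∞ S]
    (ρ : ∀ x : S, TangentSpace (𝓡∂ 3) x) (c x : S)
    (hx : x ∈ (extChartAt (𝓡∂ 3) c).source) :
    (trivializationAt E3 (fun x : S => TangentSpace (𝓡∂ 3) x) c ⟨x, ρ x⟩).2 =
      coordVec ρ c (extChartAt (𝓡∂ 3) c x) := by
  have : IsManifold (𝓡∂ 3) 1 S := .of_le (n := ∞) (by norm_cast)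
  have hx' : x ∈ (chartAt (EuclideanHalfSpace 3) c).source := by simpa using hx
  have h := TangentBundle.continuousLinearMapAt_trivializationAt (I := 𝓡∂ 3) hx'
  have h1 := congrArg (fun f : E3 →L[ℝ] E3 => f (ρ x)) h
  simp only [coordVec]
  rw [(extChartAt (𝓡∂ 3) c).left_inv hx]
  refine Eq.trans ?_ h1
  exact (Bundle.Trivialization.continuousLinearMapAt_apply_of_mem (R := ℝ) _ (by simpa using hx') _).symm

theorem chart_smooth_iff {F : Type*} [NormedAddCommGroup F] [NormedSpace ℝ F]
    [IsManifold (𝓡∂ 3) ∞ S] {g : S → F} {f : E3 → F} {c : S}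
    (h : ∀ x ∈ (extChartAt (𝓡∂ 3) c).source, g x = f (extChartAt (𝓡∂ 3) c x)) :
    ContMDiffOn (𝓡∂ 3) 𝓘(ℝ, F) ∞ g (extChartAt (𝓡∂ 3) c).source ↔
      ContDiffOn ℝ ∞ f (extChartAt (𝓡∂ 3) c).target := by
  constructor
  · intro hg
    rw [← contMDiffOn_iff_contDiffOn]
    refine (hg.comp (contMDiffOn_extChartAt_symm (I := 𝓡∂ 3) (n := ∞) c)
      fun y hy => (extChartAt (𝓡∂ 3) c).map_target hy).congr fun y hy => ?_
    rw [Function.comp_apply, h _ ((extChartAt (𝓡∂ 3) c).map_target hy),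
      (extChartAt (𝓡∂ 3) c).right_inv hy]
  · intro hf
    rw [← contMDiffOn_iff_contDiffOn] at hf
    have h1 := hf.comp (contMDiffOn_extChartAt (I := 𝓡∂ 3) (n := ∞) (x := c))
      (by rw [← extChartAt_source (𝓡∂ 3)]; exact (extChartAt (𝓡∂ 3) c).mapsTo)
    rw [← extChartAt_source (𝓡∂ 3)] at h1
    exact h1.congr h

/-- A covector field which is smooth in all charts. -/
def SmoothCov (a : CovectorField (𝓡∂ 3) S) : Prop :=
  ∀ c, ContDiffOn ℝ ∞ (coordRep a c) (extChartAt (𝓡∂ 3) c).target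

/-- A function which is smooth in all charts. -/
def SmoothFn (f : S → ℝ) : Prop :=
  ∀ c, ContDiffOn ℝ ∞ (fun y => f ((extChartAt (𝓡∂ 3) c).symm y)) (extChartAt (𝓡∂ 3) c).target

/-- The chart domains are open, cover `S` and lie in the base sets of the trivializations, so
smoothness can be tested chart by chart. The bundle is left general because both covectors and
vectors are needed. -/
theorem contMDiff_of_charts {F : Type*} [NormedAddCommGroup F] [NormedSpace ℝ F]
    {V : S → Type*} [TopologicalSpace (Bundle.TotalSpace F V)] [∀ x, AddCommGroup (V x)]
    [∀ x, Module ℝ (V x)] [∀ x, TopologicalSpace (V x)] [FiberBundle F V] [VectorBundle ℝ F V]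
    [IsManifold (𝓡∂ 3) ∞ S] [ContMDiffVectorBundle ∞ F V (𝓡∂ 3)]
    {s : ∀ x, V x} {f : S → E3 → F}
    (hb : ∀ c, (extChartAt (𝓡∂ 3) c).source ⊆ (trivializationAt F V c).baseSet)
    (h : ∀ c, ∀ x ∈ (extChartAt (𝓡∂ 3) c).source,
      (trivializationAt F V c ⟨x, s x⟩).2 = f c (extChartAt (𝓡∂ 3) c x)) :
    ContMDiff (𝓡∂ 3) ((𝓡∂ 3).prod 𝓘(ℝ, F)) ∞ (fun x => Bundle.TotalSpace.mk' F x (s x)) ↔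
      ∀ c, ContDiffOn ℝ ∞ (f c) (extChartAt (𝓡∂ 3) c).target := by
  have key : ∀ c, ContMDiffOn (𝓡∂ 3) ((𝓡∂ 3).prod 𝓘(ℝ, F)) ∞
      (fun x => Bundle.TotalSpace.mk' F x (s x)) (extChartAt (𝓡∂ 3) c).source ↔
      ContDiffOn ℝ ∞ (f c) (extChartAt (𝓡∂ 3) c).target := fun c => by
    rw [Bundle.Trivialization.contMDiffOn_section_iff (trivializationAt F V c)
      (isOpen_extChartAt_source c) (hb c)]
    exact chart_smooth_iff (h c)
  simp only [← key]
  exact ⟨fun hs c => hs.contMDiffOn, fun hs x => (hs x).contMDiffAt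
    ((isOpen_extChartAt_source x).mem_nhds (mem_extChartAt_source x))⟩

variable [IsManifold (𝓡∂ 3) ∞ S]

theorem contMDiff_covector_iff (a : CovectorField (𝓡∂ 3) S) :
    ContMDiff (𝓡∂ 3) ((𝓡∂ 3).prod 𝓘(ℝ, E3 →L[ℝ] ℝ)) ∞
      (fun x => Bundle.TotalSpace.mk' (E3 →L[ℝ] ℝ)
        (E := fun x : S => TangentSpace (𝓡∂ 3) x →L[ℝ] Bundle.Trivial S ℝ x) x (a x)) ↔
      SmoothCov a :=
  contMDiff_of_charts (fun c x hx => by simpa using hx) (fun c x hx => trivialization_covector a c x hx)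

theorem contMDiff_vector_iff (ρ : ∀ x : S, TangentSpace (𝓡∂ 3) x) :
    ContMDiff (𝓡∂ 3) ((𝓡∂ 3).prod 𝓘(ℝ, E3)) ∞
      (fun x => Bundle.TotalSpace.mk' E3 (E := fun x : S => TangentSpace (𝓡∂ 3) x) x (ρ x)) ↔
      ∀ c, ContDiffOn ℝ ∞ (coordVec ρ c) (extChartAt (𝓡∂ 3) c).target :=
  contMDiff_of_charts (fun c x hx => by simpa using hx) (fun c x hx => trivialization_vector ρ c x hx)

theorem contMDiff_fn_iff (f : S → ℝ) : ContMDiff (𝓡∂ 3) 𝓘(ℝ, ℝ) ∞ f ↔ SmoothFn f := by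
  have key : ∀ c, ContMDiffOn (𝓡∂ 3) 𝓘(ℝ, ℝ) ∞ f (extChartAt (𝓡∂ 3) c).source ↔
      ContDiffOn ℝ ∞ (fun y => f ((extChartAt (𝓡∂ 3) c).symm y)) (extChartAt (𝓡∂ 3) c).target :=
    fun c => chart_smooth_iff fun x hx => by rw [(extChartAt (𝓡∂ 3) c).left_inv hx]
  simp only [SmoothFn, ← key]
  exact ⟨fun hs c => hs.contMDiffOn, fun hs x => (hs x).contMDiffAt
    ((isOpen_extChartAt_source x).mem_nhds (mem_extChartAt_source x))⟩

theorem OneForm.smoothCov (a : OneForm S) : SmoothCov (fun x => a x) :=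
  (contMDiff_covector_iff (fun x => a x)).1 a.contMDiff

theorem smoothCov_cov (a : Fin 3 → OneForm S) (i : Fin 3) : SmoothCov (cov a i) :=
  (a i).smoothCov

theorem smoothFn_scalar (f : ScalarField S) : SmoothFn (fun x => f x) :=
  (contMDiff_fn_iff _).1 f.contMDiff

/-- The one-form with a given smooth underlying covector field. -/
def SmoothCov.toOneForm {a : CovectorField (𝓡∂ 3) S} (ha : SmoothCov a) : OneForm S :=
  ⟨a, (contMDiff_covector_iff a).2 ha⟩

theorem SmoothCov.toOneForm_apply {a : CovectorField (𝓡∂ 3) S} (ha : SmoothCov a) (x : S) :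
    ha.toOneForm x = a x := rfl

omit [IsManifold (𝓡∂ 3) ∞ S]

theorem SmoothCov.add {a b : CovectorField (𝓡∂ 3) S} (ha : SmoothCov a) (hb : SmoothCov b) :
    SmoothCov (fun x => a x + b x) := fun c => by
  refine ((ha c).add (hb c)).congr fun y _ => ?_
  ext v; rfl

theorem SmoothCov.sub {a b : CovectorField (𝓡∂ 3) S} (ha : SmoothCov a) (hb : SmoothCov b) :
    SmoothCov (fun x => a x - b x) := fun c => by
  refine ((ha c).sub (hb c)).congr fun y _ => ?_
  ext v; rfl

theorem SmoothCov.smul {f : S → ℝ} {a : CovectorField (𝓡∂ 3) S} (hf : SmoothFn f)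
    (ha : SmoothCov a) : SmoothCov (fun x => f x • a x) := fun c => by
  refine ((hf c).smul (ha c)).congr fun y _ => ?_
  ext v; rfl

theorem SmoothCov.zero : SmoothCov (fun _ => 0 : CovectorField (𝓡∂ 3) S) := fun c =>
  (contDiffOn_const (c := (0 : E3 →L[ℝ] ℝ))).congr fun y _ => by ext v; rfl

theorem SmoothCov.sum {κ : Type*} (s : Finset κ) {a : κ → CovectorField (𝓡∂ 3) S}
    (ha : ∀ k, SmoothCov (a k)) : SmoothCov (fun x => ∑ k ∈ s, a k x) := by
  classical
  induction s using Finset.induction_on with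
  | empty => simpa using SmoothCov.zero
  | insert k s hk ih =>
    simp only [Finset.sum_insert hk]
    exact (ha k).add ih

theorem SmoothFn.const (r : ℝ) : SmoothFn (fun _ : S => r) := fun _ => contDiffOn_const

theorem SmoothFn.mul {f g : S → ℝ} (hf : SmoothFn f) (hg : SmoothFn g) :
    SmoothFn (fun x => f x * g x) := fun c => (hf c).mul (hg c)

theorem SmoothFn.sub {f g : S → ℝ} (hf : SmoothFn f) (hg : SmoothFn g) :
    SmoothFn (fun x => f x - g x) := fun c => (hf c).sub (hg c)

theorem SmoothCov.epsContract {r : Fin 3 → S → ℝ} {e : Fin 3 → CovectorField (𝓡∂ 3) S}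
    (hr : ∀ i, SmoothFn (r i)) (he : ∀ i, SmoothCov (e i)) (i : Fin 3) :
    SmoothCov (epsContract r e i) :=
  SmoothCov.sum _ fun j => SmoothCov.sum _ fun k =>
    SmoothCov.smul ((SmoothFn.const _).mul (hr j)) (he k)

variable [IsManifold (𝓡∂ 3) ∞ S]

theorem coordRep_extD0 {f : S → ℝ} (hf : SmoothFn f) {c : S} {y : E3}
    (hy : y ∈ (extChartAt (𝓡∂ 3) c).target) :
    coordRep (extD0 (𝓡∂ 3) f) c y =
      fderivWithin ℝ (fun y => f ((extChartAt (𝓡∂ 3) c).symm y)) (range (𝓡∂ 3)) y := by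
  have : IsManifold (𝓡∂ 3) 1 S := .of_le (n := ∞) (by norm_cast)
  have hr := extChartAt_target_subset_range c hy
  have hU : UniqueMDiffWithinAt 𝓘(ℝ, E3) (range (𝓡∂ 3)) y :=
    ((𝓡∂ 3).uniqueDiffOn y hr).uniqueMDiffWithinAt
  have h1 : HasMFDerivWithinAt 𝓘(ℝ, E3) (𝓡∂ 3) (extChartAt (𝓡∂ 3) c).symm (range (𝓡∂ 3)) y
      (coordPush (𝓡∂ 3) c y) := (mdifferentiableWithinAt_extChartAt_symm hy).hasMFDerivWithinAt
  have h2 := (((contMDiff_fn_iff f).2 hf).mdifferentiable (by simp)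
    ((extChartAt (𝓡∂ 3) c).symm y)).hasMFDerivAt
  have h5 := (h2.comp_hasMFDerivWithinAt y h1).mfderivWithin hU
  rw [← mfderivWithin_eq_fderivWithin]
  exact h5.symm

omit [IsManifold (𝓡∂ 3) ∞ S] in
-- A chart target is a neighbourhood, within the half-space, of each of its points, so derivatives
-- within the half-space see only the values on the target.
theorem contDiffOn_fderivWithin_target {F : Type*} [NormedAddCommGroup F] [NormedSpace ℝ F]
    {f : E3 → F} {c : S} (hf : ContDiffOn ℝ ∞ f (extChartAt (𝓡∂ 3) c).target) :
    ContDiffOn ℝ ∞ (fderivWithin ℝ f (range (𝓡∂ 3))) (extChartAt (𝓡∂ 3) c).target := fun y hy => by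
  have hr := extChartAt_target_subset_range c hy
  have h1 : ContDiffWithinAt ℝ ∞ f (range (𝓡∂ 3)) y :=
    (hf y hy).mono_of_mem_nhdsWithin (extChartAt_target_mem_nhdsWithin_of_mem hy)
  exact (h1.fderivWithin_right (𝓡∂ 3).uniqueDiffOn (by simp) hr).mono
    (extChartAt_target_subset_range c)

theorem SmoothFn.extD0 {f : S → ℝ} (hf : SmoothFn f) : SmoothCov (extD0 (𝓡∂ 3) f) := fun c =>
  (contDiffOn_fderivWithin_target (hf c)).congr fun _ hy => coordRep_extD0 hf hy

theorem SmoothCov.covD0 {A : Fin 3 → CovectorField (𝓡∂ 3) S} {τ : Fin 3 → S → ℝ}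
    (hA : ∀ i, SmoothCov (A i)) (hτ : ∀ i, SmoothFn (τ i)) (i : Fin 3) :
    SmoothCov (covD0 A τ i) :=
  (hτ i).extD0.add (SmoothCov.sum _ fun j => SmoothCov.sum _ fun k =>
    SmoothCov.smul ((SmoothFn.const _).mul (hτ k)) (hA j))

end Smoothness

/-! ### Algebraic rules for the exterior derivative. -/

section ExteriorDerivative

variable {S : Type*} [TopologicalSpace S] [ChartedSpace (EuclideanHalfSpace 3) S]

theorem SmoothCov.differentiableWithinAt {a : CovectorField (𝓡∂ 3) S} (ha : SmoothCov a) {c : S}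
    {y : E3} (hy : y ∈ (extChartAt (𝓡∂ 3) c).target) :
    DifferentiableWithinAt ℝ (coordRep a c) (range (𝓡∂ 3)) y :=
  ((ha c y hy).mono_of_mem_nhdsWithin
    (extChartAt_target_mem_nhdsWithin_of_mem hy)).differentiableWithinAt (by simp)

theorem SmoothFn.differentiableWithinAt {f : S → ℝ} (hf : SmoothFn f) {c : S}
    {y : E3} (hy : y ∈ (extChartAt (𝓡∂ 3) c).target) :
    DifferentiableWithinAt ℝ (fun y => f ((extChartAt (𝓡∂ 3) c).symm y)) (range (𝓡∂ 3)) y :=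
  ((hf c y hy).mono_of_mem_nhdsWithin
    (extChartAt_target_mem_nhdsWithin_of_mem hy)).differentiableWithinAt (by simp)

theorem uniqueDiff_target {c : S} {y : E3} (hy : y ∈ (extChartAt (𝓡∂ 3) c).target) :
    UniqueDiffWithinAt ℝ (range (𝓡∂ 3)) y :=
  (𝓡∂ 3).uniqueDiffOn y (extChartAt_target_subset_range c hy)

variable [IsManifold (𝓡∂ 3) ∞ S]

theorem SmoothCov.extD1_coordPush {a : CovectorField (𝓡∂ 3) S} (ha : SmoothCov a) {c : S}
    {y : E3} (hy : y ∈ (extChartAt (𝓡∂ 3) c).target) (u v : E3) :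
    extD1 a ((extChartAt (𝓡∂ 3) c).symm y) (coordPush (𝓡∂ 3) c y u) (coordPush (𝓡∂ 3) c y v) =
      fderivWithin ℝ (coordRep a c) (range (𝓡∂ 3)) y u v -
        fderivWithin ℝ (coordRep a c) (range (𝓡∂ 3)) y v u :=
  HKBoundary.extD1_coordPush a hy (ha.differentiableWithinAt (mem_extChartAt_target _)) u v

theorem extD1_add {a b : CovectorField (𝓡∂ 3) S} (ha : SmoothCov a) (hb : SmoothCov b) (x : S)
    (u v : E3) : extD1 (fun x => a x + b x) x u v = extD1 a x u v + extD1 b x u v := by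
  have : IsManifold (𝓡∂ 3) 1 S := .of_le (n := ∞) (by norm_cast)
  have hx := mem_extChartAt_target (I := 𝓡∂ 3) x
  have h : coordRep (fun x => a x + b x) x = fun y => coordRep a x y + coordRep b x y := by
    ext y v; rfl
  rw [extD1_eq, extD1_eq, extD1_eq, h, fderivWithin_fun_add (uniqueDiff_target hx)
    (ha.differentiableWithinAt hx) (hb.differentiableWithinAt hx)]
  simp only [add_apply]
  ring

theorem extD0_eq {f : S → ℝ} (hf : SmoothFn f) (x : S) (u : E3) :
    fderivWithin ℝ (fun y => f ((extChartAt (𝓡∂ 3) x).symm y)) (range (𝓡∂ 3))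
      (extChartAt (𝓡∂ 3) x x) u = extD0 (𝓡∂ 3) f x u := by
  have : IsManifold (𝓡∂ 3) 1 S := .of_le (n := ∞) (by norm_cast)
  rw [← coordRep_extD0 hf (mem_extChartAt_target x)]
  exact coordRep_self _ x u

theorem extD1_smul {f : S → ℝ} {a : CovectorField (𝓡∂ 3) S} (hf : SmoothFn f) (ha : SmoothCov a)
    (x : S) (u v : E3) : extD1 (fun x => f x • a x) x u v =
      extD0 (𝓡∂ 3) f x u * a x v - extD0 (𝓡∂ 3) f x v * a x u + f x * extD1 a x u v := by
  have : IsManifold (𝓡∂ 3) 1 S := .of_le (n := ∞) (by norm_cast)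
  have hx := mem_extChartAt_target (I := 𝓡∂ 3) x
  have h : coordRep (fun x => f x • a x) x =
      fun y => f ((extChartAt (𝓡∂ 3) x).symm y) • coordRep a x y := by
    ext y v; rfl
  rw [extD1_eq, extD1_eq, h, fderivWithin_fun_smul (uniqueDiff_target hx)
    (hf.differentiableWithinAt hx) (ha.differentiableWithinAt hx)]
  simp only [add_apply, smul_apply,
    ContinuousLinearMap.smulRight_apply, extD0_eq hf, coordRep_self, smul_eq_mul,
    extChartAt_to_inv]
  ring

theorem extD1_const_smul (r : ℝ) {a : CovectorField (𝓡∂ 3) S} (ha : SmoothCov a)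
    (x : S) (u v : E3) : extD1 (fun x => r • a x) x u v = r * extD1 a x u v := by
  rw [extD1_smul (f := fun _ => r) (SmoothFn.const r) ha]
  have : extD0 (𝓡∂ 3) (fun _ : S => r) x = 0 := mfderiv_const
  rw [this]
  change 0 * _ - 0 * _ + _ = _
  ring

theorem extD1_sub {a b : CovectorField (𝓡∂ 3) S} (ha : SmoothCov a) (hb : SmoothCov b) (x : S)
    (u v : E3) : extD1 (fun x => a x - b x) x u v = extD1 a x u v - extD1 b x u v := by
  have h := extD1_add (ha.sub hb) hb x u v
  simp only [sub_add_cancel] at h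
  linarith

theorem extD1_zero (x : S) (u v : E3) :
    extD1 (fun _ => 0 : CovectorField (𝓡∂ 3) S) x u v = 0 := by
  have h := extD1_add SmoothCov.zero SmoothCov.zero x u v
  simp only [add_zero] at h
  linarith

theorem extD1_sum {κ : Type*} (s : Finset κ) {a : κ → CovectorField (𝓡∂ 3) S}
    (ha : ∀ k, SmoothCov (a k)) (x : S) (u v : E3) :
    extD1 (fun x => ∑ k ∈ s, a k x) x u v = ∑ k ∈ s, extD1 (a k) x u v := by
  classical
  induction s using Finset.induction_on with
  | empty => simpa using extD1_zero x u v
  | insert k s hk ih =>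
    simp only [Finset.sum_insert hk]
    rw [extD1_add (ha k) (SmoothCov.sum s ha), ih]

/-- Symmetry of second derivatives. It also holds at boundary points, because every point of the
half-space is in the closure of its interior. -/
theorem extD1_extD0 {f : S → ℝ} (hf : SmoothFn f) (x : S) (u v : E3) :
    extD1 (extD0 (𝓡∂ 3) f) x u v = 0 := by
  have : IsManifold (𝓡∂ 3) 1 S := .of_le (n := ∞) (by norm_cast)
  have hx := mem_extChartAt_target (I := 𝓡∂ 3) x
  have hr := extChartAt_target_subset_range x hx
  have hev : coordRep (extD0 (𝓡∂ 3) f) x =ᶠ[𝓝[range (𝓡∂ 3)] (extChartAt (𝓡∂ 3) x x)]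
      fderivWithin ℝ (fun y => f ((extChartAt (𝓡∂ 3) x).symm y)) (range (𝓡∂ 3)) := by
    filter_upwards [extChartAt_target_mem_nhdsWithin_of_mem hx] with y hy
    exact coordRep_extD0 hf hy
  have hsm : ContDiffWithinAt ℝ ∞ (fun y => f ((extChartAt (𝓡∂ 3) x).symm y)) (range (𝓡∂ 3))
      (extChartAt (𝓡∂ 3) x x) :=
    (hf x _ hx).mono_of_mem_nhdsWithin (extChartAt_target_mem_nhdsWithin_of_mem hx)
  have hsym := hsm.isSymmSndFDerivWithinAt (by simp; norm_cast) (𝓡∂ 3).uniqueDiffOn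
    ((𝓡∂ 3).range_subset_closure_interior hr) hr
  rw [extD1_eq, hev.fderivWithin_eq (coordRep_extD0 hf hx), hsym u v, sub_self]

theorem extD0_add {f g : S → ℝ} (hf : SmoothFn f) (hg : SmoothFn g) (x : S) (u : E3) :
    extD0 (𝓡∂ 3) (fun x => f x + g x) x u = extD0 (𝓡∂ 3) f x u + extD0 (𝓡∂ 3) g x u := by
  have h := mfderiv_add (((contMDiff_fn_iff f).2 hf).mdifferentiable (by simp) x)
    (((contMDiff_fn_iff g).2 hg).mdifferentiable (by simp) x)
  exact congrArg (fun L : E3 →L[ℝ] ℝ => L u) h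

theorem extD0_sub {f g : S → ℝ} (hf : SmoothFn f) (hg : SmoothFn g) (x : S) (u : E3) :
    extD0 (𝓡∂ 3) (fun x => f x - g x) x u = extD0 (𝓡∂ 3) f x u - extD0 (𝓡∂ 3) g x u := by
  have h := extD0_add (hf.sub hg) hg x u
  simp only [sub_add_cancel] at h
  linarith

theorem extD0_const_mul {g : S → ℝ} (r : ℝ) (hg : SmoothFn g) (x : S) (u : E3) :
    extD0 (𝓡∂ 3) (fun x => r * g x) x u = r * extD0 (𝓡∂ 3) g x u := by
  have h := const_smul_mfderiv (((contMDiff_fn_iff g).2 hg).mdifferentiable (by simp) x) r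
  exact congrArg (fun L : E3 →L[ℝ] ℝ => L u) h

omit [IsManifold (𝓡∂ 3) ∞ S] in
/-- Two-forms that are bilinear and alternating at each point. -/
def IsAlternatingTwoForm (β : TwoForm (𝓡∂ 3) S) : Prop :=
  ∀ x : S, ∃ B : E3 →ₗ[ℝ] E3 →ₗ[ℝ] ℝ, (∀ u, B u u = 0) ∧ ∀ u v : E3, β x u v = B u v

theorem isAlternatingTwoForm_extD1 (a : CovectorField (𝓡∂ 3) S) :
    IsAlternatingTwoForm (extD1 a) := fun x => by
  have : IsManifold (𝓡∂ 3) 1 S := .of_le (n := ∞) (by norm_cast)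
  let B : E3 →ₗ[ℝ] E3 →ₗ[ℝ] ℝ := (ContinuousLinearMap.coeLM ℝ).comp
    (fderivWithin ℝ (coordRep a x) (range (𝓡∂ 3)) (extChartAt (𝓡∂ 3) x x)).toLinearMap
  exact ⟨B - B.flip, fun u => sub_self _, fun u v => extD1_eq a x u v⟩

omit [IsManifold (𝓡∂ 3) ∞ S]

theorem isAlternatingTwoForm_wedge11 (a b : CovectorField (𝓡∂ 3) S) :
    IsAlternatingTwoForm (wedge11 a b) := fun x => by
  let f : E3 →ₗ[ℝ] ℝ := (show E3 →L[ℝ] ℝ from a x).toLinearMap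
  let g : E3 →ₗ[ℝ] ℝ := (show E3 →L[ℝ] ℝ from b x).toLinearMap
  exact ⟨f.smulRight g - (f.smulRight g).flip, fun u => sub_self _, fun u v => rfl⟩

theorem IsAlternatingTwoForm.add {β β' : TwoForm (𝓡∂ 3) S} (h : IsAlternatingTwoForm β)
    (h' : IsAlternatingTwoForm β') : IsAlternatingTwoForm (fun x u v => β x u v + β' x u v) :=
  fun x => by
    obtain ⟨B, hB, hB'⟩ := h x
    obtain ⟨C, hC, hC'⟩ := h' x
    exact ⟨B + C, fun u => by simp [hB, hC], fun u v =>
      congrArg₂ (· + ·) (hB' u v) (hC' u v)⟩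

theorem IsAlternatingTwoForm.mul {β : TwoForm (𝓡∂ 3) S} (f : S → ℝ) (h : IsAlternatingTwoForm β) :
    IsAlternatingTwoForm (fun x u v => f x * β x u v) := fun x => by
  obtain ⟨B, hB, hB'⟩ := h x
  exact ⟨f x • B, fun u => by simp [hB], fun u v => congrArg (f x * ·) (hB' u v)⟩

theorem IsAlternatingTwoForm.sub {β β' : TwoForm (𝓡∂ 3) S} (h : IsAlternatingTwoForm β)
    (h' : IsAlternatingTwoForm β') : IsAlternatingTwoForm (fun x u v => β x u v - β' x u v) := by
  simpa [sub_eq_add_neg] using h.add (h'.mul (fun _ => -1))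

theorem IsAlternatingTwoForm.sum {κ : Type*} (s : Finset κ) {β : κ → TwoForm (𝓡∂ 3) S}
    (h : ∀ k, IsAlternatingTwoForm (β k)) :
    IsAlternatingTwoForm (fun x u v => ∑ k ∈ s, β k x u v) := fun x => by
  choose B hB hB' using fun k => h k x
  exact ⟨∑ k ∈ s, B k, fun u => by simp [hB], fun u v => by simp [hB']⟩

theorem IsAlternatingTwoForm.epsSum (f : Fin 3 → S → ℝ) {β : Fin 3 → Fin 3 → TwoForm (𝓡∂ 3) S}
    (h : ∀ j k, IsAlternatingTwoForm (β j k)) (i : Fin 3) :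
    IsAlternatingTwoForm (fun x u v => ∑ j, ∑ k, eps i j k * f j x * β j k x u v) :=
  .sum _ fun j => .sum _ fun k => (h j k).mul (fun x => eps i j k * f j x)

end ExteriorDerivative

/-! ### Divergence theorem and fundamental lemma on the half-space. -/

section HalfSpace

/-- The closed half-space. -/
abbrev halfSpace : Set E3 := range (𝓡∂ 3)

theorem mem_halfSpace {y : E3} : y ∈ halfSpace ↔ 0 ≤ y 0 := by
  rw [halfSpace, range_modelWithCornersEuclideanHalfSpace]; rfl

theorem interior_halfSpace_eq : interior halfSpace = {y : E3 | 0 < y 0} := by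
  rw [halfSpace, interior_range_modelWithCornersEuclideanHalfSpace]

theorem isClosed_halfSpace : IsClosed halfSpace := (𝓡∂ 3).isClosed_range

/-- Points of the boundary plane of the half-space. -/
def planePoint (x : Fin 2 → ℝ) : E3 := WithLp.toLp 2 (Fin.insertNth (α := fun _ => ℝ) 0 0 x)

theorem continuous_planePoint : Continuous planePoint := by
  refine (PiLp.continuous_toLp 2 _).comp (continuous_pi fun i => ?_)
  refine Fin.cases ?_ (fun j => ?_) i
  · simpa using continuous_const
  · simpa using continuous_apply j

theorem planePoint_zero (x : Fin 2 → ℝ) : planePoint x 0 = 0 := by simp [planePoint]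

theorem planePoint_succ (x : Fin 2 → ℝ) (j : Fin 2) : planePoint x j.succ = x j := by
  simp [planePoint]

theorem abs_coord_le_norm (y : E3) (i : Fin 3) : |y i| ≤ ‖y‖ := by
  simpa using PiLp.norm_apply_le y i

/-- The divergence of a triple of functions on the half-space. -/
noncomputable def halfDiv (f : Fin 3 → E3 → ℝ) (y : E3) : ℝ :=
  ∑ n, fderivWithin ℝ (f n) halfSpace y (EuclideanSpace.single n 1)

/-- The divergence theorem in the half-space. -/
theorem integral_halfDiv {f : Fin 3 → E3 → ℝ} (hf : ∀ n, ContDiffOn ℝ 1 (f n) halfSpace)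
    {R : ℝ} (hR : 0 < R) (hz : ∀ n y, R ≤ ‖y‖ → f n y = 0) :
    ∫ y in halfSpace, halfDiv f y =
      - ∫ x in Icc (fun _ : Fin 2 => -(R + 1)) (fun _ => R + 1), f 0 (planePoint x) := by
  set L := (EuclideanSpace.equiv (Fin 3) ℝ).symm with hL
  have hLmp : MeasurePreserving L volume volume := PiLp.volume_preserving_toLp (Fin 3)
  have hLme : MeasurableEmbedding L := L.toHomeomorph.measurableEmbedding
  -- The box [0, R+1] × [-(R+1), R+1]²: one face lies in the boundary plane, and on the other five
  -- the norm exceeds `R`, where `f` vanishes.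
  let a : Fin 3 → ℝ := ![0, -(R + 1), -(R + 1)]
  let b : Fin 3 → ℝ := fun _ => R + 1
  have hab : a ≤ b := fun i => by fin_cases i <;> simp [a, b] <;> linarith
  have hmem : ∀ x ∈ Icc a b, L x ∈ halfSpace := fun x hx => mem_halfSpace.2 (hx.1 0)
  have hcd : ∀ n, ContinuousOn (fun y => fderivWithin ℝ (f n) halfSpace y) halfSpace := fun n =>
    ((hf n).continuousOn_fderivWithin (𝓡∂ 3).uniqueDiffOn le_rfl)
  have key := integral_divergence_of_hasFDerivAt_off_countable' a b hab
    (fun n x => f n (L x)) (fun n x => (fderivWithin ℝ (f n) halfSpace (L x)).comp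
      (L : (Fin 3 → ℝ) →L[ℝ] E3)) ∅ countable_empty
    (fun n => (hf n).continuousOn.comp L.continuous.continuousOn hmem)
    (fun x hx n => by
      have h0 : 0 < x 0 := (hx.1 0 (mem_univ _)).1
      have hn : halfSpace ∈ 𝓝 (L x) := by
        rw [← mem_interior_iff_mem_nhds, interior_halfSpace_eq]; exact h0
      have h1 : DifferentiableWithinAt ℝ (f n) halfSpace (L x) :=
        (hf n).differentiableOn (by norm_num) _ (mem_halfSpace.2 h0.le)
      have h2 := h1.hasFDerivWithinAt.hasFDerivAt hn
      exact h2.comp x L.hasFDerivAt)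
    (by
      refine ContinuousOn.integrableOn_compact isCompact_Icc (continuousOn_finsetSum _ fun n _ => ?_)
      exact ((hcd n).comp L.continuous.continuousOn hmem).clm_apply continuousOn_const)
  have hbox : ∀ x : Fin 3 → ℝ, ∀ n, x n = R + 1 ∨ x n = -(R + 1) → R ≤ ‖L x‖ := by
    intro x n hx
    refine le_trans ?_ (abs_coord_le_norm (L x) n)
    change R ≤ |x n|
    rcases hx with h | h <;> rw [h]
    · rw [abs_of_pos] <;> linarith
    · rw [abs_neg, abs_of_pos] <;> linarith
  -- A point of the half-space outside the box has norm greater than `R`, so `f` vanishes near it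
  -- and so does the divergence.
  have hlhs : ∫ y in halfSpace, halfDiv f y = ∫ x in Icc a b, ∑ n,
      (fderivWithin ℝ (f n) halfSpace (L x)).comp (L : (Fin 3 → ℝ) →L[ℝ] E3) (Pi.single n 1) := by
    rw [← hLmp.setIntegral_preimage_emb hLme]
    apply setIntegral_eq_of_subset_of_forall_sdiff_eq_zero
    · exact L.continuous.measurable isClosed_halfSpace.measurableSet
    · exact hmem
    · intro x hx
      have hbig : R < ‖L x‖ := by
        by_contra hcon
        push Not at hcon
        refine hx.2 ⟨fun i => ?_, fun i => ?_⟩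
        · have := (abs_le.1 ((abs_coord_le_norm (L x) i).trans hcon)).1
          have h0 : 0 ≤ x 0 := mem_halfSpace.1 hx.1
          change -R ≤ x i at this
          fin_cases i <;> simp [a] at this ⊢ <;> linarith
        · have := (abs_le.1 ((abs_coord_le_norm (L x) i).trans hcon)).2
          change x i ≤ R at this
          change x i ≤ R + 1
          linarith
      refine Finset.sum_eq_zero fun n _ => ?_
      have hev : f n =ᶠ[𝓝[halfSpace] (L x)] fun _ => 0 := by
        refine mem_nhdsWithin_of_mem_nhds ?_
        filter_upwards [continuous_norm.continuousAt.eventually (lt_mem_nhds hbig)] with y hy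
        exact hz n y (le_of_lt hy)
      rw [hev.fderivWithin_eq (hz n _ hbig.le)]
      simp
  rw [hlhs, key]
  -- Only the face in the boundary plane contributes; its outward normal is minus the first basis
  -- vector, whence the sign.
  have hzero : ∀ (i : Fin 3) (c : ℝ) (h : c = R + 1 ∨ c = -(R + 1)) (s : Set (Fin 2 → ℝ)),
      ∫ x in s, f i (L (i.insertNth c x)) = 0 := fun i c h s => by
    rw [show (fun x : Fin 2 → ℝ => f i (L (i.insertNth c x))) = fun _ => 0 from
      funext fun x => hz i _ (hbox _ i (by simpa using h))]
    simp
  rw [Fin.sum_univ_three]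
  rw [hzero 0 (b 0) (Or.inl rfl), hzero 1 (b 1) (Or.inl rfl), hzero 2 (b 2) (Or.inl rfl),
    hzero 1 (a 1) (Or.inr rfl), hzero 2 (a 2) (Or.inr rfl)]
  simp only [sub_zero, zero_sub, add_zero, neg_inj]
  congr 1
  congr 1
  · ext x
    simp only [mem_Icc, Pi.le_def, Fin.forall_fin_two]
    rfl

/-- At a point outside `U` the cut-off vanishes in a neighbourhood, so the product extends by zero
although `K` is controlled on `U` only. -/
theorem contDiffOn_mul_of_tsupport {ψ K : E3 → ℝ} {U : Set E3} (hU : IsOpen U)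
    (hψ : ContDiff ℝ ∞ ψ) (hs : tsupport ψ ⊆ U) (hK : ContDiffOn ℝ 1 K (U ∩ halfSpace)) :
    ContDiffOn ℝ 1 (fun y => ψ y * K y) halfSpace := fun y hy => by
  by_cases hyU : y ∈ U
  · have h1 : ContDiffWithinAt ℝ 1 K halfSpace y :=
      (hK y ⟨hyU, hy⟩).mono_of_mem_nhdsWithin (inter_mem (mem_nhdsWithin_of_mem_nhds
        (hU.mem_nhds hyU)) self_mem_nhdsWithin)
    exact (hψ.of_le (by norm_cast)).contDiffWithinAt.mul h1
  · have h2 : ψ =ᶠ[𝓝 y] 0 := notMem_tsupport_iff_eventuallyEq.1 fun h => hyU (hs h)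
    refine (contDiffWithinAt_const (c := (0 : ℝ))).congr_of_eventuallyEq
      (mem_nhdsWithin_of_mem_nhds ?_) (by simp [h2.self_of_nhds])
    filter_upwards [h2] with z hz
    simp [hz]

theorem halfDiv_eq_zero {ψ : E3 → ℝ} {K : Fin 3 → E3 → ℝ} {y : E3} (hy : y ∉ tsupport ψ) :
    halfDiv (fun n y => ψ y * K n y) y = 0 := by
  have h2 : ψ =ᶠ[𝓝 y] 0 := notMem_tsupport_iff_eventuallyEq.1 hy
  refine Finset.sum_eq_zero fun n _ => ?_
  have hev : (fun y => ψ y * K n y) =ᶠ[𝓝[halfSpace] y] fun _ => 0 := by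
    refine mem_nhdsWithin_of_mem_nhds ?_
    filter_upwards [h2] with z hz
    simp [hz]
  rw [hev.fderivWithin_eq (by simp [h2.self_of_nhds])]
  simp

/-- The cut-off reduces this to `integral_halfDiv`. The number `R` only has to bound the ball; it
gives the plane integral a bounded domain. -/
theorem integral_halfDiv_mul {ψ : E3 → ℝ} {K : Fin 3 → E3 → ℝ} {y₀ : E3} {r R : ℝ} (hR : 0 < R)
    (hψ : ContDiff ℝ ∞ ψ) (hs : tsupport ψ ⊆ Metric.ball y₀ r)
    (hK : ∀ n, ContDiffOn ℝ 1 (K n) (Metric.ball y₀ r ∩ halfSpace))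
    (hz : ∀ y ∈ Metric.ball y₀ r, ‖y‖ < R) :
    ∫ y in Metric.ball y₀ r ∩ halfSpace, halfDiv (fun n y => ψ y * K n y) y =
      - ∫ x in Icc (fun _ : Fin 2 => -(R + 1)) (fun _ => R + 1),
        ψ (planePoint x) * K 0 (planePoint x) := by
  rw [← integral_halfDiv (f := fun n y => ψ y * K n y)
    (fun n => contDiffOn_mul_of_tsupport Metric.isOpen_ball hψ hs (hK n)) hR
    (fun n y hy => by
      have : y ∉ tsupport ψ := fun h => absurd (hz y (hs h)) (not_lt.2 hy)
      rw [image_eq_zero_of_notMem_tsupport this, zero_mul])]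
  symm
  apply setIntegral_eq_of_subset_of_forall_sdiff_eq_zero isClosed_halfSpace.measurableSet
    inter_subset_right
  intro y hy
  exact halfDiv_eq_zero fun h => hy.2 ⟨hs h, hy.1⟩

/-- The fundamental lemma of the calculus of variations for a first-order expression in divergence
form on the half-space: the bulk coefficient vanishes, and so does the normal flux on the boundary
plane. -/
theorem halfSpace_fundamental_lemma {Q : E3 → ℝ} {K : Fin 3 → E3 → ℝ} {y₀ : E3} {r : ℝ}
    (hr : 0 < r) (hQ : ContinuousOn Q (Metric.ball y₀ r ∩ halfSpace))
    (hK : ∀ n, ContDiffOn ℝ 1 (K n) (Metric.ball y₀ r ∩ halfSpace))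
    (h : ∀ ψ : E3 → ℝ, ContDiff ℝ ∞ ψ → HasCompactSupport ψ → tsupport ψ ⊆ Metric.ball y₀ r →
      ∫ y in Metric.ball y₀ r ∩ halfSpace, (ψ y * Q y + halfDiv (fun n y => ψ y * K n y) y) = 0) :
    (∀ y ∈ Metric.ball y₀ r ∩ halfSpace, Q y = 0) ∧ (y₀ 0 = 0 → K 0 y₀ = 0) := by
  have hmeas : MeasurableSet (Metric.ball y₀ r ∩ halfSpace) :=
    measurableSet_ball.inter isClosed_halfSpace.measurableSet
  set R : ℝ := ‖y₀‖ + r with hRdef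
  have hR : 0 < R := by positivity
  have hz : ∀ y ∈ Metric.ball y₀ r, ‖y‖ < R := fun y hy => by
    have h1 : ‖y - y₀‖ < r := by simpa [dist_eq_norm] using hy
    calc ‖y‖ = ‖y₀ + (y - y₀)‖ := by simp
      _ ≤ ‖y₀‖ + ‖y - y₀‖ := norm_add_le _ _
      _ < R := by rw [hRdef]; linarith
  let U : Set E3 := Metric.ball y₀ r ∩ {y | 0 < y 0}
  have hcoord : Continuous fun y : E3 => y 0 := by fun_prop
  have hU : IsOpen U := Metric.isOpen_ball.inter (isOpen_lt continuous_const hcoord)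
  have hUsub : U ⊆ Metric.ball y₀ r ∩ halfSpace := fun y hy => ⟨hy.1, mem_halfSpace.2 hy.2.le⟩
  have hQU : ContinuousOn Q U := hQ.mono hUsub
  -- Test functions supported in the open half-space have no flux through the plane, so only the
  -- integral of `ψ Q` is left.
  have hae : ∀ᵐ y ∂(volume : Measure E3), y ∈ U → Q y = 0 := by
    refine hU.ae_eq_zero_of_integral_contDiff_smul_eq_zero
      (hQU.locallyIntegrableOn hU.measurableSet) fun ψ hψ hc hs => ?_
    have hs' : tsupport ψ ⊆ Metric.ball y₀ r := hs.trans inter_subset_left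
    have h1 := h ψ hψ hc hs'
    have hdiv := integral_halfDiv_mul hR hψ hs' hK hz
    have hplane : ∀ x, ψ (planePoint x) * K 0 (planePoint x) = 0 := fun x => by
      have : planePoint x ∉ tsupport ψ := fun hx => by
        have := (hs hx).2
        simp [planePoint_zero] at this
      rw [image_eq_zero_of_notMem_tsupport this, zero_mul]
    simp only [hplane, integral_zero, neg_zero] at hdiv
    have hi1 : IntegrableOn (fun y => ψ y * Q y) (Metric.ball y₀ r ∩ halfSpace) := by
      have hco : ContinuousOn (fun y => ψ y * Q y) (tsupport ψ) :=
        hψ.continuous.continuousOn.mul (hQU.mono hs)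
      refine ((hco.integrableOn_compact hc).of_forall_sdiff_eq_zero hmeas fun y hy => ?_)
      rw [image_eq_zero_of_notMem_tsupport hy.2, zero_mul]
    have hi2 : IntegrableOn (halfDiv fun n y => ψ y * K n y) (Metric.ball y₀ r ∩ halfSpace) := by
      have hco : ContinuousOn (halfDiv fun n y => ψ y * K n y) halfSpace :=
        continuousOn_finsetSum _ fun n _ =>
          ((contDiffOn_mul_of_tsupport Metric.isOpen_ball hψ hs' (hK n)).continuousOn_fderivWithin
            (𝓡∂ 3).uniqueDiffOn le_rfl).clm_apply continuousOn_const
      have hsub : tsupport ψ ⊆ halfSpace := fun y hy => (hUsub (hs hy)).2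
      refine (((hco.mono hsub).integrableOn_compact hc).of_forall_sdiff_eq_zero hmeas
        fun y hy => ?_)
      exact halfDiv_eq_zero hy.2
    rw [integral_add hi1 hi2, hdiv, add_zero] at h1
    rw [← h1]
    symm
    apply setIntegral_eq_integral_of_forall_compl_eq_zero
    intro y hy
    rw [image_eq_zero_of_notMem_tsupport fun hy' => hy (hUsub (hs hy')), zero_mul]
  have hzeroU : EqOn Q (fun _ => 0) U := by
    refine Measure.eqOn_open_of_ae_eq (μ := volume) ?_ hU hQU continuousOn_const
    exact (ae_restrict_iff' hU.measurableSet).2 hae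
  -- Boundary points are reached from the interior along the inward normal, and `Q` is continuous up
  -- to the boundary.
  have hzero : ∀ y ∈ Metric.ball y₀ r ∩ halfSpace, Q y = 0 := fun y hy => by
    let g : ℝ → E3 := fun s => y + s • EuclideanSpace.single 0 1
    have hg : Tendsto g (𝓝[>] 0) (𝓝 y) := by
      have : Continuous g := by fun_prop
      simpa [g] using (this.tendsto 0).mono_left nhdsWithin_le_nhds
    have hev : ∀ᶠ s in 𝓝[>] (0 : ℝ), g s ∈ U := by
      filter_upwards [hg.eventually (Metric.isOpen_ball.mem_nhds hy.1), self_mem_nhdsWithin]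
        with s hs hs0
      refine ⟨hs, ?_⟩
      have := mem_halfSpace.1 hy.2
      simp only [mem_ofPred_eq, g, PiLp.add_apply, PiLp.smul_apply, PiLp.single_apply]
      simp at hs0 ⊢
      linarith
    have hg' : Tendsto g (𝓝[>] 0) (𝓝[Metric.ball y₀ r ∩ halfSpace] y) :=
      tendsto_nhdsWithin_iff.2 ⟨hg, hev.mono fun s hs => hUsub hs⟩
    have h1 : Tendsto (fun s => Q (g s)) (𝓝[>] 0) (𝓝 (Q y)) := (hQ y hy).tendsto.comp hg'
    have h2 : Tendsto (fun s => Q (g s)) (𝓝[>] 0) (𝓝 0) :=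
      tendsto_const_nhds.congr' (hev.mono fun s hs => (hzeroU hs).symm)
    exact tendsto_nhds_unique h1 h2
  refine ⟨hzero, fun hy0 => ?_⟩
  -- With the bulk term gone, the hypothesis is the vanishing of the flux, now also for `ψ` that
  -- reach the plane.
  have hflux : ∀ ψ : E3 → ℝ, ContDiff ℝ ∞ ψ → HasCompactSupport ψ →
      tsupport ψ ⊆ Metric.ball y₀ r →
      ∫ x in Icc (fun _ : Fin 2 => -(R + 1)) (fun _ => R + 1),
        ψ (planePoint x) * K 0 (planePoint x) = 0 := fun ψ hψ hc hs => by
    have h1 := h ψ hψ hc hs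
    rw [setIntegral_congr_fun (g := halfDiv fun n y => ψ y * K n y) hmeas
      (fun y hy => by simp [hzero y hy]), integral_halfDiv_mul hR hψ hs hK hz] at h1
    linarith
  by_contra hne
  let x₀ : Fin 2 → ℝ := fun j => y₀ j.succ
  have hx₀ : planePoint x₀ = y₀ := by
    ext i
    refine Fin.cases ?_ (fun j => ?_) i
    · rw [planePoint_zero, hy0]
    · rw [planePoint_succ]
  have hmem0 : y₀ ∈ Metric.ball y₀ r ∩ halfSpace :=
    ⟨Metric.mem_ball_self hr, mem_halfSpace.2 hy0.ge⟩
  have hc0 : ContinuousWithinAt (fun y => K 0 y * K 0 y₀) (Metric.ball y₀ r ∩ halfSpace) y₀ :=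
    ((hK 0).continuousOn y₀ hmem0).mul_const _
  have hpos : 0 < K 0 y₀ * K 0 y₀ := mul_self_pos.2 hne
  have hev := hc0.eventually (lt_mem_nhds hpos)
  obtain ⟨δ, hδ, hδ'⟩ := Metric.mem_nhdsWithin_iff.1 hev
  set ε := min δ r with hε
  have hε0 : 0 < ε := lt_min hδ hr
  let ψ : ContDiffBump y₀ := ⟨ε / 4, ε / 2, by positivity, by linarith⟩
  have hsub : tsupport ψ ⊆ Metric.ball y₀ ε := by
    rw [ψ.tsupport_eq]
    exact Metric.closedBall_subset_ball (by change ε / 2 < ε; linarith)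
  have hsr : tsupport ψ ⊆ Metric.ball y₀ r :=
    hsub.trans (Metric.ball_subset_ball (min_le_right _ _))
  have hint := hflux ψ ψ.contDiff ψ.hasCompactSupport hsr
  -- Multiplying by the constant `K 0 y₀` fixes the sign: on the support of the bump `K 0` has the
  -- sign of its value at the centre, so `g` is nonnegative and positive at `x₀`, while its integral
  -- vanishes.
  let g : (Fin 2 → ℝ) → ℝ := fun x => ψ (planePoint x) * K 0 (planePoint x) * K 0 y₀
  have hgcont : Continuous g := by
    have h1 := (contDiffOn_mul_of_tsupport Metric.isOpen_ball ψ.contDiff hsr (hK 0)).continuousOn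
    rw [← continuousOn_univ]
    exact (h1.comp continuous_planePoint.continuousOn
      fun x _ => mem_halfSpace.2 (planePoint_zero x).ge).mul continuousOn_const
  have hgsupp : ∀ x, x ∉ Icc (fun _ : Fin 2 => -(R + 1)) (fun _ => R + 1) → g x = 0 := by
    intro x hx
    have : planePoint x ∉ tsupport ψ := fun hm => hx <| by
      have hb := fun j : Fin 2 => abs_le.1
        ((abs_coord_le_norm (planePoint x) j.succ).trans (hz _ (hsr hm)).le)
      simp only [planePoint_succ] at hb
      exact ⟨fun j => by linarith [(hb j).1], fun j => by linarith [(hb j).2]⟩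
    simp only [g, image_eq_zero_of_notMem_tsupport this, zero_mul]
  have hgnn : 0 ≤ g := fun x => by
    by_cases hm : planePoint x ∈ tsupport ψ
    · have h1 : 0 < K 0 (planePoint x) * K 0 y₀ := hδ'
        ⟨(Metric.ball_subset_ball (min_le_left _ _)) (hsub hm), hsr hm,
          mem_halfSpace.2 (planePoint_zero x).ge⟩
      have h2 := ψ.nonneg (x := planePoint x)
      simp only [g, Pi.zero_apply, mul_assoc]
      positivity
    · simp [g, image_eq_zero_of_notMem_tsupport hm]
  have hgpos : g x₀ ≠ 0 := by
    simp only [g, hx₀, mul_assoc]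
    have : ψ y₀ = 1 := ψ.one_of_mem_closedBall (Metric.mem_closedBall_self (by positivity))
    rw [this, one_mul]
    exact hpos.ne'
  have hgc : HasCompactSupport g := HasCompactSupport.intro isCompact_Icc hgsupp
  have h3 := hgcont.integral_pos_of_hasCompactSupport_nonneg_nonzero (μ := volume) hgc hgnn hgpos
  rw [← setIntegral_eq_integral_of_forall_compl_eq_zero hgsupp] at h3
  simp only [g, integral_mul_const, hint, zero_mul, lt_self_iff_false] at h3

end HalfSpace

/-! ### Integrals of three-forms and their independence of the chart. -/

section Integration

variable {S : Type*} [TopologicalSpace S] [ChartedSpace (EuclideanHalfSpace 3) S]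

/-- The coefficient of a three-form in the chart at `c`. -/
noncomputable def chartEval (η : ThreeForm (𝓡∂ 3) S) (c : S) (y : E3) : ℝ :=
  η ((extChartAt (𝓡∂ 3) c).symm y)
    (coordPush (𝓡∂ 3) c y (EuclideanSpace.single 0 1))
    (coordPush (𝓡∂ 3) c y (EuclideanSpace.single 1 1))
    (coordPush (𝓡∂ 3) c y (EuclideanSpace.single 2 1))

/-- Three-forms with continuous coefficients in all charts. -/
def ContForm (η : ThreeForm (𝓡∂ 3) S) : Prop :=
  ∀ c, ContinuousOn (chartEval η c) (extChartAt (𝓡∂ 3) c).target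

theorem measurableSet_target (c : S) : MeasurableSet (extChartAt (𝓡∂ 3) c).target := by
  rw [extChartAt_target]
  exact (((chartAt _ c).open_target.preimage (𝓡∂ 3).continuous_symm).measurableSet).inter
    (𝓡∂ 3).isClosed_range.measurableSet

theorem ContForm.add {η ζ : ThreeForm (𝓡∂ 3) S} (hη : ContForm η) (hζ : ContForm ζ) :
    ContForm (fun x u v w => η x u v w + ζ x u v w) := fun c => (hη c).add (hζ c)

/-- The coefficient of a three-form transforms with the determinant. -/
def IsTopForm (η : ThreeForm (𝓡∂ 3) S) : Prop :=
  ∀ (x : S) (P T : E3 →L[ℝ] E3),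
    η x (P (T (EuclideanSpace.single 0 1))) (P (T (EuclideanSpace.single 1 1)))
        (P (T (EuclideanSpace.single 2 1))) =
      T.det * η x (P (EuclideanSpace.single 0 1)) (P (EuclideanSpace.single 1 1))
        (P (EuclideanSpace.single 2 1))

theorem euclidean_expand (v : E3) : v = v 0 • EuclideanSpace.single 0 1 +
    v 1 • EuclideanSpace.single 1 1 + v 2 • (EuclideanSpace.single 2 1 : E3) := by
  ext i
  fin_cases i <;> simp

theorem det_euclidean (T : E3 →L[ℝ] E3) : T.det =
    Matrix.det (Matrix.of fun i j : Fin 3 => T (EuclideanSpace.single j 1) i) := by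
  rw [ContinuousLinearMap.det, ← LinearMap.det_toMatrix (EuclideanSpace.basisFun (Fin 3) ℝ).toBasis]
  congr 1

/-- An alternating three-form on a three-dimensional space is a multiple of the determinant.
Expanding the vectors `T (e j)` in the basis reproduces the 3 × 3 determinant term by term. -/
theorem top_wedge_det (a : E3 →ₗ[ℝ] ℝ) (B : E3 →ₗ[ℝ] E3 →ₗ[ℝ] ℝ) (hB : ∀ u, B u u = 0)
    (T : E3 →L[ℝ] E3) (e : Fin 3 → E3) (he : e = fun i => EuclideanSpace.single i 1) :
    a (T (e 0)) * B (T (e 1)) (T (e 2)) - a (T (e 1)) * B (T (e 0)) (T (e 2)) +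
        a (T (e 2)) * B (T (e 0)) (T (e 1)) =
      T.det * (a (e 0) * B (e 1) (e 2) - a (e 1) * B (e 0) (e 2) + a (e 2) * B (e 0) (e 1)) := by
  have hanti : ∀ u v, B v u = - B u v := fun u v => by
    have := hB (u + v)
    simp only [map_add, LinearMap.add_apply, hB] at this
    linarith
  obtain ⟨t, ht⟩ : ∃ t : Fin 3 → Fin 3 → ℝ, t = fun j i => T (e j) i := ⟨_, rfl⟩
  have hT : ∀ j, T (e j) = t j 0 • e 0 + t j 1 • e 1 + t j 2 • e 2 := fun j => by
    subst ht; subst he; exact euclidean_expand _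
  have hdet : T.det = Matrix.det (Matrix.of fun i j : Fin 3 => t j i) := by
    subst ht; subst he; exact det_euclidean T
  rw [hdet, Matrix.det_fin_three]
  simp only [Matrix.of_apply, hT, map_add, map_smul, LinearMap.add_apply,
    LinearMap.smul_apply, smul_eq_mul, hB,
    hanti (e 0) (e 1), hanti (e 0) (e 2), hanti (e 1) (e 2)]
  ring

theorem isTopForm_wedge12 (a : CovectorField (𝓡∂ 3) S) {β : TwoForm (𝓡∂ 3) S}
    (hβ : IsAlternatingTwoForm β) : IsTopForm (wedge12 a β) := fun x P T => by
  obtain ⟨B, hB, hB'⟩ := hβ x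
  have h := top_wedge_det ((show E3 →L[ℝ] ℝ from a x).toLinearMap.comp P.toLinearMap)
    (B.compl₁₂ P.toLinearMap P.toLinearMap) (fun u => hB _) T _ rfl
  simp only [wedge12]
  refine Eq.trans ?_ (h.trans ?_)
  · exact congrArg₂ (· + ·) (congrArg₂ (· - ·) (congrArg _ (hB' _ _)) (congrArg _ (hB' _ _)))
      (congrArg _ (hB' _ _))
  · refine congrArg (T.det * ·) ?_
    exact (congrArg₂ (· + ·) (congrArg₂ (· - ·) (congrArg _ (hB' _ _)) (congrArg _ (hB' _ _)))
      (congrArg _ (hB' _ _))).symm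

theorem IsTopForm.add {η ζ : ThreeForm (𝓡∂ 3) S} (hη : IsTopForm η) (hζ : IsTopForm ζ) :
    IsTopForm (fun x u v w => η x u v w + ζ x u v w) := fun x P T => by
  refine (congrArg₂ (· + ·) (hη x P T) (hζ x P T)).trans ?_
  exact (mul_add _ _ _).symm

theorem IsTopForm.const_mul {η : ThreeForm (𝓡∂ 3) S} (r : ℝ) (hη : IsTopForm η) :
    IsTopForm (fun x u v w => r * η x u v w) := fun x P T => by
  refine (congrArg (r * ·) (hη x P T)).trans ?_
  exact mul_left_comm _ _ _

variable [IsManifold (𝓡∂ 3) ∞ S] [T2Space S] [CompactSpace S]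

theorem tsupport_chartPartition (c : S) :
    tsupport (chartPartition S c) ⊆ (extChartAt (𝓡∂ 3) c).source := by
  rw [extChartAt_source]
  exact (SmoothPartitionOfUnity.exists_isSubordinate_chartAt_source (𝓡∂ 3) S).choose_spec c

/-- Local finiteness and compactness leave finitely many members that are not identically zero, so
the integral is a finite sum. -/
theorem exists_finset_chartPartition :
    ∃ F : Finset S, ∀ c ∉ F, ∀ x, chartPartition S c x = 0 := by
  have h := (chartPartition S).locallyFinite.finite_nonempty_of_compact
  refine ⟨h.toFinset, fun c hc x => ?_⟩
  by_contra hx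
  exact hc (h.mem_toFinset.2 ⟨x, hx⟩)

/-- The contribution of the chart at `c` to the integral. -/
noncomputable def chartIntegral (c : S) (g : E3 → ℝ) : ℝ :=
  ∫ y in (extChartAt (𝓡∂ 3) c).target,
    chartPartition S c ((extChartAt (𝓡∂ 3) c).symm y) * g y

theorem integral_eq_sum {F : Finset S} (hF : ∀ c ∉ F, ∀ x, chartPartition S c x = 0)
    (η : ThreeForm (𝓡∂ 3) S) :
    integral η = ∑ c ∈ F, chartIntegral c (chartEval η c) := by
  refine finsum_eq_finsetSum_of_support_subset _ fun c hc => ?_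
  by_contra h
  refine hc ?_
  simp [hF c h]

theorem sum_chartPartition {F : Finset S} (hF : ∀ c ∉ F, ∀ x, chartPartition S c x = 0) (x : S) :
    ∑ c ∈ F, chartPartition S c x = 1 := by
  rw [← (chartPartition S).sum_eq_one (mem_univ x)]
  refine (finsum_eq_finsetSum_of_support_subset _ fun c hc => ?_).symm
  by_contra h
  exact hc (hF c h x)

omit [IsManifold (𝓡∂ 3) ∞ S] [T2Space S] in
theorem isCompact_chart_image {c : S} {K : Set S} (hK : IsClosed K)
    (hs : K ⊆ (extChartAt (𝓡∂ 3) c).source) : IsCompact (extChartAt (𝓡∂ 3) c '' K) :=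
  hK.isCompact.image_of_continuousOn ((continuousOn_extChartAt c).mono hs)

omit [IsManifold (𝓡∂ 3) ∞ S] [T2Space S] in
-- A closed subset of the compact `S` inside the chart domain has compact image, and the integrand
-- is continuous there and zero elsewhere; the chart target itself need not be compact.
theorem integrableOn_chart {c : S} {K : Set S} (hK : IsClosed K)
    (hs : K ⊆ (extChartAt (𝓡∂ 3) c).source) {g : E3 → ℝ}
    (hg : ContinuousOn g (extChartAt (𝓡∂ 3) c).target)
    (hz : ∀ y ∈ (extChartAt (𝓡∂ 3) c).target, (extChartAt (𝓡∂ 3) c).symm y ∉ K → g y = 0) :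
    IntegrableOn g (extChartAt (𝓡∂ 3) c).target := by
  have hsub : extChartAt (𝓡∂ 3) c '' K ⊆ (extChartAt (𝓡∂ 3) c).target := by
    rintro _ ⟨x, hx, rfl⟩
    exact (extChartAt (𝓡∂ 3) c).map_source (hs hx)
  refine ((hg.mono hsub).integrableOn_compact (isCompact_chart_image hK hs)).of_forall_sdiff_eq_zero
    (measurableSet_target c) fun y hy => hz y hy.1 fun h => hy.2 ?_
  exact ⟨_, h, (extChartAt (𝓡∂ 3) c).right_inv hy.1⟩

theorem continuousOn_chartPartition (b c : S) :
    ContinuousOn (fun y => chartPartition S b ((extChartAt (𝓡∂ 3) c).symm y))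
      (extChartAt (𝓡∂ 3) c).target :=
  (chartPartition S b).contMDiff.continuous.comp_continuousOn (continuousOn_extChartAt_symm c)

theorem integrableOn_partition_mul {c : S} {g : E3 → ℝ}
    (hg : ContinuousOn g (extChartAt (𝓡∂ 3) c).target) :
    IntegrableOn (fun y => chartPartition S c ((extChartAt (𝓡∂ 3) c).symm y) * g y)
      (extChartAt (𝓡∂ 3) c).target :=
  integrableOn_chart (isClosed_tsupport (chartPartition S c)) (tsupport_chartPartition c)
    ((continuousOn_chartPartition c c).mul hg) fun y _ hy => by
      rw [image_eq_zero_of_notMem_tsupport hy, zero_mul]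

theorem chartIntegral_add {c : S} {g h : E3 → ℝ}
    (hg : ContinuousOn g (extChartAt (𝓡∂ 3) c).target)
    (hh : ContinuousOn h (extChartAt (𝓡∂ 3) c).target) :
    chartIntegral c (fun y => g y + h y) = chartIntegral c g + chartIntegral c h := by
  simp only [chartIntegral, mul_add]
  exact integral_add (integrableOn_partition_mul hg) (integrableOn_partition_mul hh)

theorem chartIntegral_const_mul {c : S} (r : ℝ) (g : E3 → ℝ) :
    chartIntegral c (fun y => r * g y) = r * chartIntegral c g := by
  simp only [chartIntegral, mul_left_comm _ r]
  exact integral_const_mul _ _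

theorem integral_add_form {η ζ : ThreeForm (𝓡∂ 3) S} (hη : ContForm η) (hζ : ContForm ζ) :
    integral (fun x u v w => η x u v w + ζ x u v w) = integral η + integral ζ := by
  obtain ⟨F, hF⟩ := exists_finset_chartPartition (S := S)
  rw [integral_eq_sum hF, integral_eq_sum hF, integral_eq_sum hF, ← Finset.sum_add_distrib]
  exact Finset.sum_congr rfl fun c _ => chartIntegral_add (hη c) (hζ c)

/-- Change of charts for the contribution of one member of the partition of unity. -/
theorem chartIntegral_change (hor : IsOrientedAtlas S) {η : ThreeForm (𝓡∂ 3) S}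
    (hη : IsTopForm η) {b : S} (hz : ∀ x ∉ (extChartAt (𝓡∂ 3) b).source, ∀ u v w, η x u v w = 0)
    (c : S) :
    chartIntegral c (chartEval η c) = ∫ y in (extChartAt (𝓡∂ 3) b).target,
      chartPartition S c ((extChartAt (𝓡∂ 3) b).symm y) * chartEval η b y := by
  have : IsManifold (𝓡∂ 3) 1 S := .of_le (n := ∞) (by norm_cast)
  set φ := extChartAt (𝓡∂ 3) b with hφ
  set χ := extChartAt (𝓡∂ 3) c with hχ
  let f : E3 → E3 := chartMap (𝓡∂ 3) (𝓡∂ 3) (id : S → S) b c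
  let s : Set E3 := φ.target ∩ {y | φ.symm y ∈ χ.source}
  let s' : Set E3 := χ.target ∩ {y | χ.symm y ∈ φ.source}
  have hsm : MeasurableSet s := by
    obtain ⟨u, hu, hus⟩ := (continuousOn_iff'.1 (continuousOn_extChartAt_symm (I := 𝓡∂ 3) b))
      χ.source (isOpen_extChartAt_source c)
    have : s = u ∩ φ.target := by rw [← hus, inter_comm]; rfl
    rw [this]
    exact hu.measurableSet.inter (measurableSet_target b)
  have himg : f '' s = s' := by
    ext y
    constructor
    · rintro ⟨x, hx, rfl⟩
      have h1 : χ.symm (f x) = φ.symm x := χ.left_inv hx.2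
      exact ⟨χ.map_source hx.2, by rw [mem_ofPred_eq, h1]; exact φ.map_target hx.1⟩
    · intro hy
      refine ⟨φ (χ.symm y), ⟨φ.map_source hy.2, ?_⟩, ?_⟩
      · rw [mem_ofPred_eq, φ.left_inv hy.2]; exact χ.map_target hy.1
      · change χ (φ.symm (φ (χ.symm y))) = y
        rw [φ.left_inv hy.2, χ.right_inv hy.1]
  have hinj : InjOn f s := fun x hx y hy hxy => by
    have h1 : χ.symm (f x) = χ.symm (f y) := congrArg _ hxy
    rw [show χ.symm (f x) = φ.symm x from χ.left_inv hx.2,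
      show χ.symm (f y) = φ.symm y from χ.left_inv hy.2] at h1
    rw [← φ.right_inv hx.1, ← φ.right_inv hy.1, h1]
  have hder : ∀ y ∈ s, HasFDerivWithinAt f (fderivWithin ℝ f (range (𝓡∂ 3)) y) s y := fun y hy => by
    have h1 : ContDiffWithinAt ℝ ∞ f (range (𝓡∂ 3)) y :=
      chartMap_contDiffWithinAt contMDiff_id hy.1 hy.2
    exact (h1.differentiableWithinAt (by simp)).hasFDerivWithinAt.mono
      (inter_subset_left.trans (extChartAt_target_subset_range b))
  have h1 : chartIntegral c (chartEval η c) =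
      ∫ y in s', chartPartition S c (χ.symm y) * chartEval η c y := by
    apply setIntegral_eq_of_subset_of_forall_sdiff_eq_zero (measurableSet_target c) inter_subset_left
    intro y hy
    have : χ.symm y ∉ φ.source := fun h => hy.2 ⟨hy.1, h⟩
    rw [chartEval, hz _ this, mul_zero]
  have h2 : ∫ y in φ.target, chartPartition S c (φ.symm y) * chartEval η b y =
      ∫ y in s, chartPartition S c (φ.symm y) * chartEval η b y := by
    apply setIntegral_eq_of_subset_of_forall_sdiff_eq_zero (measurableSet_target b) inter_subset_left
    intro y hy
    have : φ.symm y ∉ χ.source := fun h => hy.2 ⟨hy.1, h⟩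
    rw [image_eq_zero_of_notMem_tsupport fun h => this (tsupport_chartPartition c h), zero_mul]
  rw [h1, h2, ← himg, integral_image_eq_integral_abs_det_fderiv_smul volume hsm hder hinj]
  refine setIntegral_congr_fun hsm fun y hy => ?_
  have hinv : χ.symm (f y) = φ.symm y := χ.left_inv hy.2
  -- Orientation enters here: the positive Jacobian makes the absolute value in the change of
  -- variables harmless.
  have hdet : 0 < (fderivWithin ℝ f (range (𝓡∂ 3)) y).det := by
    have h := hor _ (chart_mem_atlas (EuclideanHalfSpace 3) b) _
      (chart_mem_atlas (EuclideanHalfSpace 3) c) (φ.symm y)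
      ⟨by rw [← extChartAt_source (𝓡∂ 3)]; exact φ.map_target hy.1,
        by rw [← extChartAt_source (𝓡∂ 3)]; exact hy.2⟩
    have hr : (chartAt (EuclideanHalfSpace 3) b).extend (𝓡∂ 3) (φ.symm y) = y :=
      φ.right_inv hy.1
    rw [hr] at h
    exact h
  -- Chain rule: the inverse chart at `c` composed with the transition map is the inverse chart at
  -- `b`.
  have hpush : ∀ v, coordPush (𝓡∂ 3) c (f y) (fderivWithin ℝ f (range (𝓡∂ 3)) y v) =
      coordPush (𝓡∂ 3) b y v := fun v => by
    have h3 := fderivWithin_chartMap (contMDiff_id (I := 𝓡∂ 3) (M := S)) hy.1 hy.2 v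
    have h4 := congrArg (fun L : E3 →L[ℝ] E3 => L (coordPush (𝓡∂ 3) b y v))
      (mfderivWithin_extChartAt_symm_comp_mfderiv_extChartAt' (I := 𝓡∂ 3) hy.2)
    have h5 : mfderiv (𝓡∂ 3) (𝓡∂ 3) (id : S → S) (φ.symm y) = ContinuousLinearMap.id ℝ _ := mfderiv_id
    rw [h5] at h3
    refine Eq.trans ?_ h4
    exact congrArg (coordPush (𝓡∂ 3) c (f y)) h3
  have htop := hη (φ.symm y) (coordPush (𝓡∂ 3) c (f y)) (fderivWithin ℝ f (range (𝓡∂ 3)) y)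
  have hE : ∀ (p q : S), p = q → ∀ u v w : E3, η p u v w = η q u v w := by
    rintro p q rfl u v w; rfl
  have hev : chartEval η b y = (fderivWithin ℝ f (range (𝓡∂ 3)) y).det * chartEval η c (f y) := by
    have e1 : chartEval η c (f y) = η (φ.symm y)
      (coordPush (𝓡∂ 3) c (f y) (EuclideanSpace.single 0 1))
      (coordPush (𝓡∂ 3) c (f y) (EuclideanSpace.single 1 1))
      (coordPush (𝓡∂ 3) c (f y) (EuclideanSpace.single 2 1)) := hE _ _ hinv _ _ _
    rw [e1]
    refine Eq.trans ?_ htop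
    have e2 : ∀ u v w u' v' w' : E3, u = u' → v = v' → w = w' →
      η (φ.symm y) u v w = η (φ.symm y) u' v' w' := by rintro u v w _ _ _ rfl rfl rfl; rfl
    exact e2 _ _ _ _ _ _ (hpush _).symm (hpush _).symm (hpush _).symm
  simp only [hinv, abs_of_pos hdet, smul_eq_mul, hev]
  ring

/-- The integral of a three-form supported in a chart domain is its integral in that chart. -/
theorem integral_eq_chart (hor : IsOrientedAtlas S) {η : ThreeForm (𝓡∂ 3) S}
    (hη : IsTopForm η) (hc : ContForm η) {b : S} {K : Set S} (hK : IsClosed K)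
    (hKs : K ⊆ (extChartAt (𝓡∂ 3) b).source) (hz : ∀ x ∉ K, ∀ u v w, η x u v w = 0) :
    integral η = ∫ y in (extChartAt (𝓡∂ 3) b).target, chartEval η b y := by
  obtain ⟨F, hF⟩ := exists_finset_chartPartition (S := S)
  -- Each contribution is moved to the chart at `b`, where the members of the partition add up to
  -- one.
  rw [integral_eq_sum hF, Finset.sum_congr rfl fun c _ =>
    chartIntegral_change hor hη (fun x hx => hz x fun h => hx (hKs h)) c,
    ← integral_finsetSum]
  · refine setIntegral_congr_fun (measurableSet_target b) fun y _ => ?_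
    rw [← Finset.sum_mul, sum_chartPartition hF, one_mul]
  · intro c _
    refine integrableOn_chart hK hKs ((continuousOn_chartPartition c b).mul (hc b)) fun y _ hy => ?_
    rw [chartEval, hz _ hy, mul_zero]

end Integration

/-! ### Differentiating integrals of one-parameter families of forms. -/

section Variation

/-- `g s = g 0 + s g' + O(s²)` on `T`, with continuous coefficients and remainder. -/
def HasVariationOn (T : Set E3) (g : ℝ → E3 → ℝ) (g' : E3 → ℝ) : Prop :=
  ContinuousOn (g 0) T ∧ ContinuousOn g' T ∧ ∃ r : ℝ → E3 → ℝ,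
    ContinuousOn (fun p : ℝ × E3 => r p.1 p.2) (univ ×ˢ T) ∧
      ∀ s, ∀ y ∈ T, g s y = g 0 y + s * g' y + s ^ 2 * r s y

namespace HasVariationOn

variable {T : Set E3} {g h : ℝ → E3 → ℝ} {g' h' : E3 → ℝ}

theorem affine {g₀ g₁ : E3 → ℝ} (h₀ : ContinuousOn g₀ T) (h₁ : ContinuousOn g₁ T) :
    HasVariationOn T (fun s y => g₀ y + s * g₁ y) g₁ :=
  ⟨by simpa using h₀, h₁, fun _ _ => 0, continuousOn_const, fun s y _ => by ring⟩

theorem congr (hg : HasVariationOn T g g') (h1 : ∀ s, ∀ y ∈ T, h s y = g s y)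
    (h2 : ∀ y ∈ T, h' y = g' y) : HasVariationOn T h h' := by
  obtain ⟨c0, c1, r, hr, e⟩ := hg
  exact ⟨c0.congr fun y hy => h1 0 y hy, c1.congr h2, r, hr, fun s y hy => by
    rw [h1 s y hy, h1 0 y hy, h2 y hy, e s y hy]⟩

theorem const {g₀ : E3 → ℝ} (h₀ : ContinuousOn g₀ T) :
    HasVariationOn T (fun _ => g₀) fun _ => 0 :=
  (affine h₀ continuousOn_const).congr (fun s y _ => by ring) fun _ _ => rfl

theorem add (hg : HasVariationOn T g g') (hh : HasVariationOn T h h') :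
    HasVariationOn T (fun s y => g s y + h s y) fun y => g' y + h' y := by
  obtain ⟨c0, c1, r, hr, e⟩ := hg
  obtain ⟨d0, d1, q, hq, f⟩ := hh
  exact ⟨c0.add d0, c1.add d1, fun s y => r s y + q s y, hr.add hq, fun s y hy => by
    beta_reduce
    rw [e s y hy, f s y hy]; ring⟩

theorem mul (hg : HasVariationOn T g g') (hh : HasVariationOn T h h') :
    HasVariationOn T (fun s y => g s y * h s y) fun y => g' y * h 0 y + g 0 y * h' y := by
  obtain ⟨c0, c1, r, hr, e⟩ := hg
  obtain ⟨d0, d1, q, hq, f⟩ := hh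
  have hsnd : ∀ {k : E3 → ℝ}, ContinuousOn k T →
      ContinuousOn (fun p : ℝ × E3 => k p.2) (univ ×ˢ T) := fun hk =>
    hk.comp continuous_snd.continuousOn fun p hp => hp.2
  have hfst : ContinuousOn (fun p : ℝ × E3 => p.1) (univ ×ˢ T) := continuous_fst.continuousOn
  refine ⟨c0.mul d0, (c1.mul d0).add (c0.mul d1), fun s y => g 0 y * q s y + r s y * h 0 y +
    g' y * h' y + s * (g' y * q s y + r s y * h' y) + s ^ 2 * (r s y * q s y), ?_, fun s y hy => by
    beta_reduce
    rw [e s y hy, f s y hy]; ring⟩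
  exact (((((hsnd c0).mul hq).add (hr.mul (hsnd d0))).add ((hsnd c1).mul (hsnd d1))).add
    (hfst.mul (((hsnd c1).mul hq).add (hr.mul (hsnd d1))))).add ((hfst.pow 2).mul (hr.mul hq))

theorem const_mul (k : ℝ) (hg : HasVariationOn T g g') :
    HasVariationOn T (fun s y => k * g s y) fun y => k * g' y :=
  ((const (continuousOn_const (c := k))).mul hg).congr (fun _ _ _ => rfl) fun y _ => by ring

theorem sub (hg : HasVariationOn T g g') (hh : HasVariationOn T h h') :
    HasVariationOn T (fun s y => g s y - h s y) fun y => g' y - h' y :=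
  (hg.add (hh.const_mul (-1))).congr (fun _ _ _ => by ring) fun _ _ => by ring

theorem sum {κ : Type*} (s : Finset κ) {g : κ → ℝ → E3 → ℝ} {g' : κ → E3 → ℝ}
    (hg : ∀ k, HasVariationOn T (g k) (g' k)) :
    HasVariationOn T (fun t y => ∑ k ∈ s, g k t y) fun y => ∑ k ∈ s, g' k y := by
  classical
  induction s using Finset.induction_on with
  | empty => simpa using const (T := T) (continuousOn_const (c := (0 : ℝ)))
  | insert k s hk ih =>
    simp only [Finset.sum_insert hk]
    exact (hg k).add ih

end HasVariationOn

variable {S : Type*} [TopologicalSpace S] [ChartedSpace (EuclideanHalfSpace 3) S]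

section
variable [IsManifold (𝓡∂ 3) ∞ S] [T2Space S] [CompactSpace S]

/-- The expansion integrates to I(0) + s(I' + s R(s)). The remainder R(s) is bounded for |s| ≤ 1,
since the support of the partition function has compact image in the chart, so the difference
quotient tends to I'. -/
theorem hasDerivAt_chartIntegral {c : S} {g : ℝ → E3 → ℝ} {g' : E3 → ℝ}
    (hg : HasVariationOn (extChartAt (𝓡∂ 3) c).target g g') :
    HasDerivAt (fun s => chartIntegral c (g s)) (chartIntegral c g') 0 := by
  obtain ⟨c0, c1, r, hr, e⟩ := hg
  set T := (extChartAt (𝓡∂ 3) c).target with hT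
  set ρ : E3 → ℝ := fun y => chartPartition S c ((extChartAt (𝓡∂ 3) c).symm y) with hρ
  have hrs : ∀ s, ContinuousOn (r s) T := fun s =>
    hr.comp (continuous_const.prodMk continuous_id).continuousOn fun y hy => ⟨mem_univ _, hy⟩
  have hexp : ∀ s, chartIntegral c (g s) =
      chartIntegral c (g 0) + s * (chartIntegral c g' + s * chartIntegral c (r s)) := fun s => by
    have h1 : chartIntegral c (g s) =
        chartIntegral c (fun y => g 0 y + s * (g' y + s * r s y)) := by
      refine setIntegral_congr_fun (measurableSet_target c) fun y hy => ?_
      simp only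
      rw [e s y hy]; ring
    rw [h1, chartIntegral_add (h := fun y => s * (g' y + s * r s y)) c0
      (continuousOn_const.mul (c1.add (continuousOn_const.mul (hrs s)))),
      chartIntegral_const_mul, chartIntegral_add (h := fun y => s * r s y) c1
      (continuousOn_const.mul (hrs s)), chartIntegral_const_mul]
  have hK := isCompact_chart_image (isClosed_tsupport (chartPartition S c))
    (tsupport_chartPartition c)
  have hKT : extChartAt (𝓡∂ 3) c '' tsupport (chartPartition S c) ⊆ T := by
    rintro _ ⟨x, hx, rfl⟩
    exact (extChartAt (𝓡∂ 3) c).map_source (tsupport_chartPartition c hx)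
  obtain ⟨C, hC⟩ := (isCompact_Icc (a := (-1 : ℝ)) (b := 1)).prod hK |>.exists_bound_of_continuousOn
    (hr.mono (prod_mono (subset_univ _) hKT))
  have hbound : ∀ s ∈ Icc (-1 : ℝ) 1, ‖chartIntegral c (r s)‖ ≤ chartIntegral c fun _ => C := by
    intro s hs
    refine norm_integral_le_of_norm_le (integrableOn_partition_mul continuousOn_const) ?_
    refine (ae_restrict_iff' (measurableSet_target c)).2 (Eventually.of_forall fun y hy => ?_)
    by_cases hy' : (extChartAt (𝓡∂ 3) c).symm y ∈ tsupport (chartPartition S c)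
    · have h1 := hC (s, y) ⟨hs, _, hy', (extChartAt (𝓡∂ 3) c).right_inv hy⟩
      rw [norm_mul, Real.norm_of_nonneg ((chartPartition S).nonneg c _)]
      exact mul_le_mul_of_nonneg_left h1 ((chartPartition S).nonneg c _)
    · rw [image_eq_zero_of_notMem_tsupport hy']; simp
  rw [hasDerivAt_iff_tendsto_slope_zero]
  have hlim : Tendsto (fun s : ℝ => chartIntegral c g' + s * chartIntegral c (r s)) (𝓝[≠] 0)
      (𝓝 (chartIntegral c g' + 0)) := by
    refine tendsto_const_nhds.add ?_
    refine Tendsto.zero_mul_isBoundedUnder_le (tendsto_id.mono_left nhdsWithin_le_nhds) ?_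
    refine ⟨chartIntegral c fun _ => C, ?_⟩
    rw [eventually_map]
    filter_upwards [mem_nhdsWithin_of_mem_nhds (Icc_mem_nhds (by norm_num : (-1 : ℝ) < 0)
      (by norm_num : (0 : ℝ) < 1))] with s hs
    exact hbound s hs
  rw [add_zero] at hlim
  refine hlim.congr' ?_
  filter_upwards [self_mem_nhdsWithin] with s hs
  have hs' : s ≠ 0 := hs
  rw [zero_add, hexp s]
  simp only [smul_eq_mul]
  field_simp
  ring

end

/-- The components of a one-form in a chart. -/
noncomputable def chartEval1 (a : CovectorField (𝓡∂ 3) S) (c : S) (m : Fin 3) (y : E3) : ℝ :=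
  a ((extChartAt (𝓡∂ 3) c).symm y) (coordPush (𝓡∂ 3) c y (EuclideanSpace.single m 1))

/-- The components of a two-form in a chart. -/
noncomputable def chartEval2 (β : TwoForm (𝓡∂ 3) S) (c : S) (m n : Fin 3) (y : E3) : ℝ :=
  β ((extChartAt (𝓡∂ 3) c).symm y) (coordPush (𝓡∂ 3) c y (EuclideanSpace.single m 1))
    (coordPush (𝓡∂ 3) c y (EuclideanSpace.single n 1))

/-- A family of one-forms with a continuous first variation. -/
def CovVariation (a : ℝ → CovectorField (𝓡∂ 3) S) (a' : CovectorField (𝓡∂ 3) S) : Prop :=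
  ∀ c m, HasVariationOn (extChartAt (𝓡∂ 3) c).target (fun s => chartEval1 (a s) c m)
    (chartEval1 a' c m)

/-- A family of two-forms with a continuous first variation. -/
def TwoVariation (β : ℝ → TwoForm (𝓡∂ 3) S) (β' : TwoForm (𝓡∂ 3) S) : Prop :=
  ∀ c m n, HasVariationOn (extChartAt (𝓡∂ 3) c).target (fun s => chartEval2 (β s) c m n)
    (chartEval2 β' c m n)

/-- A family of three-forms with a continuous first variation. -/
def ThreeVariation (η : ℝ → ThreeForm (𝓡∂ 3) S) (η' : ThreeForm (𝓡∂ 3) S) : Prop :=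
  ∀ c, HasVariationOn (extChartAt (𝓡∂ 3) c).target (fun s => chartEval (η s) c) (chartEval η' c)

theorem ThreeVariation.contForm {η : ℝ → ThreeForm (𝓡∂ 3) S} {η' : ThreeForm (𝓡∂ 3) S}
    (h : ThreeVariation η η') : ContForm η' := fun c => (h c).2.1

theorem ThreeVariation.hasDerivAt [IsManifold (𝓡∂ 3) ∞ S] [T2Space S] [CompactSpace S]
    {η : ℝ → ThreeForm (𝓡∂ 3) S} {η' : ThreeForm (𝓡∂ 3) S}
    (h : ThreeVariation η η') : HasDerivAt (fun s => integral (η s)) (integral η') 0 := by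
  obtain ⟨F, hF⟩ := exists_finset_chartPartition (S := S)
  simp only [integral_eq_sum hF]
  exact HasDerivAt.fun_sum fun c _ => hasDerivAt_chartIntegral (h c)

theorem continuousOn_chartEval1 {a : CovectorField (𝓡∂ 3) S} (ha : SmoothCov a) (c : S)
    (m : Fin 3) : ContinuousOn (chartEval1 a c m) (extChartAt (𝓡∂ 3) c).target :=
  (ha c).continuousOn.clm_apply continuousOn_const

theorem CovVariation.affine {a b : CovectorField (𝓡∂ 3) S} (ha : SmoothCov a) (hb : SmoothCov b) :
    CovVariation (fun s x => a x + s • b x) b := fun c m =>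
  .affine (continuousOn_chartEval1 ha c m) (continuousOn_chartEval1 hb c m)

theorem CovVariation.const {a : CovectorField (𝓡∂ 3) S} (ha : SmoothCov a) :
    CovVariation (fun _ => a) fun _ => 0 := fun c m => .const (continuousOn_chartEval1 ha c m)

theorem CovVariation.add {a b : ℝ → CovectorField (𝓡∂ 3) S} {a' b' : CovectorField (𝓡∂ 3) S}
    (ha : CovVariation a a') (hb : CovVariation b b') :
    CovVariation (fun s x => a s x + b s x) fun x => a' x + b' x := fun c m =>
  (ha c m).add (hb c m)

theorem CovVariation.sub {a b : ℝ → CovectorField (𝓡∂ 3) S} {a' b' : CovectorField (𝓡∂ 3) S}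
    (ha : CovVariation a a') (hb : CovVariation b b') :
    CovVariation (fun s x => a s x - b s x) fun x => a' x - b' x := fun c m =>
  (ha c m).sub (hb c m)

theorem CovVariation.smul {f : S → ℝ} {a : ℝ → CovectorField (𝓡∂ 3) S}
    {a' : CovectorField (𝓡∂ 3) S} (hf : SmoothFn f) (ha : CovVariation a a') :
    CovVariation (fun s x => f x • a s x) fun x => f x • a' x := fun c m =>
  ((HasVariationOn.const (hf c).continuousOn).mul (ha c m)).congr (fun _ _ _ => rfl)
    fun y _ => by
      rw [zero_mul, zero_add]; rfl

theorem CovVariation.sum {κ : Type*} (s : Finset κ) {a : κ → ℝ → CovectorField (𝓡∂ 3) S}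
    {a' : κ → CovectorField (𝓡∂ 3) S} (ha : ∀ k, CovVariation (a k) (a' k)) :
    CovVariation (fun t x => ∑ k ∈ s, a k t x) fun x => ∑ k ∈ s, a' k x := by
  classical
  induction s using Finset.induction_on with
  | empty => simpa using CovVariation.const SmoothCov.zero
  | insert k s hk ih =>
    simp only [Finset.sum_insert hk]
    exact (ha k).add ih

theorem TwoVariation.add {β γ : ℝ → TwoForm (𝓡∂ 3) S} {β' γ' : TwoForm (𝓡∂ 3) S}
    (hβ : TwoVariation β β') (hγ : TwoVariation γ γ') :
    TwoVariation (fun s x u v => β s x u v + γ s x u v) fun x u v => β' x u v + γ' x u v :=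
  fun c m n => (hβ c m n).add (hγ c m n)

theorem TwoVariation.const_mul (k : ℝ) {β : ℝ → TwoForm (𝓡∂ 3) S} {β' : TwoForm (𝓡∂ 3) S}
    (hβ : TwoVariation β β') :
    TwoVariation (fun s x u v => k * β s x u v) fun x u v => k * β' x u v :=
  fun c m n => (hβ c m n).const_mul k

theorem TwoVariation.sum {κ : Type*} (s : Finset κ) {β : κ → ℝ → TwoForm (𝓡∂ 3) S}
    {β' : κ → TwoForm (𝓡∂ 3) S} (hβ : ∀ k, TwoVariation (β k) (β' k)) :
    TwoVariation (fun t x u v => ∑ k ∈ s, β k t x u v) fun x u v => ∑ k ∈ s, β' k x u v :=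
  fun c m n => HasVariationOn.sum s fun k => hβ k c m n

theorem TwoVariation.wedge11 {a b : ℝ → CovectorField (𝓡∂ 3) S} {a' b' : CovectorField (𝓡∂ 3) S}
    (ha : CovVariation a a') (hb : CovVariation b b') :
    TwoVariation (fun s => wedge11 (a s) (b s))
      fun x u v => wedge11 a' (b 0) x u v + wedge11 (a 0) b' x u v := fun c m n =>
  (((ha c m).mul (hb c n)).sub ((ha c n).mul (hb c m))).congr (fun _ _ _ => rfl) fun y _ => by
    simp only [chartEval1, chartEval2, HKBoundary.wedge11]
    ring

theorem TwoVariation.extD1 [IsManifold (𝓡∂ 3) ∞ S] {a b : CovectorField (𝓡∂ 3) S}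
    (ha : SmoothCov a) (hb : SmoothCov b) :
    TwoVariation (fun s => extD1 fun x => a x + s • b x) (extD1 b) := fun c m n => by
  have hcont : ∀ {d : CovectorField (𝓡∂ 3) S}, SmoothCov d → ContinuousOn
      (chartEval2 (HKBoundary.extD1 d) c m n) (extChartAt (𝓡∂ 3) c).target := fun {d} hd => by
    have h := (contDiffOn_fderivWithin_target (hd c)).continuousOn
    exact (((h.clm_apply continuousOn_const).clm_apply continuousOn_const).sub
      ((h.clm_apply continuousOn_const).clm_apply continuousOn_const)).congr
      fun y hy => hd.extD1_coordPush hy _ _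
  refine (HasVariationOn.affine (hcont ha) (hcont hb)).congr (fun s y hy => ?_) fun _ _ => rfl
  have hs : SmoothCov fun x => s • b x := SmoothCov.smul (SmoothFn.const s) hb
  exact (extD1_add ha hs _ _ _).trans (congrArg (_ + ·) (extD1_const_smul s hb _ _ _))

theorem ThreeVariation.wedge12 {a : ℝ → CovectorField (𝓡∂ 3) S} {a' : CovectorField (𝓡∂ 3) S}
    {β : ℝ → TwoForm (𝓡∂ 3) S} {β' : TwoForm (𝓡∂ 3) S}
    (ha : CovVariation a a') (hβ : TwoVariation β β') :
    ThreeVariation (fun s => wedge12 (a s) (β s))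
      fun x u v w => wedge12 a' (β 0) x u v w + wedge12 (a 0) β' x u v w := fun c =>
  ((((ha c 0).mul (hβ c 1 2)).sub ((ha c 1).mul (hβ c 0 2))).add
    ((ha c 2).mul (hβ c 0 1))).congr (fun _ _ _ => rfl) fun y _ => by
    simp only [chartEval1, chartEval2, chartEval, HKBoundary.wedge12]
    ring

theorem ThreeVariation.sub {η ζ : ℝ → ThreeForm (𝓡∂ 3) S} {η' ζ' : ThreeForm (𝓡∂ 3) S}
    (hη : ThreeVariation η η') (hζ : ThreeVariation ζ ζ') :
    ThreeVariation (fun s x u v w => η s x u v w - ζ s x u v w)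
      fun x u v w => η' x u v w - ζ' x u v w :=
  fun c => (hη c).sub (hζ c)

theorem ThreeVariation.const_mul (k : ℝ) {η : ℝ → ThreeForm (𝓡∂ 3) S} {η' : ThreeForm (𝓡∂ 3) S}
    (hη : ThreeVariation η η') :
    ThreeVariation (fun s x u v w => k * η s x u v w) fun x u v w => k * η' x u v w :=
  fun c => (hη c).const_mul k

theorem ThreeVariation.fn_mul {f : S → ℝ} (hf : SmoothFn f) {η : ℝ → ThreeForm (𝓡∂ 3) S}
    {η' : ThreeForm (𝓡∂ 3) S} (hη : ThreeVariation η η') :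
    ThreeVariation (fun s x u v w => f x * η s x u v w) fun x u v w => f x * η' x u v w :=
  fun c => ((HasVariationOn.const (hf c).continuousOn).mul (hη c)).congr (fun _ _ _ => rfl)
    fun y _ => by rw [zero_mul, zero_add]; rfl

theorem ThreeVariation.sum {κ : Type*} (s : Finset κ) {η : κ → ℝ → ThreeForm (𝓡∂ 3) S}
    {η' : κ → ThreeForm (𝓡∂ 3) S} (hη : ∀ k, ThreeVariation (η k) (η' k)) :
    ThreeVariation (fun t x u v w => ∑ k ∈ s, η k t x u v w)
      fun x u v w => ∑ k ∈ s, η' k x u v w :=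
  fun c => HasVariationOn.sum s fun k => hη k c

end Variation

/-! ### Values of the antisymmetric symbol, used to expand internal sums. -/

theorem eps_self_left (i k : Fin 3) : eps i i k = 0 := by simp [eps]

theorem eps_self_right (i k : Fin 3) : eps i k k = 0 := by simp [eps]

theorem eps_self_outer (i k : Fin 3) : eps i k i = 0 := by simp [eps]

theorem eps_values : eps 0 1 2 = 1 ∧ eps 0 2 1 = -1 ∧ eps 1 0 2 = -1 ∧ eps 1 2 0 = 1 ∧
    eps 2 0 1 = 1 ∧ eps 2 1 0 = -1 := by
  norm_num [eps]

/-! ### First variations of the field strengths and of the Hamiltonian. -/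

section FieldVariation

variable {S : Type*} [TopologicalSpace S] [ChartedSpace (EuclideanHalfSpace 3) S]
  [IsManifold (𝓡∂ 3) ∞ S]

/-- The linearization of `D e^i` in the direction `(a, b)`. -/
noncomputable def linTorsion (q : Fields S) (a b : Fin 3 → OneForm S) (i : Fin 3) : TwoForm (𝓡∂ 3) S :=
  fun x u v => covD1 (cov q.A) (cov b) i x u v +
    ∑ j, ∑ k, eps i j k * wedge11 (cov a j) (cov q.e k) x u v

/-- The linearization of `Π_{A i}` in the direction `(a, b)`. -/
noncomputable def linPiA (α : Couplings) (q : Fields S) (a b : Fin 3 → OneForm S) (i : Fin 3) :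
    TwoForm (𝓡∂ 3) S := fun x u v =>
  α.α₁ * (2 * ∑ j, ∑ k, eps i j k * wedge11 (cov q.e j) (cov b k) x u v) +
    2 * α.α₃ * covD1 (cov q.A) (cov a) i x u v + α.α₅ * linTorsion q a b i x u v

/-- The linearization of `Π_{e i}` in the direction `(a, b)`. -/
noncomputable def linPiE (α : Couplings) (q : Fields S) (a b : Fin 3 → OneForm S) (i : Fin 3) :
    TwoForm (𝓡∂ 3) S := fun x u v =>
  2 * α.α₂ * linTorsion q a b i x u v +
    α.α₄ * (2 * ∑ j, ∑ k, eps i j k * wedge11 (cov q.e j) (cov b k) x u v) +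
    α.α₅ * covD1 (cov q.A) (cov a) i x u v

omit [IsManifold (𝓡∂ 3) ∞ S] in
theorem TwoVariation.congr {β : ℝ → TwoForm (𝓡∂ 3) S} {β' β'' : TwoForm (𝓡∂ 3) S}
    (h : TwoVariation β β') (h' : ∀ x u v, β'' x u v = β' x u v) : TwoVariation β β'' := by
  have : β'' = β' := funext fun x => funext fun u => funext fun v => h' x u v
  rwa [this]

omit [IsManifold (𝓡∂ 3) ∞ S] in
theorem ThreeVariation.congr {η : ℝ → ThreeForm (𝓡∂ 3) S} {η' η'' : ThreeForm (𝓡∂ 3) S}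
    (h : ThreeVariation η η') (h' : ∀ x u v w, η'' x u v w = η' x u v w) :
    ThreeVariation η η'' := by
  have : η'' = η' := funext fun x => funext fun u => funext fun v => funext fun w => h' x u v w
  rwa [this]

theorem variation_cov (A a : Fin 3 → OneForm S) (i : Fin 3) :
    CovVariation (fun s => cov (A + s • a) i) (cov a i) :=
  .affine (smoothCov_cov A i) (smoothCov_cov a i)

theorem add_zero_smul (A a : Fin 3 → OneForm S) : A + (0 : ℝ) • a = A :=
  (congrArg (A + ·) (zero_smul ℝ a)).trans (add_zero A)

theorem add_smul_zero (A : Fin 3 → OneForm S) (s : ℝ) : A + s • (0 : Fin 3 → OneForm S) = A :=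
  (congrArg (A + ·) (smul_zero s)).trans (add_zero A)

theorem cov_zero_smul (A a : Fin 3 → OneForm S) : cov (A + (0 : ℝ) • a) = cov A := by
  rw [add_zero_smul]

/-- Varying either factor gives the same term, because both the symbol and the wedge product change
sign under exchange; hence the factor 2. -/
theorem variation_epsWedge (e b : Fin 3 → OneForm S) (i : Fin 3) :
    TwoVariation (fun s => epsWedge (cov (e + s • b)) i)
      fun x u v => 2 * ∑ j, ∑ k, eps i j k * wedge11 (cov e j) (cov b k) x u v := by
  refine (TwoVariation.sum _ fun j => TwoVariation.sum _ fun k => TwoVariation.const_mul (eps i j k)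
    (TwoVariation.wedge11 (variation_cov e b j) (variation_cov e b k))).congr fun x u v => ?_
  simp only [cov_zero_smul]
  fin_cases i <;> simp only [Fin.zero_eta, Fin.mk_one, Fin.reduceFinMk, Fin.sum_univ_three, eps_values, eps_self_left, eps_self_right, eps_self_outer,
    wedge11] <;> ring

/-- The variation of the curvature is the covariant derivative of the variation of the connection;
the 1/2 in the curvature cancels the 2 of `variation_epsWedge`. -/
theorem variation_curv (A a : Fin 3 → OneForm S) (i : Fin 3) :
    TwoVariation (fun s => curv (cov (A + s • a)) i) (covD1 (cov A) (cov a) i) := by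
  refine ((TwoVariation.extD1 (smoothCov_cov A i) (smoothCov_cov a i)).add
    ((variation_epsWedge A a i).const_mul (1 / 2))).congr fun x u v => ?_
  simp only [covD1]
  ring

theorem variation_covD1 (q : Fields S) (a b : Fin 3 → OneForm S) (i : Fin 3) :
    TwoVariation (fun s => covD1 (cov (q.A + s • a)) (cov (q.e + s • b)) i)
      (linTorsion q a b i) := by
  refine ((TwoVariation.extD1 (smoothCov_cov q.e i) (smoothCov_cov b i)).add
    (TwoVariation.sum _ fun j => TwoVariation.sum _ fun k => TwoVariation.const_mul (eps i j k)
    (TwoVariation.wedge11 (variation_cov q.A a j) (variation_cov q.e b k)))).congr fun x u v => ?_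
  simp only [cov_zero_smul, linTorsion, covD1, mul_add, Finset.sum_add_distrib]
  ring

theorem variation_PiA (α : Couplings) (q Y : Fields S) (i : Fin 3) :
    TwoVariation (fun s => PiA α (q.move s Y) i) (linPiA α q Y.A Y.e i) :=
  (((variation_epsWedge q.e Y.e i).const_mul α.α₁).add
    ((variation_curv q.A Y.A i).const_mul (2 * α.α₃))).add
    ((variation_covD1 q Y.A Y.e i).const_mul α.α₅)

theorem variation_PiE (α : Couplings) (q Y : Fields S) (i : Fin 3) :
    TwoVariation (fun s => PiE α (q.move s Y) i) (linPiE α q Y.A Y.e i) :=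
  (((variation_covD1 q Y.A Y.e i).const_mul (2 * α.α₂)).add
    ((variation_epsWedge q.e Y.e i).const_mul α.α₄)).add
    ((variation_curv q.A Y.A i).const_mul α.α₅)

theorem move_zero (q Y : Fields S) : q.move 0 Y = q := by
  simp [Fields.move, add_zero_smul]

/-- The linearization of the Hamiltonian density in the direction `(a, b)`. -/
noncomputable def linHam (α : Couplings) (q : Fields S) (a b : Fin 3 → OneForm S) : ThreeForm (𝓡∂ 3) S :=
  fun x u v w =>
    (∑ i, (wedge12 (fun x => ∑ j, ∑ k, (eps i j k * fn q.Aperp k x) • cov a j x) (PiA α q i) x u v w +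
      wedge12 (covD0 (cov q.A) (fn q.Aperp) i) (linPiA α q a b i) x u v w))
    - 2 * (∑ i, ∑ j, ∑ k, eps i j k * q.eperp i x *
        (wedge12 (cov b j) (fun x u v => α.α₁ * curv (cov q.A) k x u v +
            α.α₄ * covD1 (cov q.A) (cov q.e) k x u v) x u v w +
          wedge12 (cov q.e j) (fun x u v => α.α₁ * covD1 (cov q.A) (cov a) k x u v +
            α.α₄ * linTorsion q a b k x u v) x u v w))
    - ∑ i, (wedge12 (fun x => epsContract (fn q.Aperp) (cov b) i x -
          ∑ j, ∑ k, (eps i j k * fn q.eperp k x) • cov a j x) (PiE α q i) x u v w +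
        wedge12 (fun x => epsContract (fn q.Aperp) (cov q.e) i x -
          covD0 (cov q.A) (fn q.eperp) i x) (linPiE α q a b i) x u v w)

theorem variation_covD0 (A a : Fin 3 → OneForm S) (τ : Fin 3 → ScalarField S) (i : Fin 3) :
    CovVariation (fun s => covD0 (cov (A + s • a)) (fn τ) i)
      fun x => ∑ j, ∑ k, (eps i j k * fn τ k x) • cov a j x := by
  have h := (CovVariation.const (smoothFn_scalar (τ i)).extD0).add
    (CovVariation.sum Finset.univ fun j => CovVariation.sum Finset.univ fun k => CovVariation.smul
      ((SmoothFn.const (eps i j k)).mul (smoothFn_scalar (τ k))) (variation_cov A a j))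
  simp only [zero_add] at h
  exact h

theorem variation_epsContract (e b : Fin 3 → OneForm S) (τ : Fin 3 → ScalarField S) (i : Fin 3) :
    CovVariation (fun s => epsContract (fn τ) (cov (e + s • b)) i)
      (epsContract (fn τ) (cov b) i) :=
  CovVariation.sum Finset.univ fun j => CovVariation.sum Finset.univ fun k => CovVariation.smul
    ((SmoothFn.const (eps i j k)).mul (smoothFn_scalar (τ j))) (variation_cov e b k)

omit [IsManifold (𝓡∂ 3) ∞ S] in
theorem ThreeVariation.wedge12' {a : ℝ → CovectorField (𝓡∂ 3) S} {a₀ a' : CovectorField (𝓡∂ 3) S}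
    {β : ℝ → TwoForm (𝓡∂ 3) S} {β₀ β' : TwoForm (𝓡∂ 3) S}
    (ha : CovVariation a a') (hβ : TwoVariation β β') (h1 : a 0 = a₀) (h2 : β 0 = β₀) :
    ThreeVariation (fun s => HKBoundary.wedge12 (a s) (β s))
      fun x u v w => HKBoundary.wedge12 a' β₀ x u v w + HKBoundary.wedge12 a₀ β' x u v w := by
  subst h1 h2; exact ThreeVariation.wedge12 ha hβ

/-! ### Dirac's equation and elimination of the multipliers. -/

section Phase
variable [T2Space S] [CompactSpace S]

/-- The direction `(a, b)` in configuration space. -/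
noncomputable def configDirection (a b : Fin 3 → OneForm S) : PhasePoint S :=
  ⟨⟨0, a, 0, b⟩, ⟨0, 0, 0, 0⟩⟩

omit [T2Space S] [CompactSpace S] in
theorem variation_hamiltonian (α : Couplings) (q : Fields S) (a b : Fin 3 → OneForm S) :
    ThreeVariation (fun s x u v w =>
      (∑ i, wedge12 (covD0 (cov (q.A + s • a)) (fn q.Aperp) i) (PiA α (q.move s ⟨0, a, 0, b⟩) i) x u v w)
      - 2 * (∑ i, ∑ j, ∑ k, eps i j k * q.eperp i x *
        wedge12 (cov (q.e + s • b) j)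
          (fun x u v => α.α₁ * curv (cov (q.A + s • a)) k x u v +
            α.α₄ * covD1 (cov (q.A + s • a)) (cov (q.e + s • b)) k x u v) x u v w)
      - ∑ i, wedge12
        (fun x => epsContract (fn q.Aperp) (cov (q.e + s • b)) i x -
          covD0 (cov (q.A + s • a)) (fn q.eperp) i x)
        (PiE α (q.move s ⟨0, a, 0, b⟩) i) x u v w) (linHam α q a b) := by
  refine ((ThreeVariation.sum _ fun i => ?_).sub (ThreeVariation.const_mul 2
    (ThreeVariation.sum _ fun i => ThreeVariation.sum _ fun j => ThreeVariation.sum _ fun k =>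
      ThreeVariation.fn_mul ?_ ?_))).sub (ThreeVariation.sum _ fun i => ?_)
  · exact ThreeVariation.wedge12' (variation_covD0 q.A a q.Aperp i) (variation_PiA α q _ i)
      (by simp only [cov_zero_smul]) (by simp only [move_zero])
  · exact (SmoothFn.const _).mul (smoothFn_scalar _)
  · exact ThreeVariation.wedge12' (variation_cov q.e b j)
      (((variation_curv q.A a k).const_mul α.α₁).add ((variation_covD1 q a b k).const_mul α.α₄))
      (by simp only [cov_zero_smul]) (by simp only [cov_zero_smul])
  · exact ThreeVariation.wedge12' ((variation_epsContract q.e b q.Aperp i).sub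
      (variation_covD0 q.A a q.eperp i)) (variation_PiE α q _ i)
      (by simp only [cov_zero_smul]) (by simp only [move_zero])

/-- Only variations of A and e are needed: variations of A_⊥ and e_⊥ would lead to the secondary
constraints, which are hypotheses of the main theorem. -/
theorem phaseD_hamiltonian (α : Couplings) (z : PhasePoint S) (a b : Fin 3 → OneForm S) :
    phaseD (hamiltonian α) z (configDirection a b) = integral (linHam α z.q a b) := by
  have h := (variation_hamiltonian α z.q a b).hasDerivAt.deriv
  rw [← h]
  refine congrArg (fun f => deriv f 0) (funext fun s => ?_)
  have e1 : z.q.Aperp + s • (0 : Fin 3 → ScalarField S) = z.q.Aperp := by rw [smul_zero, add_zero]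
  have e2 : z.q.eperp + s • (0 : Fin 3 → ScalarField S) = z.q.eperp := by rw [smul_zero, add_zero]
  simp only [hamiltonian, PhasePoint.move, Fields.move, configDirection, e1, e2]

/-- `∑_i w^i ∧ β_i`. -/
noncomputable def pairing (w : Fin 3 → OneForm S) (β : Fin 3 → TwoForm (𝓡∂ 3) S) : ThreeForm (𝓡∂ 3) S :=
  fun x u v t => ∑ i, wedge12 (cov w i) (β i) x u v t

omit [T2Space S] [CompactSpace S] in
theorem variation_pairing (w : Fin 3 → OneForm S) {β : ℝ → Fin 3 → TwoForm (𝓡∂ 3) S}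
    {β' : Fin 3 → TwoForm (𝓡∂ 3) S} (h : ∀ i, TwoVariation (fun s => β s i) (β' i)) :
    ThreeVariation (fun s => pairing w (β s)) (pairing w β') := by
  refine ThreeVariation.sum _ fun i => (ThreeVariation.wedge12
    (CovVariation.const (smoothCov_cov w i)) (h i)).congr fun x u v t => ?_
  simp only [wedge12]
  change _ = (0 * _ - 0 * _ + 0 * _) + _
  ring

theorem phaseD_primCA (α : Couplings) (w : Fin 3 → OneForm S) (z Y : PhasePoint S) :
    phaseD (primCA α w) z Y = Y.m.P w - integral (pairing w (linPiA α z.q Y.q.A Y.q.e)) := by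
  have h := (variation_pairing w (variation_PiA α z.q Y.q)).hasDerivAt
  have h2 : HasDerivAt (fun s : ℝ => z.m.P w + s * Y.m.P w) (Y.m.P w) 0 := by
    simpa using ((hasDerivAt_id (0 : ℝ)).mul_const (Y.m.P w)).const_add (z.m.P w)
  exact (h2.sub h).deriv

theorem phaseD_primCe (α : Couplings) (w : Fin 3 → OneForm S) (z Y : PhasePoint S) :
    phaseD (primCe α w) z Y = Y.m.p w - integral (pairing w (linPiE α z.q Y.q.A Y.q.e)) := by
  have h := (variation_pairing w (variation_PiE α z.q Y.q)).hasDerivAt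
  have h2 : HasDerivAt (fun s : ℝ => z.m.p w + s * Y.m.p w) (Y.m.p w) 0 := by
    simpa using ((hasDerivAt_id (0 : ℝ)).mul_const (Y.m.p w)).const_add (z.m.p w)
  exact (h2.sub h).deriv

omit [T2Space S] [CompactSpace S] in
theorem phaseD_primCAperp (w : Fin 3 → ScalarField S) (z Y : PhasePoint S) :
    phaseD (primCAperp w) z Y = Y.m.Pperp w := by
  have h2 : HasDerivAt (fun s : ℝ => z.m.Pperp w + s * Y.m.Pperp w) (Y.m.Pperp w) 0 := by
    simpa using ((hasDerivAt_id (0 : ℝ)).mul_const (Y.m.Pperp w)).const_add (z.m.Pperp w)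
  exact h2.deriv

omit [T2Space S] [CompactSpace S] in
theorem phaseD_primCeperp (w : Fin 3 → ScalarField S) (z Y : PhasePoint S) :
    phaseD (primCeperp w) z Y = Y.m.pperp w := by
  have h2 : HasDerivAt (fun s : ℝ => z.m.pperp w + s * Y.m.pperp w) (Y.m.pperp w) 0 := by
    simpa using ((hasDerivAt_id (0 : ℝ)).mul_const (Y.m.pperp w)).const_add (z.m.pperp w)
  exact h2.deriv

/-- The integrand of Dirac's equation in the direction `(a, b)`. -/
noncomputable def diracForm (α : Couplings) (q : Fields S) (XA Xe a b : Fin 3 → OneForm S) :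
    ThreeForm (𝓡∂ 3) S := fun x u v w =>
  linHam α q a b x u v w - pairing XA (linPiA α q a b) x u v w -
    pairing Xe (linPiE α q a b) x u v w + pairing a (linPiA α q XA Xe) x u v w +
    pairing b (linPiE α q XA Xe) x u v w

omit [T2Space S] [CompactSpace S] in
theorem contForm_pairing_linPiA (α : Couplings) (q : Fields S) (w a b : Fin 3 → OneForm S) :
    ContForm (pairing w (linPiA α q a b)) :=
  (variation_pairing w (variation_PiA α q ⟨0, a, 0, b⟩)).contForm

omit [T2Space S] [CompactSpace S] in
theorem contForm_pairing_linPiE (α : Couplings) (q : Fields S) (w a b : Fin 3 → OneForm S) :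
    ContForm (pairing w (linPiE α q a b)) :=
  (variation_pairing w (variation_PiE α q ⟨0, a, 0, b⟩)).contForm

omit [IsManifold (𝓡∂ 3) ∞ S] [T2Space S] [CompactSpace S] in
theorem ContForm.sub {η ζ : ThreeForm (𝓡∂ 3) S} (hη : ContForm η) (hζ : ContForm ζ) :
    ContForm (fun x u v w => η x u v w - ζ x u v w) := fun c => (hη c).sub (hζ c)

theorem integral_sub_form {η ζ : ThreeForm (𝓡∂ 3) S} (hη : ContForm η) (hζ : ContForm ζ) :
    integral (fun x u v w => η x u v w - ζ x u v w) = integral η - integral ζ := by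
  have h := integral_add_form (hη.sub hζ) hζ
  simp only [sub_add_cancel] at h
  linarith

/-- In a momentum direction everything but the canonical pairing is constant, so the equation
compares the value of an arbitrary functional on the multiplier with its value on the velocity. The
full algebraic dual separates points. -/
theorem SolvesDirac.multipliers {α : Couplings} {z X : PhasePoint S} {lp : Fin 3 → ScalarField S}
    {l : Fin 3 → OneForm S} {mp : Fin 3 → ScalarField S} {m : Fin 3 → OneForm S}
    (h : ∀ Y : PhasePoint S, symplecticForm X Y =
      phaseD (hamiltonian α) z Y + phaseD (primCAperp lp) z Y + phaseD (primCA α l) z Y +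
        phaseD (primCeperp mp) z Y + phaseD (primCe α m) z Y) :
    l = X.q.A ∧ m = X.q.e := by
  have hH : ∀ M : Momenta S, phaseD (hamiltonian α) z ⟨⟨0, 0, 0, 0⟩, M⟩ = 0 := fun M => by
    have : (fun s : ℝ => hamiltonian α (z.move s ⟨⟨0, 0, 0, 0⟩, M⟩)) = fun _ => hamiltonian α z := by
      funext s
      simp only [hamiltonian, PhasePoint.move, Fields.move, smul_zero, add_zero, add_smul_zero]
    rw [phaseD, this, deriv_const]
  -- The linearization in the zero direction is read off from the constancy of `primCA` along it,
  -- without expanding the form.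
  have hA : ∀ w, integral (pairing w (linPiA α z.q (0 : Fin 3 → OneForm S) 0)) = 0 := fun w => by
    have h1 := phaseD_primCA α w z ⟨⟨0, 0, 0, 0⟩, ⟨0, 0, 0, 0⟩⟩
    have h2 : (fun s : ℝ => primCA α w (z.move s ⟨⟨0, 0, 0, 0⟩, ⟨0, 0, 0, 0⟩⟩)) =
        fun _ => primCA α w z := by
      funext s
      simp only [primCA, PhasePoint.move, Fields.move, smul_zero, add_zero, add_smul_zero]
    rw [phaseD, h2, deriv_const] at h1
    simp only [LinearMap.zero_apply, zero_sub] at h1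
    linarith
  have hE : ∀ w, integral (pairing w (linPiE α z.q (0 : Fin 3 → OneForm S) 0)) = 0 := fun w => by
    have h1 := phaseD_primCe α w z ⟨⟨0, 0, 0, 0⟩, ⟨0, 0, 0, 0⟩⟩
    have h2 : (fun s : ℝ => primCe α w (z.move s ⟨⟨0, 0, 0, 0⟩, ⟨0, 0, 0, 0⟩⟩)) =
        fun _ => primCe α w z := by
      funext s
      simp only [primCe, PhasePoint.move, Fields.move, smul_zero, add_zero, add_smul_zero]
    rw [phaseD, h2, deriv_const] at h1
    simp only [LinearMap.zero_apply, zero_sub] at h1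
    linarith
  constructor
  · refine (Module.eval_apply_injective ℝ (V := Fin 3 → OneForm S)) ?_
    ext f
    have h1 := h ⟨⟨0, 0, 0, 0⟩, ⟨0, f, 0, 0⟩⟩
    rw [hH, phaseD_primCA, phaseD_primCe, phaseD_primCAperp, phaseD_primCeperp, hA, hE] at h1
    simp only [symplecticForm, map_zero, LinearMap.zero_apply] at h1
    simp only [Module.Dual.eval_apply]
    linarith
  · refine (Module.eval_apply_injective ℝ (V := Fin 3 → OneForm S)) ?_
    ext f
    have h1 := h ⟨⟨0, 0, 0, 0⟩, ⟨0, 0, 0, f⟩⟩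
    rw [hH, phaseD_primCA, phaseD_primCe, phaseD_primCAperp, phaseD_primCeperp, hA, hE] at h1
    simp only [symplecticForm, map_zero, LinearMap.zero_apply] at h1
    simp only [Module.Dual.eval_apply]
    linarith

/-- Dirac's equation in the configuration directions, with the multipliers eliminated. -/
theorem IsHamiltonianVector.integral_diracForm {α : Couplings} {z X : PhasePoint S}
    (h : IsHamiltonianVector α z X) (a b : Fin 3 → OneForm S) :
    integral (diracForm α z.q X.q.A X.q.e a b) = 0 := by
  obtain ⟨⟨lp, l, mp, m, hD⟩, -, hTA, -, hTe⟩ := h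
  obtain ⟨rfl, rfl⟩ := SolvesDirac.multipliers hD
  have h1 := hD (configDirection a b)
  -- Tangency expresses the momentum components of `X`, which occur in the symplectic form, as
  -- integrals of linearized momenta.
  have h2 := hTA a
  have h3 := hTe b
  rw [phaseD_hamiltonian, phaseD_primCA, phaseD_primCe, phaseD_primCAperp,
    phaseD_primCeperp] at h1
  rw [phaseD_primCA] at h2
  rw [phaseD_primCe] at h3
  simp only [symplecticForm, configDirection, map_zero, LinearMap.zero_apply] at h1
  have c1 := (variation_hamiltonian α z.q a b).contForm
  have c2 := contForm_pairing_linPiA α z.q X.q.A a b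
  have c3 := contForm_pairing_linPiE α z.q X.q.e a b
  have c4 := contForm_pairing_linPiA α z.q a X.q.A X.q.e
  have c5 := contForm_pairing_linPiE α z.q b X.q.A X.q.e
  unfold diracForm
  rw [integral_add_form (((c1.sub c2).sub c3).add c4) c5, integral_add_form ((c1.sub c2).sub c3) c4,
    integral_sub_form (c1.sub c2) c3, integral_sub_form c1 c2]
  linarith

end Phase
end FieldVariation

/-! ### Exterior derivatives of the multiplier and flux forms. -/

section PointwiseIdentity

variable {S : Type*} [TopologicalSpace S] [ChartedSpace (EuclideanHalfSpace 3) S]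

theorem covector_sum_apply (c : Fin 3 → Fin 3 → ℝ) {x : S}
    (a : Fin 3 → Fin 3 → TangentSpace (𝓡∂ 3) x →L[ℝ] ℝ) (u : E3) :
    (∑ j, ∑ k, c j k • a j k : TangentSpace (𝓡∂ 3) x →L[ℝ] ℝ) u = ∑ j, ∑ k, c j k * a j k u := by
  change (∑ j, ∑ k, c j k • a j k : E3 →L[ℝ] ℝ) u = _
  simp only [sum_apply]
  rfl

theorem covD0_apply (A : Fin 3 → CovectorField (𝓡∂ 3) S) (τ : Fin 3 → S → ℝ) (i : Fin 3) (x : S)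
    (u : E3) : covD0 A τ i x u =
      extD0 (𝓡∂ 3) (τ i) x u + ∑ j, ∑ k, eps i j k * τ k x * A j x u :=
  congrArg (extD0 (𝓡∂ 3) (τ i) x u + ·) (covector_sum_apply _ (fun j _ => A j x) u)

theorem epsContract_apply (r : Fin 3 → S → ℝ) (e : Fin 3 → CovectorField (𝓡∂ 3) S) (i : Fin 3)
    (x : S) (u : E3) : epsContract r e i x u = ∑ j, ∑ k, eps i j k * r j x * e k x u :=
  covector_sum_apply _ (fun _ k => e k x) u

variable [IsManifold (𝓡∂ 3) ∞ S]

theorem extD1_eps_sum (c : Fin 3 → Fin 3 → ℝ) {f : Fin 3 → Fin 3 → S → ℝ}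
    {a : Fin 3 → Fin 3 → CovectorField (𝓡∂ 3) S} (hf : ∀ j k, SmoothFn (f j k))
    (ha : ∀ j k, SmoothCov (a j k)) (x : S) (u v : E3) :
    extD1 (fun x => ∑ j, ∑ k, (c j k * f j k x) • a j k x) x u v =
      ∑ j, ∑ k, c j k * (extD0 (𝓡∂ 3) (f j k) x u * a j k x v -
        extD0 (𝓡∂ 3) (f j k) x v * a j k x u + f j k x * extD1 (a j k) x u v) := by
  have hs : ∀ j k, SmoothCov fun x => (c j k * f j k x) • a j k x := fun j k =>
    SmoothCov.smul ((SmoothFn.const _).mul (hf j k)) (ha j k)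
  rw [extD1_sum Finset.univ (a := fun j x => ∑ k, (c j k * f j k x) • a j k x)
    fun j => SmoothCov.sum _ (hs j)]
  refine Finset.sum_congr rfl fun j _ => ?_
  rw [extD1_sum Finset.univ (a := fun k x => (c j k * f j k x) • a j k x) (hs j)]
  refine Finset.sum_congr rfl fun k _ => ?_
  rw [extD1_smul ((SmoothFn.const _).mul (hf j k)) (ha j k), extD0_const_mul _ (hf j k),
    extD0_const_mul _ (hf j k)]
  ring

theorem extD1_covD0 {A : Fin 3 → CovectorField (𝓡∂ 3) S} {τ : Fin 3 → S → ℝ}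
    (hA : ∀ i, SmoothCov (A i)) (hτ : ∀ i, SmoothFn (τ i)) (i : Fin 3) (x : S) (u v : E3) :
    extD1 (covD0 A τ i) x u v = ∑ j, ∑ k, eps i j k * (extD0 (𝓡∂ 3) (τ k) x u * A j x v -
        extD0 (𝓡∂ 3) (τ k) x v * A j x u + τ k x * extD1 (A j) x u v) := by
  refine (extD1_add (hτ i).extD0 (SmoothCov.sum _ fun j => SmoothCov.sum _ fun k =>
    SmoothCov.smul ((SmoothFn.const _).mul (hτ k)) (hA j)) x u v).trans ?_
  rw [extD1_extD0 (hτ i), zero_add]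
  exact extD1_eps_sum (eps i) (f := fun _ k => τ k) (a := fun j _ => A j) (fun _ k => hτ k)
    (fun j _ => hA j) x u v

theorem extD1_epsContract {r : Fin 3 → S → ℝ} {e : Fin 3 → CovectorField (𝓡∂ 3) S}
    (hr : ∀ i, SmoothFn (r i)) (he : ∀ i, SmoothCov (e i)) (i : Fin 3) (x : S) (u v : E3) :
    extD1 (epsContract r e i) x u v = ∑ j, ∑ k, eps i j k * (extD0 (𝓡∂ 3) (r j) x u * e k x v -
        extD0 (𝓡∂ 3) (r j) x v * e k x u + r j x * extD1 (e k) x u v) :=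
  extD1_eps_sum (eps i) (f := fun j _ => r j) (a := fun _ k => e k) (fun j _ => hr j)
    (fun _ k => he k) x u v

/-- The defect in the equation that determines the multiplier form paired with the two-form
`β`. -/
noncomputable def bulkDefect (q : Fields S) (V : Fin 3 → OneForm S) (β : Fin 3 → TwoForm (𝓡∂ 3) S)
    (i : Fin 3) : TwoForm (𝓡∂ 3) S := fun x u v =>
  (∑ j, ∑ k, eps i j k * wedge11 (cov q.e j) (cov V k) x u v) -
    ∑ j, ∑ k, eps i j k * fn q.eperp j x * β k x u v

/-- The one-forms whose pullbacks to the boundary are set to zero by the boundary terms. -/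
noncomputable def fluxForm (q : Fields S) (V V' : Fin 3 → OneForm S) (k k' k'' : ℝ) (i : Fin 3) :
    CovectorField (𝓡∂ 3) S := fun x =>
  (k • cov V i x + k' • cov V' i x) + k'' • epsContract (fn q.eperp) (cov q.e) i x

theorem smoothCov_fluxForm (q : Fields S) (V V' : Fin 3 → OneForm S) (k k' k'' : ℝ) (i : Fin 3) :
    SmoothCov (fluxForm q V V' k k' k'' i) :=
  ((SmoothCov.smul (SmoothFn.const k) (smoothCov_cov V i)).add
    (SmoothCov.smul (SmoothFn.const k') (smoothCov_cov V' i))).add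
    (SmoothCov.smul (SmoothFn.const k'') (SmoothCov.epsContract (fun i => smoothFn_scalar (q.eperp i))
      (smoothCov_cov q.e) i))

theorem fluxForm_apply (q : Fields S) (V V' : Fin 3 → OneForm S) (k k' k'' : ℝ) (i : Fin 3)
    (x : S) (u : E3) : fluxForm q V V' k k' k'' i x u = k * cov V i x u + k' * cov V' i x u +
      k'' * ∑ j, ∑ l, eps i j l * fn q.eperp j x * cov q.e l x u := by
  rw [← epsContract_apply]; rfl

theorem extD1_fluxForm (q : Fields S) (V V' : Fin 3 → OneForm S) (k k' k'' : ℝ) (i : Fin 3)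
    (x : S) (u v : E3) : extD1 (fluxForm q V V' k k' k'' i) x u v =
      k * extD1 (cov V i) x u v + k' * extD1 (cov V' i) x u v +
      k'' * ∑ j, ∑ l, eps i j l * (extD0 (𝓡∂ 3) (fn q.eperp j) x u * cov q.e l x v -
        extD0 (𝓡∂ 3) (fn q.eperp j) x v * cov q.e l x u +
        fn q.eperp j x * extD1 (cov q.e l) x u v) := by
  have h1 := SmoothCov.smul (SmoothFn.const k) (smoothCov_cov V i)
  have h2 := SmoothCov.smul (SmoothFn.const k') (smoothCov_cov V' i)
  have h3 := SmoothCov.epsContract (r := fn q.eperp) (fun i => smoothFn_scalar (q.eperp i))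
      (smoothCov_cov q.e) i
  refine (extD1_add (h1.add h2) (SmoothCov.smul (SmoothFn.const k'') h3) x u v).trans ?_
  rw [extD1_add h1 h2, extD1_const_smul k (smoothCov_cov V i),
    extD1_const_smul k' (smoothCov_cov V' i), extD1_const_smul k'' h3,
    extD1_epsContract (r := fn q.eperp) (fun i => smoothFn_scalar (q.eperp i))
      (smoothCov_cov q.e)]

variable {q : Fields S} {XA Xe VA Ve : Fin 3 → OneForm S}

theorem extD1_XA (hXA : ∀ i x, cov XA i x = covD0 (cov q.A) (fn q.Aperp) i x + cov VA i x)
    (i : Fin 3) (x : S) (u v : E3) : extD1 (cov XA i) x u v =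
      (∑ j, ∑ k, eps i j k * (extD0 (𝓡∂ 3) (fn q.Aperp k) x u * cov q.A j x v -
        extD0 (𝓡∂ 3) (fn q.Aperp k) x v * cov q.A j x u + fn q.Aperp k x * extD1 (cov q.A j) x u v))
        + extD1 (cov VA i) x u v := by
  have h : cov XA i = fun x => covD0 (cov q.A) (fn q.Aperp) i x + cov VA i x := funext (hXA i)
  have hτ : ∀ i, SmoothFn (fn q.Aperp i) := fun i => smoothFn_scalar (q.Aperp i)
  rw [h, extD1_add (SmoothCov.covD0 (smoothCov_cov q.A) hτ i) (smoothCov_cov VA i),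
    extD1_covD0 (smoothCov_cov q.A) hτ]

theorem extD1_Xe (hXe : ∀ i x, cov Xe i x = covD0 (cov q.A) (fn q.eperp) i x -
      epsContract (fn q.Aperp) (cov q.e) i x + cov Ve i x)
    (i : Fin 3) (x : S) (u v : E3) : extD1 (cov Xe i) x u v =
      (∑ j, ∑ k, eps i j k * (extD0 (𝓡∂ 3) (fn q.eperp k) x u * cov q.A j x v -
        extD0 (𝓡∂ 3) (fn q.eperp k) x v * cov q.A j x u + fn q.eperp k x * extD1 (cov q.A j) x u v))
        - (∑ j, ∑ k, eps i j k * (extD0 (𝓡∂ 3) (fn q.Aperp j) x u * cov q.e k x v -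
        extD0 (𝓡∂ 3) (fn q.Aperp j) x v * cov q.e k x u + fn q.Aperp j x * extD1 (cov q.e k) x u v))
        + extD1 (cov Ve i) x u v := by
  have h : cov Xe i = fun x => covD0 (cov q.A) (fn q.eperp) i x -
      epsContract (fn q.Aperp) (cov q.e) i x + cov Ve i x := funext (hXe i)
  have hτ : ∀ i, SmoothFn (fn q.Aperp i) := fun i => smoothFn_scalar (q.Aperp i)
  have hr : ∀ i, SmoothFn (fn q.eperp i) := fun i => smoothFn_scalar (q.eperp i)
  have h1 := SmoothCov.covD0 (smoothCov_cov q.A) hr i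
  have h2 := SmoothCov.epsContract hτ (smoothCov_cov q.e) i
  rw [h, extD1_add (h1.sub h2) (smoothCov_cov Ve i), extD1_sub h1 h2,
    extD1_covD0 (smoothCov_cov q.A) hr, extD1_epsContract hτ (smoothCov_cov q.e)]

theorem XA_apply (hXA : ∀ i x, cov XA i x = covD0 (cov q.A) (fn q.Aperp) i x + cov VA i x)
    (i : Fin 3) (x : S) (u : E3) : cov XA i x u = extD0 (𝓡∂ 3) (fn q.Aperp i) x u +
      (∑ j, ∑ k, eps i j k * fn q.Aperp k x * cov q.A j x u) + cov VA i x u := by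
  rw [← covD0_apply, hXA]; rfl

theorem Xe_apply (hXe : ∀ i x, cov Xe i x = covD0 (cov q.A) (fn q.eperp) i x -
      epsContract (fn q.Aperp) (cov q.e) i x + cov Ve i x)
    (i : Fin 3) (x : S) (u : E3) : cov Xe i x u = extD0 (𝓡∂ 3) (fn q.eperp i) x u +
      (∑ j, ∑ k, eps i j k * fn q.eperp k x * cov q.A j x u) -
      (∑ j, ∑ k, eps i j k * fn q.Aperp j x * cov q.e k x u) + cov Ve i x u := by
  rw [← covD0_apply, ← epsContract_apply, hXe]; rfl

theorem cov_zero_apply (i : Fin 3) (x : S) (u : E3) : cov (0 : Fin 3 → OneForm S) i x u = 0 := rfl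

theorem extD1_cov_zero (i : Fin 3) (x : S) (u v : E3) :
    extD1 (cov (0 : Fin 3 → OneForm S) i) x u v = 0 := extD1_zero x u v

omit [IsManifold (𝓡∂ 3) ∞ S] in
theorem covector_sub_apply {x : S} (a b : TangentSpace (𝓡∂ 3) x →L[ℝ] ℝ) (u : E3) :
    (a - b) u = a u - b u := rfl

end PointwiseIdentity

/-! ### Gauge covariance and the splitting of the Dirac form. -/

section PointwiseIdentity

variable {S : Type*} [TopologicalSpace S] [ChartedSpace (EuclideanHalfSpace 3) S]
  [IsManifold (𝓡∂ 3) ∞ S]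
variable {q : Fields S} {XA Xe VA Ve : Fin 3 → OneForm S}

/-- The Ricci identity D D A_⊥ = ε F A_⊥. The second derivatives have already disappeared in
`extD1_XA`; the rest is algebra of the symbol. -/
theorem covD1_XA (hXA : ∀ i x, cov XA i x = covD0 (cov q.A) (fn q.Aperp) i x + cov VA i x)
    (i : Fin 3) (x : S) (u v : E3) : covD1 (cov q.A) (cov XA) i x u v =
      (∑ j, ∑ k, eps i j k * curv (cov q.A) j x u v * fn q.Aperp k x) +
        covD1 (cov q.A) (cov VA) i x u v := by
  simp only [covD1, curv, wedge11, XA_apply hXA, extD1_XA hXA]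
  generalize extD1 (cov VA i) x u v = dV
  fin_cases i <;> simp only [Fin.zero_eta, Fin.mk_one, Fin.reduceFinMk, Fin.sum_univ_three,
    eps_values, eps_self_left, eps_self_right, eps_self_outer] <;> ring

/-- The part of the variation generated by A_⊥ is an infinitesimal rotation, under which the torsion
rotates; D D e_⊥ contributes the curvature acting on e_⊥ by the Ricci identity. -/
theorem linTorsion_X (hXA : ∀ i x, cov XA i x = covD0 (cov q.A) (fn q.Aperp) i x + cov VA i x)
    (hXe : ∀ i x, cov Xe i x = covD0 (cov q.A) (fn q.eperp) i x -
      epsContract (fn q.Aperp) (cov q.e) i x + cov Ve i x)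
    (i : Fin 3) (x : S) (u v : E3) : linTorsion q XA Xe i x u v =
      (∑ j, ∑ k, eps i j k * covD1 (cov q.A) (cov q.e) j x u v * fn q.Aperp k x) +
      (∑ j, ∑ k, eps i j k * curv (cov q.A) j x u v * fn q.eperp k x) +
        linTorsion q VA Ve i x u v := by
  simp only [linTorsion, covD1, curv, wedge11, XA_apply hXA, Xe_apply hXe, extD1_Xe hXe]
  generalize extD1 (cov Ve i) x u v = dV
  fin_cases i <;> simp only [Fin.zero_eta, Fin.mk_one, Fin.reduceFinMk, Fin.sum_univ_three,
    eps_values, eps_self_left, eps_self_right, eps_self_outer] <;> ring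

theorem eps_wedge_Xe (hXe : ∀ i x, cov Xe i x = covD0 (cov q.A) (fn q.eperp) i x -
      epsContract (fn q.Aperp) (cov q.e) i x + cov Ve i x)
    (i : Fin 3) (x : S) (u v : E3) :
    2 * (∑ j, ∑ k, eps i j k * wedge11 (cov q.e j) (cov Xe k) x u v) =
      (∑ j, ∑ k, eps i j k * epsWedge (cov q.e) j x u v * fn q.Aperp k x) +
      2 * (∑ j, ∑ k, eps i j k * wedge11 (cov q.e j) (covD0 (cov q.A) (fn q.eperp) k) x u v) +
      2 * ∑ j, ∑ k, eps i j k * wedge11 (cov q.e j) (cov Ve k) x u v := by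
  simp only [wedge11, epsWedge, Xe_apply hXe, covD0_apply]
  fin_cases i <;> simp only [Fin.zero_eta, Fin.mk_one, Fin.reduceFinMk, Fin.sum_univ_three,
    eps_values, eps_self_left, eps_self_right, eps_self_outer] <;> ring

/-- Gauge covariance of the momentum: A_⊥ merely rotates it, and only the terms generated by e_⊥ and
by the multiplier forms survive. -/
theorem linPiA_X (α : Couplings)
    (hXA : ∀ i x, cov XA i x = covD0 (cov q.A) (fn q.Aperp) i x + cov VA i x)
    (hXe : ∀ i x, cov Xe i x = covD0 (cov q.A) (fn q.eperp) i x -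
      epsContract (fn q.Aperp) (cov q.e) i x + cov Ve i x)
    (i : Fin 3) (x : S) (u v : E3) : linPiA α q XA Xe i x u v =
      (∑ j, ∑ k, eps i j k * PiA α q j x u v * fn q.Aperp k x) +
      2 * α.α₁ * (∑ j, ∑ k, eps i j k *
        wedge11 (cov q.e j) (covD0 (cov q.A) (fn q.eperp) k) x u v) +
      α.α₅ * (∑ j, ∑ k, eps i j k * curv (cov q.A) j x u v * fn q.eperp k x) +
        linPiA α q VA Ve i x u v := by
  simp only [linPiA, PiA, linTorsion_X hXA hXe, eps_wedge_Xe hXe, covD1_XA hXA]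
  fin_cases i <;> simp only [Fin.zero_eta, Fin.mk_one, Fin.reduceFinMk, Fin.sum_univ_three,
    eps_values, eps_self_left, eps_self_right, eps_self_outer] <;> ring

theorem linPiE_X (α : Couplings)
    (hXA : ∀ i x, cov XA i x = covD0 (cov q.A) (fn q.Aperp) i x + cov VA i x)
    (hXe : ∀ i x, cov Xe i x = covD0 (cov q.A) (fn q.eperp) i x -
      epsContract (fn q.Aperp) (cov q.e) i x + cov Ve i x)
    (i : Fin 3) (x : S) (u v : E3) : linPiE α q XA Xe i x u v =
      (∑ j, ∑ k, eps i j k * PiE α q j x u v * fn q.Aperp k x) +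
      2 * α.α₄ * (∑ j, ∑ k, eps i j k *
        wedge11 (cov q.e j) (covD0 (cov q.A) (fn q.eperp) k) x u v) +
      2 * α.α₂ * (∑ j, ∑ k, eps i j k * curv (cov q.A) j x u v * fn q.eperp k x) +
        linPiE α q VA Ve i x u v := by
  simp only [linPiE, PiE, linTorsion_X hXA hXe, eps_wedge_Xe hXe, covD1_XA hXA]
  fin_cases i <;> simp only [Fin.zero_eta, Fin.mk_one, Fin.reduceFinMk, Fin.sum_univ_three,
    eps_values, eps_self_left, eps_self_right, eps_self_outer] <;> ring

theorem rotated_apply (r : Fin 3 → S → ℝ) (a : Fin 3 → OneForm S) (i : Fin 3) (x : S) (u : E3) :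
    (∑ j, ∑ k, (eps i j k * r k x) • cov a j x : TangentSpace (𝓡∂ 3) x →L[ℝ] ℝ) u =
      ∑ j, ∑ k, eps i j k * r k x * cov a j x u :=
  covector_sum_apply _ (fun j _ => cov a j x) u

set_option maxHeartbeats 2000000 in
/-- What remains of the Dirac form in the direction of the connection once gauge covariance has
removed the multipliers of the Gauss constraint. -/
theorem diracForm_connection_reduced (α : Couplings)
    (hXA : ∀ i x, cov XA i x = covD0 (cov q.A) (fn q.Aperp) i x + cov VA i x)
    (hXe : ∀ i x, cov Xe i x = covD0 (cov q.A) (fn q.eperp) i x -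
      epsContract (fn q.Aperp) (cov q.e) i x + cov Ve i x) (a : Fin 3 → OneForm S)
    (x : S) (u v w : E3) :
    diracForm α q XA Xe a 0 x u v w =
      (∑ i, ∑ j, ∑ k, eps i j k * fn q.eperp k x * wedge12 (cov a j) (PiE α q i) x u v w) -
      (∑ i, wedge12 (cov VA i) (linPiA α q a 0 i) x u v w) -
      (∑ i, wedge12 (cov Ve i) (linPiE α q a 0 i) x u v w) +
      (∑ i, wedge12 (cov a i) (fun x u v => 2 * α.α₁ * (∑ j, ∑ k, eps i j k *
          wedge11 (cov q.e j) (covD0 (cov q.A) (fn q.eperp) k) x u v) +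
        α.α₅ * (∑ j, ∑ k, eps i j k * curv (cov q.A) j x u v * fn q.eperp k x) +
        linPiA α q VA Ve i x u v) x u v w) -
      2 * ∑ i, ∑ j, ∑ k, eps i j k * fn q.eperp i x *
          wedge12 (cov q.e j) (fun x u v => α.α₁ * covD1 (cov q.A) (cov a) k x u v +
            α.α₄ * linTorsion q a 0 k x u v) x u v w := by
  have hX : ∀ i (u : E3), cov XA i x u = covD0 (cov q.A) (fn q.Aperp) i x u + cov VA i x u :=
    fun i u => by rw [hXA]; rfl
  have hX' : ∀ i (u : E3), cov Xe i x u = covD0 (cov q.A) (fn q.eperp) i x u -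
      epsContract (fn q.Aperp) (cov q.e) i x u + cov Ve i x u := fun i u => by rw [hXe]; rfl
  have hr : ∀ i x, q.eperp i x = fn q.eperp i x := fun _ _ => rfl
  simp only [diracForm, linHam, pairing, wedge12, linPiA_X α hXA hXe, linPiE_X α hXA hXe, hX, hX',
    covector_sub_apply, rotated_apply, cov_zero_apply, hr, epsContract_apply]
  simp only [Fin.sum_univ_three, eps_values, eps_self_left, eps_self_right, eps_self_outer]
  ring

set_option maxHeartbeats 2000000 in
-- The forms D A_⊥, D e_⊥ and ε A_⊥ e wedged with linearized momenta cancel between the Hamiltonian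
-- and the multiplier terms, and the rotation of the momentum by A_⊥ cancels the explicit variation
-- of ε A_⊥ e, as for the connection.
theorem diracForm_triad_reduced (α : Couplings)
    (hXA : ∀ i x, cov XA i x = covD0 (cov q.A) (fn q.Aperp) i x + cov VA i x)
    (hXe : ∀ i x, cov Xe i x = covD0 (cov q.A) (fn q.eperp) i x -
      epsContract (fn q.Aperp) (cov q.e) i x + cov Ve i x) (b : Fin 3 → OneForm S)
    (x : S) (u v w : E3) :
    diracForm α q XA Xe 0 b x u v w =
      -(∑ i, wedge12 (cov VA i) (linPiA α q 0 b i) x u v w) -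
      (∑ i, wedge12 (cov Ve i) (linPiE α q 0 b i) x u v w) +
      (∑ i, wedge12 (cov b i) (fun x u v => 2 * α.α₄ * (∑ j, ∑ k, eps i j k *
          wedge11 (cov q.e j) (covD0 (cov q.A) (fn q.eperp) k) x u v) +
        2 * α.α₂ * (∑ j, ∑ k, eps i j k * curv (cov q.A) j x u v * fn q.eperp k x) +
        linPiE α q VA Ve i x u v) x u v w) -
      2 * ∑ i, ∑ j, ∑ k, eps i j k * fn q.eperp i x *
          (wedge12 (cov b j) (fun x u v => α.α₁ * curv (cov q.A) k x u v +
            α.α₄ * covD1 (cov q.A) (cov q.e) k x u v) x u v w +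
          α.α₄ * wedge12 (cov q.e j) (linTorsion q 0 b k) x u v w) := by
  have hX : ∀ i (u : E3), cov XA i x u = covD0 (cov q.A) (fn q.Aperp) i x u + cov VA i x u :=
    fun i u => by rw [hXA]; rfl
  have hX' : ∀ i (u : E3), cov Xe i x u = covD0 (cov q.A) (fn q.eperp) i x u -
      epsContract (fn q.Aperp) (cov q.e) i x u + cov Ve i x u := fun i u => by rw [hXe]; rfl
  have hr : ∀ i x, q.eperp i x = fn q.eperp i x := fun _ _ => rfl
  have h0 : ∀ i (u v : E3), covD1 (cov q.A) (cov (0 : Fin 3 → OneForm S)) i x u v = 0 := fun i u v => by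
    simp only [covD1, wedge11, extD1_cov_zero, cov_zero_apply, mul_zero, sub_zero,
      Finset.sum_const_zero, add_zero]
  simp only [diracForm, linHam, pairing, wedge12, linPiA_X α hXA hXe, linPiE_X α hXA hXe, hX, hX',
    covector_sub_apply, rotated_apply, cov_zero_apply, hr, epsContract_apply, h0]
  simp only [Fin.sum_univ_three, eps_values, eps_self_left, eps_self_right, eps_self_outer]
  ring

set_option maxHeartbeats 20000000 in
set_option maxRecDepth 20000 in
-- An integration by parts carried out pointwise: the last sum is d(W∧a). In the bulk coefficient,
-- α₁ comes from the ε e∧e term of the momentum of A and α₂ from the torsion term of the momentum of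
-- e; the other couplings enter only the exact term or cancel.
theorem connection_flux (α : Couplings) (a : Fin 3 → OneForm S)
    (x : S) (u v w : E3) :
      (∑ i, ∑ j, ∑ k, eps i j k * fn q.eperp k x * wedge12 (cov a j) (PiE α q i) x u v w) -
      (∑ i, wedge12 (cov VA i) (linPiA α q a 0 i) x u v w) -
      (∑ i, wedge12 (cov Ve i) (linPiE α q a 0 i) x u v w) +
      (∑ i, wedge12 (cov a i) (fun x u v => 2 * α.α₁ * (∑ j, ∑ k, eps i j k *
          wedge11 (cov q.e j) (covD0 (cov q.A) (fn q.eperp) k) x u v) +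
        α.α₅ * (∑ j, ∑ k, eps i j k * curv (cov q.A) j x u v * fn q.eperp k x) +
        linPiA α q VA Ve i x u v) x u v w) -
      2 * (∑ i, ∑ j, ∑ k, eps i j k * fn q.eperp i x *
          wedge12 (cov q.e j) (fun x u v => α.α₁ * covD1 (cov q.A) (cov a) k x u v +
            α.α₄ * linTorsion q a 0 k x u v) x u v w) = 2 * (α.α₁ - α.α₂) *
        (∑ i, wedge12 (cov a i) (bulkDefect q Ve (covD1 (cov q.A) (cov q.e)) i) x u v w) +
      ∑ i, (wedge12 (cov a i) (extD1 (fluxForm q VA Ve (2 * α.α₃) α.α₅ (2 * α.α₁) i)) x u v w -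
        wedge12 (fluxForm q VA Ve (2 * α.α₃) α.α₅ (2 * α.α₁) i) (extD1 (cov a i)) x u v w) := by
  -- Trading d e for the torsion lets torsion and curvature be generalized to independent symbols,
  -- so that a polynomial identity remains.
  have hd : ∀ i (u v : E3), extD1 (cov q.e i) x u v = covD1 (cov q.A) (cov q.e) i x u v -
      ∑ j, ∑ k, eps i j k * wedge11 (cov q.A j) (cov q.e k) x u v := fun i u v => by
    simp only [covD1]; ring
  have h0 : ∀ i (u v : E3), covD1 (cov q.A) (cov (0 : Fin 3 → OneForm S)) i x u v = 0 := fun i u v => by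
    simp only [covD1, wedge11, extD1_cov_zero, cov_zero_apply, mul_zero, sub_zero,
      Finset.sum_const_zero, add_zero]
  have hA : ∀ (a : Fin 3 → OneForm S) i (u v : E3), covD1 (cov q.A) (cov a) i x u v =
      extD1 (cov a i) x u v + ∑ j, ∑ k, eps i j k * wedge11 (cov q.A j) (cov a k) x u v :=
    fun _ _ _ _ => rfl
  simp only [wedge12, PiE, linPiA, linPiE, linTorsion, bulkDefect, fluxForm_apply, extD1_fluxForm,
    hd, h0]
  generalize covD1 (cov q.A) (cov q.e) = T
  generalize curv (cov q.A) = F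
  simp only [hA]
  simp only [wedge11, epsWedge, cov_zero_apply, covD0_apply]
  simp only [Fin.sum_univ_three, eps_values, eps_self_left, eps_self_right, eps_self_outer]
  ring

set_option maxHeartbeats 20000000 in
set_option maxRecDepth 20000 in
-- The counterpart of `connection_flux` with V_A and V_e, and curvature and torsion, interchanged;
-- the bulk coefficient changes sign.
theorem triad_flux (α : Couplings) (b : Fin 3 → OneForm S)
    (x : S) (u v w : E3) :
      -(∑ i, wedge12 (cov VA i) (linPiA α q 0 b i) x u v w) -
      (∑ i, wedge12 (cov Ve i) (linPiE α q 0 b i) x u v w) +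
      (∑ i, wedge12 (cov b i) (fun x u v => 2 * α.α₄ * (∑ j, ∑ k, eps i j k *
          wedge11 (cov q.e j) (covD0 (cov q.A) (fn q.eperp) k) x u v) +
        2 * α.α₂ * (∑ j, ∑ k, eps i j k * curv (cov q.A) j x u v * fn q.eperp k x) +
        linPiE α q VA Ve i x u v) x u v w) -
      2 * (∑ i, ∑ j, ∑ k, eps i j k * fn q.eperp i x *
          (wedge12 (cov b j) (fun x u v => α.α₁ * curv (cov q.A) k x u v +
            α.α₄ * covD1 (cov q.A) (cov q.e) k x u v) x u v w +
          α.α₄ * wedge12 (cov q.e j) (linTorsion q 0 b k) x u v w)) =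
      -(2 * (α.α₁ - α.α₂)) *
        (∑ i, wedge12 (cov b i) (bulkDefect q VA (curv (cov q.A)) i) x u v w) +
      ∑ i, (wedge12 (cov b i) (extD1 (fluxForm q Ve VA (2 * α.α₂) α.α₅ (2 * α.α₄) i)) x u v w -
        wedge12 (fluxForm q Ve VA (2 * α.α₂) α.α₅ (2 * α.α₄) i) (extD1 (cov b i)) x u v w) := by
  have hd : ∀ i (u v : E3), extD1 (cov q.e i) x u v = covD1 (cov q.A) (cov q.e) i x u v -
      ∑ j, ∑ k, eps i j k * wedge11 (cov q.A j) (cov q.e k) x u v := fun i u v => by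
    simp only [covD1]; ring
  have h0 : ∀ i (u v : E3), covD1 (cov q.A) (cov (0 : Fin 3 → OneForm S)) i x u v = 0 := fun i u v => by
    simp only [covD1, wedge11, extD1_cov_zero, cov_zero_apply, mul_zero, sub_zero,
      Finset.sum_const_zero, add_zero]
  have hA : ∀ (a : Fin 3 → OneForm S) i (u v : E3), covD1 (cov q.A) (cov a) i x u v =
      extD1 (cov a i) x u v + ∑ j, ∑ k, eps i j k * wedge11 (cov q.A j) (cov a k) x u v :=
    fun _ _ _ _ => rfl
  simp only [wedge12, linPiA, linPiE, linTorsion, bulkDefect, fluxForm_apply, extD1_fluxForm,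
    hd, h0]
  generalize covD1 (cov q.A) (cov q.e) = T
  generalize curv (cov q.A) = F
  simp only [hA]
  simp only [wedge11, cov_zero_apply, covD0_apply]
  simp only [Fin.sum_univ_three, eps_values, eps_self_left, eps_self_right, eps_self_outer]
  ring

/-- The Dirac form in the direction of the connection: a bulk term and an exact term. -/
theorem diracForm_connection (α : Couplings)
    (hXA : ∀ i x, cov XA i x = covD0 (cov q.A) (fn q.Aperp) i x + cov VA i x)
    (hXe : ∀ i x, cov Xe i x = covD0 (cov q.A) (fn q.eperp) i x -
      epsContract (fn q.Aperp) (cov q.e) i x + cov Ve i x) (a : Fin 3 → OneForm S)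
    (x : S) (u v w : E3) :
    diracForm α q XA Xe a 0 x u v w = 2 * (α.α₁ - α.α₂) *
        (∑ i, wedge12 (cov a i) (bulkDefect q Ve (covD1 (cov q.A) (cov q.e)) i) x u v w) +
      ∑ i, (wedge12 (cov a i) (extD1 (fluxForm q VA Ve (2 * α.α₃) α.α₅ (2 * α.α₁) i)) x u v w -
        wedge12 (fluxForm q VA Ve (2 * α.α₃) α.α₅ (2 * α.α₁) i) (extD1 (cov a i)) x u v w) :=
  (diracForm_connection_reduced α hXA hXe a x u v w).trans (connection_flux α a x u v w)

/-- The Dirac form in the direction of the triad: a bulk term and an exact term. -/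
theorem diracForm_triad (α : Couplings)
    (hXA : ∀ i x, cov XA i x = covD0 (cov q.A) (fn q.Aperp) i x + cov VA i x)
    (hXe : ∀ i x, cov Xe i x = covD0 (cov q.A) (fn q.eperp) i x -
      epsContract (fn q.Aperp) (cov q.e) i x + cov Ve i x) (b : Fin 3 → OneForm S)
    (x : S) (u v w : E3) :
    diracForm α q XA Xe 0 b x u v w = -(2 * (α.α₁ - α.α₂)) *
        (∑ i, wedge12 (cov b i) (bulkDefect q VA (curv (cov q.A)) i) x u v w) +
      ∑ i, (wedge12 (cov b i) (extD1 (fluxForm q Ve VA (2 * α.α₂) α.α₅ (2 * α.α₄) i)) x u v w -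
        wedge12 (fluxForm q Ve VA (2 * α.α₂) α.α₅ (2 * α.α₄) i) (extD1 (cov b i)) x u v w) :=
  (diracForm_triad_reduced α hXA hXe b x u v w).trans (triad_flux α b x u v w)

end PointwiseIdentity

/-! ### Test forms supported in a chart. -/

section Localization

variable {S : Type*} [TopologicalSpace S] [ChartedSpace (EuclideanHalfSpace 3) S]
  [IsManifold (𝓡∂ 3) ∞ S]

theorem IsTopForm.sub {S : Type*} [TopologicalSpace S] [ChartedSpace (EuclideanHalfSpace 3) S]
    {η ζ : ThreeForm (𝓡∂ 3) S} (hη : IsTopForm η) (hζ : IsTopForm ζ) :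
    IsTopForm (fun x u v w => η x u v w - ζ x u v w) := by
  simpa [sub_eq_add_neg] using hη.add (hζ.const_mul (-1))

theorem continuousOn_chartEval2_extD1 {a : CovectorField (𝓡∂ 3) S} (ha : SmoothCov a) (c : S)
    (m n : Fin 3) :
    ContinuousOn (chartEval2 (extD1 a) c m n) (extChartAt (𝓡∂ 3) c).target :=
  (TwoVariation.extD1 ha ha c m n).2.1

theorem contForm_wedge12 {S : Type*} [TopologicalSpace S] [ChartedSpace (EuclideanHalfSpace 3) S]
    {a : CovectorField (𝓡∂ 3) S} (ha : SmoothCov a) {β : TwoForm (𝓡∂ 3) S}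
    (hβ : ∀ c m n, ContinuousOn (chartEval2 β c m n) (extChartAt (𝓡∂ 3) c).target) :
    ContForm (wedge12 a β) := fun c =>
  (((continuousOn_chartEval1 ha c 0).mul (hβ c 1 2)).sub
    ((continuousOn_chartEval1 ha c 1).mul (hβ c 0 2))).add
    ((continuousOn_chartEval1 ha c 2).mul (hβ c 0 1))

theorem extD1_eq_zero_of_eventuallyEq {a : CovectorField (𝓡∂ 3) S} {x : S}
    (h : ∀ᶠ p in 𝓝 x, a p = 0) (u v : E3) : extD1 a x u v = 0 := by
  have : IsManifold (𝓡∂ 3) 1 S := .of_le (n := ∞) (by norm_cast)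
  have hx := mem_extChartAt_target (I := 𝓡∂ 3) x
  have hev : coordRep a x =ᶠ[𝓝[range (𝓡∂ 3)] (extChartAt (𝓡∂ 3) x x)] fun _ => 0 := by
    have hc : ContinuousWithinAt (extChartAt (𝓡∂ 3) x).symm (range (𝓡∂ 3))
        (extChartAt (𝓡∂ 3) x x) :=
      (continuousAt_extChartAt_symm x).continuousWithinAt
    have h' : ∀ᶠ p in 𝓝 ((extChartAt (𝓡∂ 3) x).symm (extChartAt (𝓡∂ 3) x x)), a p = 0 := by
      rwa [extChartAt_to_inv]
    filter_upwards [hc.eventually h'] with y hy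
    simp only [coordRep, hy]
    exact ContinuousLinearMap.zero_comp _
  have h0 := hev.fderivWithin_eq_of_mem (𝕜 := ℝ) (extChartAt_target_subset_range x hx)
  rw [extD1_eq, h0]
  simp

/-- Test one-forms: `ψ dy_m` in the chart at `b`. -/
theorem exists_testForm [T2Space S] (b : S) : ∃ r > 0,
    Metric.ball (extChartAt (𝓡∂ 3) b b) r ∩ halfSpace ⊆ (extChartAt (𝓡∂ 3) b).target ∧
    ∀ (ψ : E3 → ℝ) (m : Fin 3), ContDiff ℝ ∞ ψ → HasCompactSupport ψ →
      tsupport ψ ⊆ Metric.ball (extChartAt (𝓡∂ 3) b b) r →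
      ∃ a : OneForm S, (∀ y ∈ (extChartAt (𝓡∂ 3) b).target,
          coordRep (fun x => a x) b y = ψ y • (EuclideanSpace.proj m : E3 →L[ℝ] ℝ)) ∧
        ∃ K : Set S, IsClosed K ∧ K ⊆ (extChartAt (𝓡∂ 3) b).source ∧ ∀ x ∉ K, a x = 0 := by
  set φ := extChartAt (𝓡∂ 3) b with hφ
  obtain ⟨f⟩ : Nonempty (SmoothBumpFunction (𝓡∂ 3) b) := inferInstance
  have hev : ∀ᶠ y in 𝓝[halfSpace] (φ b), y ∈ φ.target ∧ f (φ.symm y) = 1 := by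
    have h0 : φ.target ∈ 𝓝[halfSpace] (φ b) := extChartAt_target_mem_nhdsWithin b
    have h1 : ∀ᶠ p in 𝓝 (φ.symm (φ b)), f p = 1 := by
      rw [extChartAt_to_inv]; exact f.eventuallyEq_one
    filter_upwards [h0, ((continuousAt_extChartAt_symm b).continuousWithinAt).eventually h1]
      with y h h' using ⟨h, h'⟩
  -- The ball is chosen so small that its part in the half-space lies in the chart target and the
  -- bump equals one there.
  obtain ⟨r, hr, hball⟩ := Metric.mem_nhdsWithin_iff.1 hev
  refine ⟨r, hr, fun y hy => (hball hy).1, fun ψ m hψ hcs hs => ?_⟩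
  have smooth_mul : ∀ g : E3 → ℝ, ContDiff ℝ ∞ g → SmoothFn (fun x => f x * g (φ x)) := fun g hg => by
    rw [← contMDiff_fn_iff]
    refine f.contMDiff_smul (g := fun x => g (φ x)) ?_
    refine (hg.contMDiff.comp_contMDiffOn (contMDiffOn_extChartAt (n := ∞) (x := b))).congr ?_
    intro x _; rfl
  have hh := smooth_mul ψ hψ
  have hg := smooth_mul (fun y => y m) (EuclideanSpace.proj m : E3 →L[ℝ] ℝ).contDiff
  -- The bump makes both ψ and the coordinate y_m globally smooth on `S`. Where it is one the
  -- product is ψ dy_m, and elsewhere in the chart ψ vanishes.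
  have hA : SmoothCov (fun x => (f x * ψ (φ x)) • extD0 (𝓡∂ 3) (fun x => f x * φ x m) x) :=
    SmoothCov.smul hh hg.extD0
  refine ⟨hA.toOneForm, fun y hy => ?_, φ.symm '' (tsupport ψ ∩ halfSpace), ?_, ?_, ?_⟩
  · have e1 : coordRep (fun x => hA.toOneForm x) b y = (f (φ.symm y) * ψ (φ (φ.symm y))) •
        coordRep (extD0 (𝓡∂ 3) (fun x => f x * φ x m)) b y := by
      ext v; rfl
    rw [e1, φ.right_inv hy]
    by_cases hyb : y ∈ Metric.ball (φ b) r
    · have hyr := extChartAt_target_subset_range b hy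
      rw [(hball ⟨hyb, hyr⟩).2, one_mul, coordRep_extD0 hg hy]
      congr 1
      have hev : (fun y => f (φ.symm y) * φ (φ.symm y) m) =ᶠ[𝓝[range (𝓡∂ 3)] y]
          (EuclideanSpace.proj m : E3 →L[ℝ] ℝ) := by
        filter_upwards [inter_mem (mem_nhdsWithin_of_mem_nhds (Metric.isOpen_ball.mem_nhds hyb))
          self_mem_nhdsWithin] with z hz
        rw [(hball hz).2, one_mul, φ.right_inv (hball hz).1]
        rfl
      rw [hev.fderivWithin_eq_of_mem hyr]
      exact ContinuousLinearMap.fderivWithin _ (uniqueDiff_target hy)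
    · rw [image_eq_zero_of_notMem_tsupport (f := ψ) fun h => hyb (hs h), mul_zero, zero_smul, zero_smul]
  · have hK : IsCompact (tsupport ψ ∩ halfSpace) := hcs.isCompact.inter_right isClosed_halfSpace
    exact (hK.image_of_continuousOn ((continuousOn_extChartAt_symm b).mono
      fun y hy => (hball ⟨hs hy.1, hy.2⟩).1)).isClosed
  · rintro _ ⟨y, hy, rfl⟩
    exact φ.map_target (hball ⟨hs hy.1, hy.2⟩).1
  · intro x hx
    have h0 : f x * ψ (φ x) = 0 := by
      by_cases hxs : x ∈ φ.source
      · rw [image_eq_zero_of_notMem_tsupport (f := ψ) (x := φ x) fun h => ?_, mul_zero]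
        exact hx ⟨φ x, ⟨h, extChartAt_target_subset_range b (φ.map_source hxs)⟩, φ.left_inv hxs⟩
      · have : f x = 0 := by
          by_contra hne
          refine hxs ?_
          rw [hφ, extChartAt_source]
          exact f.support_subset_source hne
        rw [this, zero_mul]
    refine (hA.toOneForm_apply x).trans ?_
    beta_reduce
    rw [h0]
    exact zero_smul ℝ _

/-- The three cyclic pairs of basis vectors determine an alternating form; they are exactly the
coefficients detected by the test forms ψ dy_m. -/
theorem alternating_eq_zero {B : E3 →ₗ[ℝ] E3 →ₗ[ℝ] ℝ} (hB : ∀ u, B u u = 0)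
    (h : ∀ m : Fin 3, B (EuclideanSpace.single (m + 1) 1) (EuclideanSpace.single (m + 2) 1) = 0)
    (u v : E3) : B u v = 0 := by
  have hanti : ∀ u v, B v u = - B u v := fun u v => by
    have := hB (u + v)
    simp only [map_add, LinearMap.add_apply, hB] at this
    linarith
  have h0 := h 0
  have h1 := h 1
  have h2 := h 2
  simp only [Fin.isValue, zero_add, Fin.reduceAdd] at h0 h1 h2
  have h0' := hanti (EuclideanSpace.single 1 1) (EuclideanSpace.single 2 1)
  have h1' := hanti (EuclideanSpace.single 2 1) (EuclideanSpace.single 0 1)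
  have h2' := hanti (EuclideanSpace.single 0 1) (EuclideanSpace.single 1 1)
  rw [h0] at h0'
  rw [h1] at h1'
  rw [h2] at h2'
  rw [euclidean_expand u, euclidean_expand v]
  simp only [map_add, map_smul, LinearMap.add_apply, LinearMap.smul_apply, hB, h0, h1, h2, h0', h1',
    h2', neg_zero, smul_zero, add_zero]

end Localization

/-! ### From the integral identity to pointwise equations. -/

section Localization

variable {S : Type*} [TopologicalSpace S] [ChartedSpace (EuclideanHalfSpace 3) S]
  [IsManifold (𝓡∂ 3) ∞ S]

omit [IsManifold (𝓡∂ 3) ∞ S] in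
theorem contDiffOn_chartEval1 {a : CovectorField (𝓡∂ 3) S} (ha : SmoothCov a) (c : S)
    (m : Fin 3) : ContDiffOn ℝ ∞ (chartEval1 a c m) (extChartAt (𝓡∂ 3) c).target :=
  (ha c).clm_apply contDiffOn_const

omit [IsManifold (𝓡∂ 3) ∞ S] in
theorem alternating_rotate {β : TwoForm (𝓡∂ 3) S} (h : IsAlternatingTwoForm β) (x : S) (u v : E3) :
    β x v u = - β x u v := by
  obtain ⟨B, hB, hB'⟩ := h x
  have := hB (u + v)
  simp only [map_add, LinearMap.add_apply, hB] at this
  rw [hB', hB']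
  linarith

theorem covector_expand (L : E3 →L[ℝ] ℝ) (u : E3) : L u = u 0 * L (EuclideanSpace.single 0 1) +
    u 1 * L (EuclideanSpace.single 1 1) + u 2 * L (EuclideanSpace.single 2 1) := by
  conv_lhs => rw [euclidean_expand u]
  simp only [map_add, map_smul, smul_eq_mul]

/-- The chart expression of `a ∧ Q + a ∧ dW - W ∧ da` for `a = ψ dy_m`. -/
theorem chartEval_testForm {Q : TwoForm (𝓡∂ 3) S} (hQa : IsAlternatingTwoForm Q)
    {W : CovectorField (𝓡∂ 3) S} (hW : SmoothCov W) {a : CovectorField (𝓡∂ 3) S}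
    (ha : SmoothCov a) {b : S} {ψ : E3 → ℝ} (hψ : ContDiff ℝ ∞ ψ) {m : Fin 3}
    (hrep : ∀ y ∈ (extChartAt (𝓡∂ 3) b).target,
      coordRep a b y = ψ y • (EuclideanSpace.proj m : E3 →L[ℝ] ℝ))
    {y : E3} (hy : y ∈ (extChartAt (𝓡∂ 3) b).target) :
    chartEval (fun x u v w => wedge12 a Q x u v w +
      (wedge12 a (extD1 W) x u v w - wedge12 W (extD1 a) x u v w)) b y =
    ψ y * chartEval2 Q b (m + 1) (m + 2) y +
      halfDiv (fun n y => ψ y * ∑ j, eps n j m * chartEval1 W b j y) y := by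
  have hyr := extChartAt_target_subset_range b hy
  have huniq : UniqueDiffWithinAt ℝ (range (𝓡∂ 3)) y := uniqueDiff_target hy
  have hWd := hW.differentiableWithinAt hy
  have hψd : DifferentiableWithinAt ℝ ψ (range (𝓡∂ 3)) y :=
    (hψ.differentiable (by simp) y).differentiableWithinAt
  have hda : fderivWithin ℝ (coordRep a b) (range (𝓡∂ 3)) y =
      (fderivWithin ℝ ψ (range (𝓡∂ 3)) y).smulRight (EuclideanSpace.proj m : E3 →L[ℝ] ℝ) := by
    have hev : coordRep a b =ᶠ[𝓝[range (𝓡∂ 3)] y]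
        fun y => ψ y • (EuclideanSpace.proj m : E3 →L[ℝ] ℝ) := by
      filter_upwards [extChartAt_target_mem_nhdsWithin_of_mem hy] with z hz using hrep z hz
    rw [hev.fderivWithin_eq_of_mem hyr]
    exact (hψd.hasFDerivWithinAt.smul_const
      (EuclideanSpace.proj m : E3 →L[ℝ] ℝ)).fderivWithin huniq
  have ha1 : ∀ i, a ((extChartAt (𝓡∂ 3) b).symm y) (coordPush (𝓡∂ 3) b y (EuclideanSpace.single i 1))
      = ψ y * (if m = i then 1 else 0) := fun i => by
    refine (congrArg (fun L : E3 →L[ℝ] ℝ => L (EuclideanSpace.single i 1)) (hrep y hy)).trans ?_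
    simp
  have ha2 : ∀ i j, extD1 a ((extChartAt (𝓡∂ 3) b).symm y)
      (coordPush (𝓡∂ 3) b y (EuclideanSpace.single i 1))
      (coordPush (𝓡∂ 3) b y (EuclideanSpace.single j 1)) =
      fderivWithin ℝ ψ (range (𝓡∂ 3)) y (EuclideanSpace.single i 1) * (if m = j then 1 else 0) -
      fderivWithin ℝ ψ (range (𝓡∂ 3)) y (EuclideanSpace.single j 1) * (if m = i then 1 else 0) :=
    fun i j => by
      rw [ha.extD1_coordPush hy, hda]
      simp
  have hWj : ∀ n j, fderivWithin ℝ (chartEval1 W b j) (range (𝓡∂ 3)) y (EuclideanSpace.single n 1) =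
      fderivWithin ℝ (coordRep W b) (range (𝓡∂ 3)) y (EuclideanSpace.single n 1)
        (EuclideanSpace.single j 1) := fun n j => by
    have h := fderivWithin_clm_apply huniq hWd
      (differentiableWithinAt_const (c := (EuclideanSpace.single j 1 : E3)))
    refine (congrArg (fun L : E3 →L[ℝ] ℝ => L (EuclideanSpace.single n 1)) h).trans ?_
    simp
  have hWjd : ∀ j, DifferentiableWithinAt ℝ (chartEval1 W b j) (range (𝓡∂ 3)) y := fun j =>
    hWd.clm_apply (differentiableWithinAt_const _)
  have hdiv : ∀ n, fderivWithin ℝ (fun y => ψ y * ∑ j, eps n j m * chartEval1 W b j y)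
      (range (𝓡∂ 3)) y (EuclideanSpace.single n 1) =
      ψ y * (∑ j, eps n j m * fderivWithin ℝ (coordRep W b) (range (𝓡∂ 3)) y
        (EuclideanSpace.single n 1) (EuclideanSpace.single j 1)) +
      (∑ j, eps n j m * chartEval1 W b j y) *
        fderivWithin ℝ ψ (range (𝓡∂ 3)) y (EuclideanSpace.single n 1) := fun n => by
    have hs : DifferentiableWithinAt ℝ (fun y => ∑ j, eps n j m * chartEval1 W b j y)
        (range (𝓡∂ 3)) y :=
      DifferentiableWithinAt.fun_sum fun j _ => (hWjd j).const_mul _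
    rw [fderivWithin_fun_mul huniq hψd hs, fderivWithin_fun_sum huniq fun j _ => (hWjd j).const_mul _]
    simp only [add_apply, smul_apply, sum_apply, smul_eq_mul]
    congr 2
    refine Finset.sum_congr rfl fun j _ => ?_
    rw [fderivWithin_const_mul huniq (hWjd j), smul_apply, smul_eq_mul, hWj]
  -- The exact part is the coefficient of d(W∧a), that is, the divergence of the vector with
  -- components ε_{njm} ψ W_j.
  simp only [chartEval, wedge12, ha1, ha2, hW.extD1_coordPush hy, halfDiv, hdiv]
  have hQ := fun i j => alternating_rotate hQa ((extChartAt (𝓡∂ 3) b).symm y)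
      (coordPush (𝓡∂ 3) b y (EuclideanSpace.single i 1))
      (coordPush (𝓡∂ 3) b y (EuclideanSpace.single j 1))
  simp only [chartEval1, chartEval2]
  -- For m = 1 the cyclic pair is (2, 0), while the wedge product is written with (0, 2).
  have hQ' := hQ 0 2
  fin_cases m <;> simp only [Fin.zero_eta, Fin.mk_one, Fin.reduceFinMk, Fin.sum_univ_three,
    eps_values, eps_self_left, eps_self_right, eps_self_outer, Fin.isValue, zero_add, Fin.reduceAdd,
    Fin.reduceEq, if_true, if_false, hQ'] <;> ring

/-- For a = ψ dy_m the integrand is ψ Q_{m+1,m+2} plus the divergence of ε_{njm} ψ W_j, to which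
`halfSpace_fundamental_lemma` applies. The normal flux involves only the tangential components of W,
which is why the boundary conclusion is restricted to vectors with vanishing first coordinate. -/
theorem flux_localization_single [T2Space S] [CompactSpace S] (hor : IsOrientedAtlas S)
    {Q : TwoForm (𝓡∂ 3) S} (hQa : IsAlternatingTwoForm Q)
    (hQc : ∀ c m n, ContinuousOn (chartEval2 Q c m n) (extChartAt (𝓡∂ 3) c).target)
    {W : CovectorField (𝓡∂ 3) S} (hW : SmoothCov W)
    (h : ∀ a : OneForm S, integral (fun x u v w => wedge12 (fun x => a x) Q x u v w +
      (wedge12 (fun x => a x) (extD1 W) x u v w - wedge12 W (extD1 fun x => a x) x u v w)) = 0)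
    (b : S) : (∀ u v : E3, Q b u v = 0) ∧
      (extChartAt (𝓡∂ 3) b b 0 = 0 → ∀ u : E3, u 0 = 0 → W b u = 0) := by
  have : IsManifold (𝓡∂ 3) 1 S := .of_le (n := ∞) (by norm_cast)
  obtain ⟨r, hr, hsub, htest⟩ := exists_testForm b
  have hmem : extChartAt (𝓡∂ 3) b b ∈ (extChartAt (𝓡∂ 3) b).target := mem_extChartAt_target b
  have hyr := extChartAt_target_subset_range b hmem
  have key : ∀ m : Fin 3, chartEval2 Q b (m + 1) (m + 2) (extChartAt (𝓡∂ 3) b b) = 0 ∧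
      (extChartAt (𝓡∂ 3) b b 0 = 0 →
        ∑ j, eps 0 j m * chartEval1 W b j (extChartAt (𝓡∂ 3) b b) = 0) := fun m => by
    have hm := halfSpace_fundamental_lemma (Q := chartEval2 Q b (m + 1) (m + 2))
      (K := fun n y => ∑ j, eps n j m * chartEval1 W b j y) hr ((hQc b _ _).mono hsub)
      (fun n => ContDiffOn.sum fun j _ => contDiffOn_const.mul
        (((contDiffOn_chartEval1 hW b j).of_le (by norm_cast)).mono hsub)) fun ψ hψ hcs hs => by
      obtain ⟨a, hrep, K, hK, hKs, hz⟩ := htest ψ m hψ hcs hs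
      have ha := a.smoothCov
      have hcont := contForm_wedge12 ha hQc
      have hcont' := (contForm_wedge12 ha (continuousOn_chartEval2_extD1 hW)).sub
        (contForm_wedge12 hW (continuousOn_chartEval2_extD1 ha))
      have htop := (isTopForm_wedge12 (fun x => a x) hQa).add
        ((isTopForm_wedge12 (fun x => a x) (isAlternatingTwoForm_extD1 W)).sub
        (isTopForm_wedge12 W (isAlternatingTwoForm_extD1 fun x => a x)))
      have hI := integral_eq_chart hor htop (hcont.add hcont') hK hKs fun x hx u v w => by
        have hd := fun u v => extD1_eq_zero_of_eventuallyEq (a := fun x => a x) (x := x) (by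
          filter_upwards [hK.isOpen_compl.mem_nhds hx] with p hp using hz p hp) u v
        have h0 : ∀ u : E3, a x u = 0 := fun u =>
          congrArg (fun L : E3 →L[ℝ] ℝ => L u) (hz x hx)
        simp only [wedge12]
        rw [h0 u, h0 v, h0 w, hd u v, hd u w, hd v w]
        ring
      rw [h a] at hI
      rw [hI]
      have e1 : ∀ y ∈ (extChartAt (𝓡∂ 3) b).target, _ := fun y hy =>
        chartEval_testForm hQa hW ha hψ hrep hy
      rw [setIntegral_congr_fun (measurableSet_target b) e1]
      symm
      refine setIntegral_eq_of_subset_of_forall_sdiff_eq_zero (measurableSet_target b) hsub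
        fun y hy => ?_
      have hyt : y ∉ tsupport ψ := fun hyt =>
        hy.2 ⟨hs hyt, extChartAt_target_subset_range b hy.1⟩
      rw [halfDiv_eq_zero hyt, image_eq_zero_of_notMem_tsupport hyt, zero_mul, add_zero]
    exact ⟨hm.1 _ ⟨Metric.mem_ball_self hr, hyr⟩, hm.2⟩
  constructor
  · have h1 : ∀ u v : E3, Q ((extChartAt (𝓡∂ 3) b).symm (extChartAt (𝓡∂ 3) b b)) u v = 0 := by
      obtain ⟨B, hB, hB'⟩ := hQa ((extChartAt (𝓡∂ 3) b).symm (extChartAt (𝓡∂ 3) b b))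
      let P : E3 →ₗ[ℝ] E3 :=
        (show E3 →L[ℝ] E3 from coordPush (𝓡∂ 3) b (extChartAt (𝓡∂ 3) b b)).toLinearMap
      have h2 := alternating_eq_zero (B := B.compl₁₂ P P) (fun u => hB _) fun m =>
        (hB' _ _).symm.trans (key m).1
      intro u v
      have eu := coordPush_comp_mfderiv hmem u
      have ev := coordPush_comp_mfderiv hmem v
      rw [← eu, ← ev]
      exact (hB' _ _).trans (h2 _ _)
    have hb := extChartAt_to_inv (I := 𝓡∂ 3) b
    rwa [hb] at h1
  · intro h0 u hu
    -- The fluxes for m = 1 and m = 2 are -W_2 and W_1; m = 0 gives no condition.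
    have k1 := (key 1).2 h0
    have k2 := (key 2).2 h0
    simp only [Fin.sum_univ_three, eps_values, eps_self_left, eps_self_right,
      zero_mul, add_zero, zero_add, one_mul, neg_mul] at k1 k2
    have hc : ∀ j, chartEval1 W b j (extChartAt (𝓡∂ 3) b b) = W b (EuclideanSpace.single j 1) :=
      fun j => coordRep_self W b _
    rw [hc] at k1 k2
    refine (covector_expand (W b) u).trans ?_
    rw [hu]
    linear_combination (-u 2) * k1 + u 1 * k2

end Localization

/-! ### Equations satisfied by the multiplier forms. -/

section Determination

variable {S : Type*} [TopologicalSpace S] [ChartedSpace (EuclideanHalfSpace 3) S]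
  [IsManifold (𝓡∂ 3) ∞ S]

theorem cov_single_self (i : Fin 3) (a : OneForm S) : cov (Pi.single i a) i = fun x => a x := by
  funext x
  simp only [cov, Pi.single_eq_same]

theorem cov_single_of_ne {i j : Fin 3} (h : j ≠ i) (a : OneForm S) :
    cov (Pi.single i a) j = fun _ => 0 := by
  funext x
  simp only [cov, Pi.single_eq_of_ne h]
  rfl

/-- Variations with a single nonzero internal component decouple the sum over `i`. The constant is
divided out in the bulk only, so the flux statement does not feel it. -/
theorem flux_localization [T2Space S] [CompactSpace S] (hor : IsOrientedAtlas S) {r : ℝ}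
    (hr : r ≠ 0) {Q : Fin 3 → TwoForm (𝓡∂ 3) S} (hQa : ∀ i, IsAlternatingTwoForm (Q i))
    (hQc : ∀ i c m n, ContinuousOn (chartEval2 (Q i) c m n) (extChartAt (𝓡∂ 3) c).target)
    {W : Fin 3 → CovectorField (𝓡∂ 3) S} (hW : ∀ i, SmoothCov (W i))
    (h : ∀ a : Fin 3 → OneForm S, integral (fun x u v w =>
      r * (∑ i, wedge12 (cov a i) (Q i) x u v w) + ∑ i, (wedge12 (cov a i) (extD1 (W i)) x u v w -
        wedge12 (W i) (extD1 (cov a i)) x u v w)) = 0)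
    (i : Fin 3) (b : S) : (∀ u v : E3, Q i b u v = 0) ∧
      (extChartAt (𝓡∂ 3) b b 0 = 0 → ∀ u : E3, u 0 = 0 → W i b u = 0) := by
  have key := flux_localization_single hor ((hQa i).mul fun _ => r)
    (fun c m n => continuousOn_const.mul (hQc i c m n)) (hW i) (fun a => by
      rw [← h (Pi.single i a)]
      congr 1
      funext x u v w
      rw [Finset.sum_eq_single_of_mem i (Finset.mem_univ i) fun j _ hj => ?_,
        Finset.sum_eq_single_of_mem i (Finset.mem_univ i) fun j _ hj => ?_, cov_single_self]
      · simp only [wedge12]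
        ring
      · rw [cov_single_of_ne hj]
        have h0 := fun u v : E3 => extD1_zero x u v
        simp only [wedge12]
        rw [h0 u v, h0 u w, h0 v w]
        change (0 * _ - 0 * _ + 0 * _) - (_ * 0 - _ * 0 + _ * 0) = (0 : ℝ)
        ring
      · rw [cov_single_of_ne hj]
        change 0 * _ - 0 * _ + 0 * _ = (0 : ℝ)
        ring) b
  exact ⟨fun u v => (mul_eq_zero.1 (key.1 u v)).resolve_left hr, key.2⟩

theorem isAlternatingTwoForm_covD1 (A e : Fin 3 → CovectorField (𝓡∂ 3) S) (i : Fin 3) :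
    IsAlternatingTwoForm (covD1 A e i) := by
  have h := (isAlternatingTwoForm_extD1 (e i)).add (IsAlternatingTwoForm.epsSum (fun _ _ => 1)
    (fun j k => isAlternatingTwoForm_wedge11 (A j) (e k)) i)
  simp only [mul_one] at h
  exact h

theorem isAlternatingTwoForm_curv (A : Fin 3 → CovectorField (𝓡∂ 3) S) (i : Fin 3) :
    IsAlternatingTwoForm (curv A i) := by
  have h := (isAlternatingTwoForm_extD1 (A i)).add ((IsAlternatingTwoForm.epsSum (fun _ _ => 1)
    (fun j k => isAlternatingTwoForm_wedge11 (A j) (A k)) i).mul fun _ => 1 / 2)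
  simp only [mul_one] at h
  exact h

theorem isAlternatingTwoForm_bulkDefect (q : Fields S) (V : Fin 3 → OneForm S)
    {β : Fin 3 → TwoForm (𝓡∂ 3) S} (hβ : ∀ i, IsAlternatingTwoForm (β i)) (i : Fin 3) :
    IsAlternatingTwoForm (bulkDefect q V β i) := by
  have h := (IsAlternatingTwoForm.epsSum (fun _ _ => 1)
    (fun j k => isAlternatingTwoForm_wedge11 (cov q.e j) (cov V k)) i).sub
      (IsAlternatingTwoForm.epsSum (fn q.eperp) (fun _ k => hβ k) i)
  simp only [mul_one] at h
  exact h

omit [IsManifold (𝓡∂ 3) ∞ S] in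
theorem continuousOn_chartEval2_wedge11 {a b : CovectorField (𝓡∂ 3) S} (ha : SmoothCov a)
    (hb : SmoothCov b) (c : S) (m n : Fin 3) :
    ContinuousOn (chartEval2 (wedge11 a b) c m n) (extChartAt (𝓡∂ 3) c).target :=
  ((continuousOn_chartEval1 ha c m).mul (continuousOn_chartEval1 hb c n)).sub
    ((continuousOn_chartEval1 ha c n).mul (continuousOn_chartEval1 hb c m))

theorem continuousOn_chartEval2_covD1 {A e : Fin 3 → CovectorField (𝓡∂ 3) S}
    (hA : ∀ i, SmoothCov (A i)) (he : ∀ i, SmoothCov (e i)) (i : Fin 3) (c : S) (m n : Fin 3) :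
    ContinuousOn (chartEval2 (covD1 A e i) c m n) (extChartAt (𝓡∂ 3) c).target :=
  (continuousOn_chartEval2_extD1 (he i) c m n).add (continuousOn_finsetSum _ fun j _ =>
    continuousOn_finsetSum _ fun k _ => continuousOn_const.mul
      (continuousOn_chartEval2_wedge11 (hA j) (he k) c m n))

theorem continuousOn_chartEval2_curv {A : Fin 3 → CovectorField (𝓡∂ 3) S}
    (hA : ∀ i, SmoothCov (A i)) (i : Fin 3) (c : S) (m n : Fin 3) :
    ContinuousOn (chartEval2 (curv A i) c m n) (extChartAt (𝓡∂ 3) c).target :=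
  (continuousOn_chartEval2_extD1 (hA i) c m n).add (continuousOn_const.mul
    (continuousOn_finsetSum _ fun j _ => continuousOn_finsetSum _ fun k _ =>
      continuousOn_const.mul (continuousOn_chartEval2_wedge11 (hA j) (hA k) c m n)))

theorem continuousOn_chartEval2_bulkDefect (q : Fields S) (V : Fin 3 → OneForm S)
    {β : Fin 3 → TwoForm (𝓡∂ 3) S}
    (hβ : ∀ i c m n, ContinuousOn (chartEval2 (β i) c m n) (extChartAt (𝓡∂ 3) c).target)
    (i : Fin 3) (c : S) (m n : Fin 3) :
    ContinuousOn (chartEval2 (bulkDefect q V β i) c m n) (extChartAt (𝓡∂ 3) c).target :=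
  (continuousOn_finsetSum _ fun j _ => continuousOn_finsetSum _ fun k _ => continuousOn_const.mul
    (continuousOn_chartEval2_wedge11 (smoothCov_cov q.e j) (smoothCov_cov V k) c m n)).sub
  (continuousOn_finsetSum _ fun j _ => continuousOn_finsetSum _ fun k _ =>
    (continuousOn_const.mul (smoothFn_scalar (q.eperp j) c).continuousOn).mul (hβ k c m n))

/-- The one-form `X_A - D A_⊥`. -/
noncomputable def connectionMultiplier (q : Fields S) (XA : Fin 3 → OneForm S) (i : Fin 3) :
    OneForm S :=
  ((smoothCov_cov XA i).sub (SmoothCov.covD0 (smoothCov_cov q.A)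
    (fun i => smoothFn_scalar (q.Aperp i)) i)).toOneForm

/-- The one-form `X_e - D e_⊥ + ε A_⊥ e`. -/
noncomputable def triadMultiplier (q : Fields S) (Xe : Fin 3 → OneForm S) (i : Fin 3) :
    OneForm S :=
  (((smoothCov_cov Xe i).sub (SmoothCov.covD0 (smoothCov_cov q.A)
    (fun i => smoothFn_scalar (q.eperp i)) i)).add (SmoothCov.epsContract
      (fun i => smoothFn_scalar (q.Aperp i)) (smoothCov_cov q.e) i)).toOneForm

theorem connectionMultiplier_spec (q : Fields S) (XA : Fin 3 → OneForm S) (i : Fin 3) (x : S) :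
    cov XA i x = covD0 (cov q.A) (fn q.Aperp) i x + cov (connectionMultiplier q XA) i x := by
  have : cov (connectionMultiplier q XA) i x = cov XA i x - covD0 (cov q.A) (fn q.Aperp) i x := rfl
  rw [this, add_sub_cancel]

theorem triadMultiplier_spec (q : Fields S) (Xe : Fin 3 → OneForm S) (i : Fin 3) (x : S) :
    cov Xe i x = covD0 (cov q.A) (fn q.eperp) i x - epsContract (fn q.Aperp) (cov q.e) i x +
      cov (triadMultiplier q Xe) i x := by
  have : cov (triadMultiplier q Xe) i x = cov Xe i x - covD0 (cov q.A) (fn q.eperp) i x +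
    epsContract (fn q.Aperp) (cov q.e) i x := rfl
  rw [this]
  abel

/-- The content of Dirac's equation: the multiplier forms solve the bulk equations, and the flux
forms vanish on vectors tangent to the boundary. -/
theorem IsHamiltonianVector.determination [T2Space S] [CompactSpace S] (hor : IsOrientedAtlas S)
    {α : Couplings} (hα : α.α₁ ≠ α.α₂) {z X : PhasePoint S} (h : IsHamiltonianVector α z X)
    {VA Ve : Fin 3 → OneForm S}
    (hXA : ∀ i x, cov X.q.A i x = covD0 (cov z.q.A) (fn z.q.Aperp) i x + cov VA i x)
    (hXe : ∀ i x, cov X.q.e i x = covD0 (cov z.q.A) (fn z.q.eperp) i x -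
      epsContract (fn z.q.Aperp) (cov z.q.e) i x + cov Ve i x) (i : Fin 3) (x : S) :
    ((∀ u v : E3, bulkDefect z.q Ve (covD1 (cov z.q.A) (cov z.q.e)) i x u v = 0) ∧
      (extChartAt (𝓡∂ 3) x x 0 = 0 → ∀ u : E3, u 0 = 0 →
        fluxForm z.q VA Ve (2 * α.α₃) α.α₅ (2 * α.α₁) i x u = 0)) ∧
    ((∀ u v : E3, bulkDefect z.q VA (curv (cov z.q.A)) i x u v = 0) ∧
      (extChartAt (𝓡∂ 3) x x 0 = 0 → ∀ u : E3, u 0 = 0 →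
        fluxForm z.q Ve VA (2 * α.α₂) α.α₅ (2 * α.α₄) i x u = 0)) := by
  have hr : 2 * (α.α₁ - α.α₂) ≠ 0 := mul_ne_zero two_ne_zero (sub_ne_zero.2 hα)
  constructor
  · refine flux_localization hor hr
      (isAlternatingTwoForm_bulkDefect z.q Ve (isAlternatingTwoForm_covD1 _ _))
      (continuousOn_chartEval2_bulkDefect z.q Ve
        (continuousOn_chartEval2_covD1 (smoothCov_cov z.q.A) (smoothCov_cov z.q.e)))
      (smoothCov_fluxForm z.q VA Ve _ _ _) (fun a => ?_) i x
    rw [← h.integral_diracForm a 0]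
    congr 1
    funext x u v w
    exact (diracForm_connection α hXA hXe a x u v w).symm
  · refine flux_localization hor (neg_ne_zero.2 hr)
      (isAlternatingTwoForm_bulkDefect z.q VA (isAlternatingTwoForm_curv _))
      (continuousOn_chartEval2_bulkDefect z.q VA
        (continuousOn_chartEval2_curv (smoothCov_cov z.q.A)))
      (smoothCov_fluxForm z.q Ve VA _ _ _) (fun b => ?_) i x
    rw [← h.integral_diracForm 0 b]
    congr 1
    funext x u v w
    exact (diracForm_triad α hXA hXe b x u v w).symm

end Determination

/-! ### Tangent spaces of the boundary and the consistency constraints. -/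

section BoundaryGeometry

variable {S : Type*} [TopologicalSpace S] [ChartedSpace (EuclideanHalfSpace 3) S]
  [IsManifold (𝓡∂ 3) ∞ S]
variable {N : Type*} [TopologicalSpace N] [ChartedSpace (EuclideanSpace ℝ (Fin 2)) N]
  [IsManifold (𝓡 2) ∞ N] {ι : N → S}

omit [IsManifold (𝓡∂ 3) ∞ S] [IsManifold (𝓡 2) ∞ N] in
theorem IsBoundaryInclusion.chart_zero (hι : IsBoundaryInclusion ι) (y : N) :
    extChartAt (𝓡∂ 3) (ι y) (ι y) 0 = 0 := by
  have h : ι y ∈ (𝓡∂ 3).boundary S := hι.range_eq ▸ mem_range_self y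
  have h' : extChartAt (𝓡∂ 3) (ι y) (ι y) ∈ frontier (range (𝓡∂ 3)) := h
  rw [frontier_range_modelWithCornersEuclideanHalfSpace] at h'
  exact Eq.symm h'

/-- The differential of the boundary inclusion at `y`. -/
noncomputable def boundaryPush (ι : N → S) (y : N) : EuclideanSpace ℝ (Fin 2) →L[ℝ] E3 :=
  mfderiv (𝓡 2) (𝓡∂ 3) ι y

/-- The first coordinate of `ι`, in the chart at the image point, is nonnegative and vanishes at
`y`; it has a minimum there and its derivative is zero. -/
theorem IsBoundaryInclusion.boundaryPush_zero (hι : IsBoundaryInclusion ι) (y : N)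
    (v : EuclideanSpace ℝ (Fin 2)) : boundaryPush ι y v 0 = 0 := by
  have : IsManifold (𝓡∂ 3) 1 S := .of_le (n := ∞) (by norm_cast)
  have : IsManifold (𝓡 2) 1 N := .of_le (n := ∞) (by norm_cast)
  set y' := extChartAt (𝓡 2) y y with hy'
  have hyt : y' ∈ (extChartAt (𝓡 2) y).target := mem_extChartAt_target y
  have hinv : (extChartAt (𝓡 2) y).symm y' = y := extChartAt_to_inv y
  have hc : ι ((extChartAt (𝓡 2) y).symm y') ∈ (extChartAt (𝓡∂ 3) (ι y)).source := by
    rw [hinv]; exact mem_extChartAt_source _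
  have hd := ((chartMap_contDiffWithinAt hι.contMDiff hyt hc).differentiableWithinAt (by simp))
  rw [ModelWithCorners.range_eq_univ, differentiableWithinAt_univ] at hd
  have hmin : IsLocalMin (fun w => chartMap (𝓡 2) (𝓡∂ 3) ι y (ι y) w 0) y' := by
    refine Eventually.of_forall fun w => ?_
    have h0 : chartMap (𝓡 2) (𝓡∂ 3) ι y (ι y) y' 0 = 0 := by
      simp only [chartMap, hinv]
      exact hι.chart_zero y
    beta_reduce
    rw [h0]
    exact mem_halfSpace.1 (chartMap_mapsTo ι y (ι y) (by rw [ModelWithCorners.range_eq_univ]; trivial))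
  have h1 : fderiv ℝ (fun w => chartMap (𝓡 2) (𝓡∂ 3) ι y (ι y) w 0) y' v =
      fderiv ℝ (chartMap (𝓡 2) (𝓡∂ 3) ι y (ι y)) y' v 0 := by
    have := ((EuclideanSpace.proj (0 : Fin 3) : E3 →L[ℝ] ℝ).hasFDerivAt.comp y' hd.hasFDerivAt).fderiv
    exact congrArg (fun L => L v) this
  rw [hmin.fderiv_eq_zero] at h1
  have h2 : boundaryPush ι y = fderivWithin ℝ (chartMap (𝓡 2) (𝓡∂ 3) ι y (ι y)) (range (𝓡 2)) y' :=
    (hι.contMDiff.mdifferentiable (by simp) y).mfderiv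
  rw [h2, ModelWithCorners.range_eq_univ, fderivWithin_univ, ← h1]
  rfl

omit [IsManifold (𝓡∂ 3) ∞ S] [IsManifold (𝓡 2) ∞ N] in
/-- The tangent space of the boundary is the kernel of any non-zero functional that vanishes on
it. -/
theorem IsBoundaryInclusion.mem_range_boundaryPush (hι : IsBoundaryInclusion ι) (y : N)
    {P : E3 →ₗ[ℝ] ℝ} (hP : P ≠ 0) (h : ∀ v, P (boundaryPush ι y v) = 0) {u : E3} (hu : P u = 0) :
    ∃ v, boundaryPush ι y v = u := by
  have hle : LinearMap.range (boundaryPush ι y).toLinearMap ≤ LinearMap.ker P := by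
    rintro _ ⟨v, rfl⟩
    exact h v
  have h1 := P.finrank_range_add_finrank_ker
  rw [LinearMap.range_eq_top.2 (LinearMap.surjective hP), finrank_top, finrank_euclideanSpace,
    Module.finrank_self] at h1
  have h2 := LinearMap.finrank_range_of_inj (f := (boundaryPush ι y).toLinearMap)
    (hι.injective_mfderiv y)
  rw [finrank_euclideanSpace] at h2
  -- Both spaces have dimension two: the range by injectivity of the differential, the kernel
  -- because 3 - 1 = 2.
  have heq := Submodule.eq_of_le_of_finrank_eq hle (by simp at h1 h2 ⊢; omega)
  have hm : u ∈ LinearMap.range (boundaryPush ι y).toLinearMap := by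
    rw [heq]; exact hu
  exact hm

/-- The consistency constraints hold on the boundary. -/
theorem IsHamiltonianVector.consistency [T2Space S] [CompactSpace S] (hor : IsOrientedAtlas S)
    (hι : IsBoundaryInclusion ι) {α : Couplings} (hα : α.α₁ ≠ α.α₂)
    (hα' : 4 * α.α₂ * α.α₃ - α.α₅ ^ 2 ≠ 0) {z X : PhasePoint S} (h : IsHamiltonianVector α z X)
    {VA Ve : Fin 3 → OneForm S}
    (hXA : ∀ i x, cov X.q.A i x = covD0 (cov z.q.A) (fn z.q.Aperp) i x + cov VA i x)
    (hXe : ∀ i x, cov X.q.e i x = covD0 (cov z.q.A) (fn z.q.eperp) i x -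
      epsContract (fn z.q.Aperp) (cov z.q.e) i x + cov Ve i x) :
    ConsistencyConstraints α ι z.q VA Ve := fun i y u => by
  have hd := h.determination hor hα hXA hXe i (ι y)
  have hu := hι.boundaryPush_zero y u
  have h1 := hd.1.2 (hι.chart_zero y) _ hu
  have h2 := hd.2.2 (hι.chart_zero y) _ hu
  rw [fluxForm_apply, ← epsContract_apply] at h1 h2
  have hα'' : α.α₅ ^ 2 - 4 * α.α₂ * α.α₃ ≠ 0 := fun h0 => hα' (by linarith)
  change cov VA i (ι y) (boundaryPush ι y u) = 2 * curvCoeff α * epsContract (fn z.q.eperp)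
      (cov z.q.e) i (ι y) (boundaryPush ι y u) ∧ cov Ve i (ι y) (boundaryPush ι y u) =
    2 * torsionCoeff α * epsContract (fn z.q.eperp) (cov z.q.e) i (ι y) (boundaryPush ι y u)
  generalize epsContract (fn z.q.eperp) (cov z.q.e) i (ι y) (boundaryPush ι y u) = c at *
  generalize cov VA i (ι y) (boundaryPush ι y u) = a at *
  generalize cov Ve i (ι y) (boundaryPush ι y u) = b at *
  have solve : ∀ {p q a : ℝ}, q ≠ 0 → a * q = 2 * p * c → a = 2 * (p / q) * c := fun hq h => by
    rw [eq_comm, mul_div_assoc', div_mul_eq_mul_div, div_eq_iff hq, h]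
  -- Cramer's rule for 2α₃ a + α₅ b = -2α₁ c and α₅ a + 2α₂ b = -2α₄ c, whose determinant is 4α₂α₃ -
  -- α₅².
  exact ⟨solve hα'' (by linear_combination (-2 * α.α₂) * h1 + α.α₅ * h2),
    solve hα'' (by linear_combination (-2 * α.α₃) * h2 + α.α₅ * h1)⟩

end BoundaryGeometry

/-! ### Indeterminacy of the perpendicular velocities, and the vector field of a coframe. -/

section VectorField

variable {S : Type*} [TopologicalSpace S] [ChartedSpace (EuclideanHalfSpace 3) S]
  [IsManifold (𝓡∂ 3) ∞ S]

/-- The components `X_{A_⊥}` and `X_{e_⊥}` are arbitrary. -/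
theorem IsHamiltonianVector.replace [T2Space S] [CompactSpace S] {α : Couplings}
    {z X : PhasePoint S} (h : IsHamiltonianVector α z X) (lp mp : Fin 3 → ScalarField S) :
    IsHamiltonianVector α z ⟨⟨lp, X.q.A, mp, X.q.e⟩, X.m⟩ := by
  obtain ⟨⟨lp', l, mp', m, hD⟩, h1, h2, h3, h4⟩ := h
  refine ⟨⟨lp' + lp - X.q.Aperp, l, mp' + mp - X.q.eperp, m, fun Y => ?_⟩, fun w => ?_, fun w => ?_,
    fun w => ?_, fun w => ?_⟩
  · have h := hD Y
    rw [phaseD_primCAperp, phaseD_primCeperp] at h ⊢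
    simp only [symplecticForm, map_sub, map_add] at h ⊢
    linarith
  · have h := h1 w
    rwa [phaseD_primCAperp] at h ⊢
  · have h := h2 w
    rwa [phaseD_primCA] at h ⊢
  · have h := h3 w
    rwa [phaseD_primCeperp] at h ⊢
  · have h := h4 w
    rwa [phaseD_primCe] at h ⊢

theorem IsHamiltonianVector.areMultiplierForms [T2Space S] [CompactSpace S]
    (hor : IsOrientedAtlas S) {α : Couplings} (hα : α.α₁ ≠ α.α₂) {z X : PhasePoint S}
    (h : IsHamiltonianVector α z X) {VA Ve : Fin 3 → OneForm S}
    (hXA : ∀ i x, cov X.q.A i x = covD0 (cov z.q.A) (fn z.q.Aperp) i x + cov VA i x)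
    (hXe : ∀ i x, cov X.q.e i x = covD0 (cov z.q.A) (fn z.q.eperp) i x -
      epsContract (fn z.q.Aperp) (cov z.q.e) i x + cov Ve i x) :
    AreMultiplierForms z.q VA Ve := fun i x u v => by
  have hd := h.determination hor hα hXA hXe i x
  exact ⟨sub_eq_zero.1 (hd.2.1 u v), sub_eq_zero.1 (hd.1.1 u v)⟩

/-- The triple of covectors as a linear map. -/
noncomputable def frameMap {x : S} (e : Fin 3 → TangentSpace (𝓡∂ 3) x →L[ℝ] ℝ) :
    E3 →L[ℝ] (Fin 3 → ℝ) := ContinuousLinearMap.pi e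

omit [IsManifold (𝓡∂ 3) ∞ S] in
-- Three independent covectors span the three-dimensional dual, and a vector annihilated by every
-- functional is zero.
theorem injective_frameMap {x : S} {e : Fin 3 → TangentSpace (𝓡∂ 3) x →L[ℝ] ℝ}
    (he : LinearIndependent ℝ e) : Function.Injective (frameMap e) := by
  have hd : LinearIndependent ℝ fun i => (show E3 →L[ℝ] ℝ from e i).toLinearMap :=
    LinearIndependent.map' (M := E3 →L[ℝ] ℝ) (v := e) he (ContinuousLinearMap.coeLM ℝ)
      (LinearMap.ker_eq_bot.2 ContinuousLinearMap.coe_injective)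
  have hspan := hd.span_eq_top_of_card_eq_finrank' (by
    rw [Fintype.card_fin]
    exact (Subspace.dual_finrank_eq.trans finrank_euclideanSpace_fin).symm)
  refine (injective_iff_map_eq_zero (frameMap e)).2 fun v hv => ?_
  refine (Module.forall_dual_apply_eq_zero_iff ℝ v).1 fun f => ?_
  have hf : f ∈ Submodule.span ℝ (range fun i => (show E3 →L[ℝ] ℝ from e i).toLinearMap) := by
    rw [hspan]; trivial
  induction hf using Submodule.span_induction with
  | mem g hg =>
    obtain ⟨i, rfl⟩ := hg
    exact congrFun hv i
  | zero => rfl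
  | add g h _ _ hg hh => rw [LinearMap.add_apply, hg, hh, add_zero]
  | smul c g _ hg => rw [LinearMap.smul_apply, hg, smul_zero]

theorem isInvertible_of_injective {L : E3 →L[ℝ] (Fin 3 → ℝ)} (h : Function.Injective L) :
    L.IsInvertible := by
  let M := LinearEquiv.ofBijective L.toLinearMap
    ⟨h, (LinearMap.injective_iff_surjective_of_finrank_eq_finrank (by simp)).1 h⟩
  exact ⟨M.toContinuousLinearEquiv, rfl⟩

/-- The vector field with prescribed contractions with a coframe. -/
noncomputable def frameVector (e : Fin 3 → OneForm S) (r : Fin 3 → ScalarField S) (x : S) :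
    TangentSpace (𝓡∂ 3) x :=
  (frameMap fun i => e i x).inverse fun i => r i x

theorem frameVector_spec {e : Fin 3 → OneForm S} (he : IsCoframe (cov e))
    (r : Fin 3 → ScalarField S) (i : Fin 3) (x : S) : e i x (frameVector e r x) = r i x := by
  have h := (isInvertible_of_injective (injective_frameMap (he x))).self_apply_inverse fun i => r i x
  exact congrFun h i

/-- In a chart the vector field solves a linear system with smooth coefficients and invertible
matrix, and inversion is smooth at invertible maps. -/
theorem smooth_frameVector {e : Fin 3 → OneForm S} (he : IsCoframe (cov e))
    (r : Fin 3 → ScalarField S) : ContMDiff (𝓡∂ 3) ((𝓡∂ 3).prod 𝓘(ℝ, E3)) ∞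
      (fun x => Bundle.TotalSpace.mk' E3 (E := fun x : S => TangentSpace (𝓡∂ 3) x) x
        (frameVector e r x)) := by
  have : IsManifold (𝓡∂ 3) 1 S := .of_le (n := ∞) (by norm_cast)
  refine (contMDiff_vector_iff _).2 fun c => ?_
  let L : E3 → E3 →L[ℝ] (Fin 3 → ℝ) := fun y => ContinuousLinearMap.pi fun i => coordRep (cov e i) c y
  let R : E3 → Fin 3 → ℝ := fun y i => r i ((extChartAt (𝓡∂ 3) c).symm y)
  have hL : ContDiffOn ℝ ∞ L (extChartAt (𝓡∂ 3) c).target :=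
    contDiffOn_clm_apply.2 fun v => contDiffOn_pi.2 fun i =>
      (smoothCov_cov e i c).clm_apply contDiffOn_const
  have hR : ContDiffOn ℝ ∞ R (extChartAt (𝓡∂ 3) c).target :=
    contDiffOn_pi.2 fun i => smoothFn_scalar (r i) c
  have hLinv : ∀ y ∈ (extChartAt (𝓡∂ 3) c).target, (L y).IsInvertible := fun y hy => by
    refine isInvertible_of_injective ((injective_iff_map_eq_zero (L y)).2 fun v hv => ?_)
    have h0 : coordPush (𝓡∂ 3) c y v = 0 :=
      injective_frameMap (he ((extChartAt (𝓡∂ 3) c).symm y)) (hv.trans (map_zero _).symm)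
    have h1 := mfderiv_comp_coordPush hy v
    rw [h0] at h1
    exact h1.symm.trans (map_zero _)
  have hρ : ∀ y ∈ (extChartAt (𝓡∂ 3) c).target, coordVec (frameVector e r) c y = (L y).inverse (R y) :=
    fun y hy => by
    refine (hLinv y hy).injective ?_
    rw [(hLinv y hy).self_apply_inverse]
    funext i
    refine Eq.trans ?_ (frameVector_spec he r i ((extChartAt (𝓡∂ 3) c).symm y))
    exact congrArg (fun v => e i ((extChartAt (𝓡∂ 3) c).symm y) v)
      (coordPush_comp_mfderiv hy (frameVector e r ((extChartAt (𝓡∂ 3) c).symm y)))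
  refine ContDiffOn.congr (fun y hy => ?_) hρ
  refine ContDiffWithinAt.clm_apply ?_ (hR y hy)
  obtain ⟨M, hM⟩ := hLinv y hy
  have hinv := contDiffAt_map_inverse (n := ∞) M
  rw [hM] at hinv
  exact hinv.comp_contDiffWithinAt y (hL y hy)

end VectorField

/-! ### Bulk evolution as Lie derivative plus rotation. -/

section Evolution

variable {S : Type*} [TopologicalSpace S] [ChartedSpace (EuclideanHalfSpace 3) S]
  [IsManifold (𝓡∂ 3) ∞ S]

omit [IsManifold (𝓡∂ 3) ∞ S] in
/-- A coframe has trivial kernel: `ε_{ijk} e^j ∧ W^k = 0` implies `W = 0`. -/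
theorem eq_zero_of_eps_wedge_eq_zero {x : S} {e : Fin 3 → TangentSpace (𝓡∂ 3) x →L[ℝ] ℝ}
    (he : LinearIndependent ℝ e) {W : Fin 3 → E3 →ₗ[ℝ] ℝ}
    (h : ∀ i (u v : E3), ∑ j, ∑ k, eps i j k * (e j u * W k v - e j v * W k u) = 0)
    (k : Fin 3) (u : E3) : W k u = 0 := by
  have hinj := injective_frameMap he
  choose f hf using fun a : Fin 3 =>
    (isInvertible_of_injective hinj).surjective (Pi.single a 1)
  have hef : ∀ i a, e i (f a) = if i = a then 1 else 0 := fun i a =>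
    (congrFun (hf a) i).trans (Pi.single_apply a 1 i)
  have hu : u = ∑ a, e a u • f a := by
    refine hinj ?_
    rw [map_sum]
    funext i
    simp only [map_smul, hf, Finset.sum_apply, Pi.smul_apply, Pi.single_apply, smul_eq_mul, mul_ite,
      mul_one, mul_zero, Finset.sum_ite_eq, Finset.mem_univ, if_true]
    rfl
  have key : ∀ a, W k (f a) = 0 := by
    have hh := fun i a b => h i (f a) (f b)
    simp only [hef] at hh
    -- Evaluation on the three pairs of dual frame vectors gives nine linear equations for the nine
    -- numbers `W k (f a)`, and these force all of them to vanish.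
    have e01 := fun i => hh i 0 1
    have e02 := fun i => hh i 0 2
    have e12 := fun i => hh i 1 2
    have e010 := e01 0
    have e011 := e01 1
    have e012 := e01 2
    have e020 := e02 0
    have e021 := e02 1
    have e022 := e02 2
    have e120 := e12 0
    have e121 := e12 1
    have e122 := e12 2
    simp [Fin.sum_univ_three, eps_values, eps_self_left, eps_self_right, eps_self_outer] at e010 e011 e012 e020 e021 e022 e120 e121 e122
    intro a
    fin_cases k <;> fin_cases a <;> simp only [Fin.zero_eta, Fin.mk_one, Fin.reduceFinMk] <;> linarith
  rw [hu, map_sum]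
  refine Finset.sum_eq_zero fun a _ => ?_
  rw [map_smul, key, smul_zero]

/-- The multiplier forms of the curvature and of the torsion are contractions with the vector field
determined by `e_⊥`. -/
theorem multiplier_eq_contraction {q : Fields S} (he : IsCoframe (cov q.e)) {V : Fin 3 → OneForm S}
    {β : Fin 3 → TwoForm (𝓡∂ 3) S} (hβ : ∀ i, IsAlternatingTwoForm (β i))
    (hV : ∀ i x (u v : E3), (∑ j, ∑ k, eps i j k * wedge11 (cov q.e j) (cov V k) x u v) =
      ∑ j, ∑ k, eps i j k * q.eperp j x * β k x u v)
    (hc : ∀ i x (u v w : E3), ∑ j, ∑ k, eps i j k * wedge12 (cov q.e j) (β k) x u v w = 0)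
    (k : Fin 3) (x : S) (u : E3) : cov V k x u = β k x (frameVector q.e q.eperp x) u := by
  choose B hB hB' using fun k => hβ k x
  have hr := fun i => frameVector_spec he q.eperp i x
  set ρ : E3 := frameVector q.e q.eperp x with hρ
  have key := eq_zero_of_eps_wedge_eq_zero (he x)
    (W := fun k => (show E3 →L[ℝ] ℝ from cov V k x).toLinearMap - B k ρ) (fun i u v => by
      have h1 := hV i x u v
      -- Putting ρ into the constraint gives ε (e_⊥^j β^k - e^j ∧ i_ρ β^k) = 0; combined with the
      -- equation for V this is ε e^j ∧ (V^k - i_ρ β^k) = 0.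
      have h2 := hc i x ρ u v
      have hr' : ∀ j, cov q.e j x ρ = q.eperp j x := hr
      simp only [wedge12, hr', hB'] at h2
      simp only [wedge11, hB'] at h1
      simp only [LinearMap.sub_apply]
      change ∑ j, ∑ k, eps i j k * (cov q.e j x u * (cov V k x v - B k ρ v) -
        cov q.e j x v * (cov V k x u - B k ρ u)) = 0
      simp only [Fin.sum_univ_three] at h1 h2 ⊢
      linear_combination h1 + h2) k u
  exact (sub_eq_zero.1 key).trans (hB' k ρ u).symm

omit [IsManifold (𝓡∂ 3) ∞ S] in
theorem coordVec_self [IsManifold (𝓡∂ 3) 1 S] (ρ : ∀ x : S, TangentSpace (𝓡∂ 3) x) (x : S) :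
    coordVec ρ x (extChartAt (𝓡∂ 3) x x) = ρ x := by
  have h : ∀ p, p = x → (mfderiv (𝓡∂ 3) 𝓘(ℝ, E3) (extChartAt (𝓡∂ 3) x) p (ρ p) : E3) = ρ x := by
    rintro _ rfl
    exact mfderiv_chart_self _ _
  exact h _ (extChartAt_to_inv x)

omit [IsManifold (𝓡∂ 3) ∞ S] in
theorem contraction_eq [IsManifold (𝓡∂ 3) 1 S] (a : CovectorField (𝓡∂ 3) S)
    (ρ : ∀ x : S, TangentSpace (𝓡∂ 3) x) {c : S} {y : E3}
    (hy : y ∈ (extChartAt (𝓡∂ 3) c).target) : coordRep a c y (coordVec ρ c y) =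
      a ((extChartAt (𝓡∂ 3) c).symm y) (ρ ((extChartAt (𝓡∂ 3) c).symm y)) :=
  congrArg (fun v => a ((extChartAt (𝓡∂ 3) c).symm y) v)
    (coordPush_comp_mfderiv hy (ρ ((extChartAt (𝓡∂ 3) c).symm y)))

theorem SmoothCov.contraction {a : CovectorField (𝓡∂ 3) S} (ha : SmoothCov a)
    {ρ : ∀ x : S, TangentSpace (𝓡∂ 3) x}
    (hρ : ∀ c, ContDiffOn ℝ ∞ (coordVec ρ c) (extChartAt (𝓡∂ 3) c).target) :
    SmoothFn fun x => a x (ρ x) := fun c => by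
  have : IsManifold (𝓡∂ 3) 1 S := .of_le (n := ∞) (by norm_cast)
  exact ((ha c).clm_apply (hρ c)).congr fun y hy => (contraction_eq a ρ hy).symm

/-- Cartan's formula for one-forms. -/
theorem lieD_eq {a : CovectorField (𝓡∂ 3) S} (ha : SmoothCov a)
    {ρ : ∀ x : S, TangentSpace (𝓡∂ 3) x}
    (hρ : ∀ c, ContDiffOn ℝ ∞ (coordVec ρ c) (extChartAt (𝓡∂ 3) c).target) (x : S) (v : E3) :
    lieD ρ a x v = extD1 a x (ρ x) v + extD0 (𝓡∂ 3) (fun x => a x (ρ x)) x v := by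
  have : IsManifold (𝓡∂ 3) 1 S := .of_le (n := ∞) (by norm_cast)
  have hx := mem_extChartAt_target (I := 𝓡∂ 3) x
  have hr := extChartAt_target_subset_range x hx
  have hv : (mfderiv (𝓡∂ 3) 𝓘(ℝ, E3) (extChartAt (𝓡∂ 3) x) x v : E3) = v := mfderiv_chart_self x v
  have hd : DifferentiableWithinAt ℝ (coordVec ρ x) (range (𝓡∂ 3)) (extChartAt (𝓡∂ 3) x x) :=
    ((hρ x _ hx).mono_of_mem_nhdsWithin
      (extChartAt_target_mem_nhdsWithin_of_mem hx)).differentiableWithinAt (by simp)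
  have hev : (fun y => a ((extChartAt (𝓡∂ 3) x).symm y) (ρ ((extChartAt (𝓡∂ 3) x).symm y)))
      =ᶠ[𝓝[range (𝓡∂ 3)] (extChartAt (𝓡∂ 3) x x)]
      fun y => coordRep a x y (coordVec ρ x y) := by
    filter_upwards [extChartAt_target_mem_nhdsWithin_of_mem hx] with y hy
      using (contraction_eq a ρ hy).symm
  have h1 := extD0_eq (ha.contraction hρ) x v
  rw [hev.fderivWithin_eq_of_mem hr, fderivWithin_clm_apply (uniqueDiff_target hx)
    (ha.differentiableWithinAt hx) hd] at h1
  simp only [add_apply, ContinuousLinearMap.comp_apply, ContinuousLinearMap.flip_apply] at h1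
  have h2 := extD1_eq a x (ρ x) v
  have h3 := coordVec_self ρ x
  rw [← h1]
  refine Eq.trans ?_ (congrArg (· + _) h2.symm)
  simp only [lieD, hv]
  rw [h3]
  ring

variable {q : Fields S} {ρ : ∀ x : S, TangentSpace (𝓡∂ 3) x}

/-- In Cartan's formula the term d(i_ρ A) cancels against the same term in D(τ - i_ρ A), and the
quadratic terms complete i_ρ dA to i_ρ F. -/
theorem connection_evolution (hρ : ∀ c, ContDiffOn ℝ ∞ (coordVec ρ c) (extChartAt (𝓡∂ 3) c).target)
    (i : Fin 3) (x : S) (v : E3) :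
    lieD ρ (cov q.A i) x v +
      covD0 (cov q.A) (fun j x => q.Aperp j x - cov q.A j x (ρ x)) i x v =
    covD0 (cov q.A) (fn q.Aperp) i x v + curv (cov q.A) i x (ρ x) v := by
  have hσ := fun j => (smoothCov_cov q.A j).contraction hρ
  rw [lieD_eq (smoothCov_cov q.A i) hρ, covD0_apply, covD0_apply,
    extD0_sub (smoothFn_scalar (q.Aperp i)) (hσ i)]
  have hfn : fn q.Aperp = fun i x => q.Aperp i x := rfl
  simp only [curv, wedge11, hfn]
  fin_cases i <;> simp only [Fin.zero_eta, Fin.mk_one, Fin.reduceFinMk, Fin.sum_univ_three,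
    eps_values, eps_self_left, eps_self_right, eps_self_outer] <;> ring

/-- Since i_ρ e = e_⊥, Cartan's formula gives i_ρ de + d e_⊥; the rotation by i_ρ A supplies the
connection terms that turn these into i_ρ De + D e_⊥. -/
theorem triad_evolution (hρ : ∀ c, ContDiffOn ℝ ∞ (coordVec ρ c) (extChartAt (𝓡∂ 3) c).target)
    (hr : ∀ i x, cov q.e i x (ρ x) = q.eperp i x) (i : Fin 3) (x : S) (v : E3) :
    lieD ρ (cov q.e i) x v -
      epsContract (fun j x => q.Aperp j x - cov q.A j x (ρ x)) (cov q.e) i x v =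
    covD0 (cov q.A) (fn q.eperp) i x v - epsContract (fn q.Aperp) (cov q.e) i x v +
      covD1 (cov q.A) (cov q.e) i x (ρ x) v := by
  have h : (fun x => cov q.e i x (ρ x)) = fn q.eperp i := funext (hr i)
  rw [lieD_eq (smoothCov_cov q.e i) hρ, covD0_apply, epsContract_apply, epsContract_apply, h]
  simp only [covD1, wedge11, hr, fn]
  fin_cases i <;> simp only [Fin.zero_eta, Fin.mk_one, Fin.reduceFinMk, Fin.sum_univ_three,
    eps_values, eps_self_left, eps_self_right, eps_self_outer] <;> ring

end Evolution

/-! ### Pullback to the boundary, the gravity equations and the sector condition. -/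

section BoundaryGravity

variable {S : Type*} [TopologicalSpace S] [ChartedSpace (EuclideanHalfSpace 3) S]
  [IsManifold (𝓡∂ 3) ∞ S]
variable {N : Type*} [TopologicalSpace N] [ChartedSpace (EuclideanSpace ℝ (Fin 2)) N]
  [IsManifold (𝓡 2) ∞ N] {ι : N → S}

theorem SmoothCov.extD1_pullback {a : CovectorField (𝓡∂ 3) S} (ha : SmoothCov a)
    (hι : ContMDiff (𝓡 2) (𝓡∂ 3) ∞ ι) (y : N) (u v : TangentSpace (𝓡 2) y) :
    extD1 (pullback (I' := 𝓡 2) ι a) y u v =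
      extD1 a (ι y) (mfderiv (𝓡 2) (𝓡∂ 3) ι y u) (mfderiv (𝓡 2) (𝓡∂ 3) ι y v) :=
  HKBoundary.extD1_pullback a hι y (ha.differentiableWithinAt (mem_extChartAt_target _)) u v

/-- The wedge terms pull back by definition; only the exterior derivative needs naturality. -/
theorem curv_pullback (A : Fin 3 → OneForm S) (hι : ContMDiff (𝓡 2) (𝓡∂ 3) ∞ ι) (i : Fin 3)
    (y : N) (u v : TangentSpace (𝓡 2) y) :
    curv (fun i => pullback (I' := 𝓡 2) ι (cov A i)) i y u v =
      curv (cov A) i (ι y) (mfderiv (𝓡 2) (𝓡∂ 3) ι y u) (mfderiv (𝓡 2) (𝓡∂ 3) ι y v) :=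
  congrArg (· + _) ((smoothCov_cov A i).extD1_pullback hι y u v)

theorem covD1_pullback (A e : Fin 3 → OneForm S) (hι : ContMDiff (𝓡 2) (𝓡∂ 3) ∞ ι) (i : Fin 3)
    (y : N) (u v : TangentSpace (𝓡 2) y) :
    covD1 (fun i => pullback (I' := 𝓡 2) ι (cov A i)) (fun i => pullback (I' := 𝓡 2) ι (cov e i))
      i y u v =
      covD1 (cov A) (cov e) i (ι y) (mfderiv (𝓡 2) (𝓡∂ 3) ι y u)
        (mfderiv (𝓡 2) (𝓡∂ 3) ι y v) :=
  congrArg (· + _) ((smoothCov_cov e i).extD1_pullback hι y u v)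

theorem sum_smul_clm_apply {V : Type*} [AddCommGroup V] [Module ℝ V] [TopologicalSpace V]
    (c : Fin 3 → Fin 3 → ℝ) (a : Fin 3 → Fin 3 → V →L[ℝ] ℝ) (u : V) :
    (∑ j, ∑ k, c j k • a j k) u = ∑ j, ∑ k, c j k * a j k u := by
  simp

omit [IsManifold (𝓡∂ 3) ∞ S] [IsManifold (𝓡 2) ∞ N] in
theorem epsContract_pullback (r : Fin 3 → S → ℝ) (e : Fin 3 → CovectorField (𝓡∂ 3) S) (i : Fin 3)
    (y : N) (u : TangentSpace (𝓡 2) y) :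
    epsContract (fun i y => r i (ι y)) (fun i => pullback (I' := 𝓡 2) ι (e i)) i y u =
      epsContract r e i (ι y) (mfderiv (𝓡 2) (𝓡∂ 3) ι y u) :=
  (sum_smul_clm_apply _ _ u).trans (sum_smul_clm_apply _ _ _).symm

omit [IsManifold (𝓡 2) ∞ N] in
theorem covD0_pullback (A : Fin 3 → OneForm S) (τ : Fin 3 → ScalarField S)
    (hι : ContMDiff (𝓡 2) (𝓡∂ 3) ∞ ι) (i : Fin 3) (y : N) (u : TangentSpace (𝓡 2) y) :
    covD0 (fun i => pullback (I' := 𝓡 2) ι (cov A i)) (fun i y => τ i (ι y)) i y u =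
      covD0 (cov A) (fn τ) i (ι y) (mfderiv (𝓡 2) (𝓡∂ 3) ι y u) := by
  have h1 : mfderiv (𝓡 2) 𝓘(ℝ, ℝ) (fun y => τ i (ι y)) y =
      (mfderiv (𝓡∂ 3) 𝓘(ℝ, ℝ) (fn τ i) (ι y)).comp (mfderiv (𝓡 2) (𝓡∂ 3) ι y) :=
    mfderiv_comp y ((τ i).contMDiff.mdifferentiable (by simp) (ι y))
      (hι.mdifferentiable (by simp) y)
  refine congrArg₂ (· + ·) (congrArg (fun L => L u) h1) ?_
  exact (sum_smul_clm_apply _ _ u).trans (sum_smul_clm_apply _ _ _).symm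

/-- On the boundary the fields solve the equations of three-dimensional Euclidean gravity with
torsion and cosmological constant. -/
theorem isEuclideanGravityAt [T2Space S] [CompactSpace S] (hι : IsBoundaryInclusion ι)
    {α : Couplings} {γ : ℝ → PhasePoint S} {X : PhasePoint S} {t : ℝ}
    (hb : BoundaryConstraints α ι (γ t).q) (hv : HasVelocityAt γ X t) {VA Ve : Fin 3 → OneForm S}
    (hc : ConsistencyConstraints α ι (γ t).q VA Ve)
    (hXA : ∀ i x v, cov X.q.A i x v =
      covD0 (cov (γ t).q.A) (fn (γ t).q.Aperp) i x v + cov VA i x v)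
    (hXe : ∀ i x v, cov X.q.e i x v = covD0 (cov (γ t).q.A) (fn (γ t).q.eperp) i x v -
      epsContract (fn (γ t).q.Aperp) (cov (γ t).q.e) i x v + cov Ve i x v) :
    IsEuclideanGravityAt (curvCoeff α) (torsionCoeff α)
      (fun s i => pullback (I' := 𝓡 2) ι (cov (γ s).q.A i))
      (fun s i y => (γ s).q.Aperp i (ι y))
      (fun s i => pullback (I' := 𝓡 2) ι (cov (γ s).q.e i))
      (fun s i y => (γ s).q.eperp i (ι y)) t where
  curvature i y u v := (curv_pullback _ hι.contMDiff i y u v).trans (hb i y u v).1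
  torsion i y u v := (covD1_pullback _ _ hι.contMDiff i y u v).trans (hb i y u v).2
  connection_evolution i y u := by
    have h := hv.2.1 i (ι y) (mfderiv (𝓡 2) (𝓡∂ 3) ι y u)
    rw [hXA] at h
    refine h.congr_deriv (congrArg₂ (· + ·) (covD0_pullback _ _ hι.contMDiff i y u).symm ?_)
    refine (hc i y u).1.trans (congrArg (2 * curvCoeff α * ·) ?_)
    exact (epsContract_pullback _ _ i y u).symm
  triad_evolution i y u := by
    have h := hv.2.2.2.1 i (ι y) (mfderiv (𝓡 2) (𝓡∂ 3) ι y u)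
    rw [hXe] at h
    refine h.congr_deriv (congrArg₂ (· + ·) (congrArg₂ (· - ·)
      (covD0_pullback _ _ hι.contMDiff i y u).symm (epsContract_pullback _ _ i y u).symm) ?_)
    refine (hc i y u).2.trans (congrArg (2 * torsionCoeff α * ·) ?_)
    exact (epsContract_pullback _ _ i y u).symm

/-- The coefficients of the sector condition at a boundary point. -/
noncomputable def sectorCovector (ι : N → S) (e : Fin 3 → OneForm S) (y : N) (i : Fin 3) : ℝ :=
  epsWedge (cov e) i (ι y) (boundaryPush ι y (EuclideanSpace.single 0 1))
    (boundaryPush ι y (EuclideanSpace.single 1 1))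

theorem plane_expand (M : EuclideanSpace ℝ (Fin 2) →L[ℝ] ℝ) (u : EuclideanSpace ℝ (Fin 2)) :
    M u = u 0 * M (EuclideanSpace.single 0 1) + u 1 * M (EuclideanSpace.single 1 1) := by
  have hu : u = u 0 • EuclideanSpace.single 0 1 + u 1 • EuclideanSpace.single 1 1 := by
    ext i
    fin_cases i <;> simp
  conv_lhs => rw [hu]
  simp only [map_add, map_smul, smul_eq_mul]

/-- A two-form on a plane is its value on the basis pair times the area determinant, so a condition
for all pairs of vectors amounts to a single equation. -/
theorem eps_plane (M : Fin 3 → EuclideanSpace ℝ (Fin 2) →L[ℝ] ℝ) (r : Fin 3 → ℝ)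
    (u v : EuclideanSpace ℝ (Fin 2)) :
    ∑ i, r i * (∑ j, ∑ k, eps i j k * (M j u * M k v - M j v * M k u)) =
      (u 0 * v 1 - u 1 * v 0) * ∑ i, (∑ j, ∑ k, eps i j k *
        (M j (EuclideanSpace.single 0 1) * M k (EuclideanSpace.single 1 1) -
          M j (EuclideanSpace.single 1 1) * M k (EuclideanSpace.single 0 1))) * r i := by
  simp only [plane_expand _ u, plane_expand _ v]
  simp only [Fin.sum_univ_three, eps_values, eps_self_left, eps_self_right, eps_self_outer]
  ring

/-- The left side is twice the determinant of the images of the two basis vectors and of `v`, and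
these are linearly dependent. -/
theorem eps_plane_self (M : Fin 3 → EuclideanSpace ℝ (Fin 2) →L[ℝ] ℝ)
    (v : EuclideanSpace ℝ (Fin 2)) :
    ∑ i, (∑ j, ∑ k, eps i j k *
        (M j (EuclideanSpace.single 0 1) * M k (EuclideanSpace.single 1 1) -
          M j (EuclideanSpace.single 1 1) * M k (EuclideanSpace.single 0 1))) * M i v = 0 := by
  simp only [plane_expand _ v]
  simp only [Fin.sum_univ_three, eps_values, eps_self_left, eps_self_right, eps_self_outer]
  ring

omit [IsManifold (𝓡∂ 3) ∞ S] in
/-- The restriction of a triple of one-forms to the tangent plane of the boundary. -/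
noncomputable def planeFrame (ι : N → S) (e : Fin 3 → CovectorField (𝓡∂ 3) S) (y : N) (i : Fin 3) :
    EuclideanSpace ℝ (Fin 2) →L[ℝ] ℝ :=
  (show E3 →L[ℝ] ℝ from e i (ι y)).comp (boundaryPush ι y)

omit [IsManifold (𝓡 2) ∞ N] in
theorem sectorAt_iff (e : Fin 3 → OneForm S) (y : N) (r : Fin 3 → ℝ) :
    SectorAt ι e y r ↔ ∑ i, sectorCovector ι e y i * r i = 0 := by
  have key := eps_plane (planeFrame ι (cov e) y) r
  constructor
  · intro h
    have h1 := h (EuclideanSpace.single 0 1 : EuclideanSpace ℝ (Fin 2))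
      (EuclideanSpace.single 1 1 : EuclideanSpace ℝ (Fin 2))
    have h2 := (key _ _).symm.trans h1
    simp only [PiLp.single_apply, Fin.isValue, Fin.reduceEq, if_true, if_false, mul_one, mul_zero,
      sub_zero, one_mul] at h2
    exact h2
  · intro h u v
    exact (key u v).trans ((congrArg _ h).trans (mul_zero _))

omit [IsManifold (𝓡 2) ∞ N] in
-- The covector is twice the cross product of the frame components of the two basis tangent vectors;
-- these are independent because `ι` is an immersion and the forms are a coframe.
theorem IsBoundaryInclusion.sectorCovector_ne_zero (hι : IsBoundaryInclusion ι)
    {e : Fin 3 → OneForm S} (he : IsCoframe (cov e)) (y : N) : sectorCovector ι e y ≠ 0 := by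
  intro h0
  let L : EuclideanSpace ℝ (Fin 2) →ₗ[ℝ] (Fin 3 → ℝ) :=
    (frameMap fun i => e i (ι y)).toLinearMap.comp (boundaryPush ι y).toLinearMap
  have hL : Function.Injective L := (injective_frameMap (he (ι y))).comp (hι.injective_mfderiv y)
  have hi' : LinearIndependent ℝ ![L (EuclideanSpace.single 0 1), L (EuclideanSpace.single 1 1)] := by
    rw [LinearIndependent.pair_iff]
    intro s t h
    rw [← map_smul, ← map_smul, ← map_add, ← map_zero L] at h
    have h' := hL h
    exact ⟨by simpa using congrArg (fun v : EuclideanSpace ℝ (Fin 2) => v 0) h',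
      by simpa using congrArg (fun v : EuclideanSpace ℝ (Fin 2) => v 1) h'⟩
  refine crossProduct_ne_zero_iff_linearIndependent.2 hi' ?_
  have hL' : ∀ v i, L v i = cov e i (ι y) (boundaryPush ι y v) := fun v i => rfl
  have h := fun i => congrFun h0 i
  simp only [sectorCovector, epsWedge, wedge11] at h
  have e0 := h 0
  have e1 := h 1
  have e2 := h 2
  simp only [Fin.sum_univ_three, eps_values, eps_self_left, eps_self_right, eps_self_outer,
    Pi.zero_apply] at e0 e1 e2
  rw [cross_apply]
  funext i
  fin_cases i <;> simp [hL'] <;> linarith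

omit [IsManifold (𝓡 2) ∞ N] in
/-- In the sector considered the vector field is tangent to the boundary. -/
theorem IsBoundaryInclusion.tangent_of_sectorAt (hι : IsBoundaryInclusion ι)
    {e : Fin 3 → OneForm S} (he : IsCoframe (cov e)) {y : N} {ρ : E3}
    (h : SectorAt ι e y fun i => e i (ι y) ρ) :
    ρ ∈ range (boundaryPush ι y) := by
  let L : E3 →L[ℝ] (Fin 3 → ℝ) := frameMap fun i => e i (ι y)
  have hL := isInvertible_of_injective (injective_frameMap (he (ι y)))
  -- The functional Σ n_i e^i: it is nonzero and annihilates the boundary tangent plane, and the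
  -- sector condition says that it annihilates ρ.
  let P : E3 →ₗ[ℝ] ℝ := ∑ i, sectorCovector ι e y i • (show E3 →L[ℝ] ℝ from e i (ι y)).toLinearMap
  have hPa : ∀ u, P u = ∑ i, sectorCovector ι e y i * L u i := fun u => by
    simp only [P, LinearMap.sum_apply, LinearMap.smul_apply, smul_eq_mul]
    rfl
  refine hι.mem_range_boundaryPush y (P := P) (fun h0 => ?_) (fun v => ?_) ?_
  · refine hι.sectorCovector_ne_zero he y (funext fun i => ?_)
    obtain ⟨u, hu⟩ := hL.surjective (Pi.single i 1)
    have h1 := hPa u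
    have h2 : L u = Pi.single i 1 := hu
    rw [h0, h2] at h1
    simpa [Pi.single_apply] using h1.symm
  · rw [hPa]
    exact eps_plane_self (planeFrame ι (cov e) y) v
  · rw [hPa]
    exact (sectorAt_iff e y _).1 h

end BoundaryGravity

section Evolution

variable {S : Type*} [TopologicalSpace S] [ChartedSpace (EuclideanHalfSpace 3) S]

/-- A two-form commutes with a one-form, so reordering the factors only exchanges j and k and
changes the sign of the symbol. -/
theorem eps_wedge12_of_eps_wedge21 {e : Fin 3 → CovectorField (𝓡∂ 3) S}
    {β : Fin 3 → TwoForm (𝓡∂ 3) S} {x : S} {u v w : TangentSpace (𝓡∂ 3) x}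
    (h : ∀ i, ∑ j, ∑ k, eps i j k * wedge21 (β j) (e k) x u v w = 0) (i : Fin 3) :
    ∑ j, ∑ k, eps i j k * wedge12 (e j) (β k) x u v w = 0 := by
  have hi := h i
  simp only [wedge21, wedge12] at hi ⊢
  fin_cases i <;> simp only [Fin.zero_eta, Fin.mk_one, Fin.reduceFinMk, Fin.sum_univ_three,
    eps_values, eps_self_left, eps_self_right, eps_self_outer] at hi ⊢ <;> linear_combination -hi

end Evolution

end HKBoundary

/-! ### The main theorem. -/

theorem mainTheorem5
    {S : Type*} [TopologicalSpace S] [ChartedSpace (EuclideanHalfSpace 3) S]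
    [IsManifold (𝓡∂ 3) ∞ S] [T2Space S] [CompactSpace S] (hor : HKBoundary.IsOrientedAtlas S)
    {N : Type*} [TopologicalSpace N] [ChartedSpace (EuclideanSpace ℝ (Fin 2)) N]
    [IsManifold (𝓡 2) ∞ N] (ι : N → S) (hι : HKBoundary.IsBoundaryInclusion ι)
    (α : HKBoundary.Couplings) (hbulk : α.α₁ ≠ α.α₂)
    (hbdry : 4 * α.α₂ * α.α₃ - α.α₅ ^ 2 ≠ 0)
    (J : Set ℝ) (hJ : IsOpen J)
    (γ X : ℝ → HKBoundary.PhasePoint S)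
    -- the curve runs in the constraint submanifold, in the sector considered
    (hframe : ∀ t ∈ J, HKBoundary.IsCoframe (HKBoundary.cov (γ t).q.e))
    (hprim : ∀ t ∈ J, HKBoundary.PrimaryConstraints α (γ t))
    (hsec : ∀ t ∈ J, HKBoundary.BulkConstraints α (γ t).q)
    (hsec_bdry : ∀ t ∈ J, HKBoundary.BoundaryConstraints α ι (γ t).q)
    (hsector : ∀ t ∈ J, HKBoundary.InSector ι (γ t).q)
    -- and is an integral curve of a Hamiltonian vector field
    (hvel : ∀ t ∈ J, HKBoundary.HasVelocityAt γ (X t) t)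
    (hham : ∀ t ∈ J, HKBoundary.IsHamiltonianVector α (γ t) (X t)) :
    ∀ t ∈ J,
      -- explicit form of the Hamiltonian vector field; the consistency constraints hold
      (∃ VA Ve : Fin 3 → HKBoundary.OneForm S,
        HKBoundary.AreMultiplierForms (γ t).q VA Ve ∧
        HKBoundary.ConsistencyConstraints α ι (γ t).q VA Ve ∧
        (∀ i x v, HKBoundary.cov (X t).q.A i x v =
          HKBoundary.covD0 (HKBoundary.cov (γ t).q.A) (HKBoundary.fn (γ t).q.Aperp) i x v +
            HKBoundary.cov VA i x v) ∧
        (∀ i x v, HKBoundary.cov (X t).q.e i x v =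
          HKBoundary.covD0 (HKBoundary.cov (γ t).q.A) (HKBoundary.fn (γ t).q.eperp) i x v -
            HKBoundary.epsContract (HKBoundary.fn (γ t).q.Aperp) (HKBoundary.cov (γ t).q.e) i x v +
            HKBoundary.cov Ve i x v)) ∧
      -- the evolution of `A_⊥` and `e_⊥` is not determined
      (∀ lamPerp muPerp : Fin 3 → HKBoundary.ScalarField S,
        HKBoundary.IsHamiltonianVector α (γ t)
          ⟨⟨lamPerp, (X t).q.A, muPerp, (X t).q.e⟩, (X t).m⟩) ∧
      -- bulk: Lie derivative along a vector field tangent to the boundary plus `SO(3)` rotation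
      (∃ ρ : HKBoundary.SmoothVectorField S,
        (∀ i x, HKBoundary.cov (γ t).q.e i x (ρ x) = (γ t).q.eperp i x) ∧
        (∀ y, ρ (ι y) ∈ Set.range (mfderiv (𝓡 2) (𝓡∂ 3) ι y)) ∧
        (∀ i x v, HasDerivAt (fun s => HKBoundary.cov (γ s).q.A i x v)
          (HKBoundary.lieD (fun x => ρ x) (HKBoundary.cov (γ t).q.A i) x v +
            HKBoundary.covD0 (HKBoundary.cov (γ t).q.A)
              (fun j x => (γ t).q.Aperp j x - HKBoundary.cov (γ t).q.A j x (ρ x)) i x v) t) ∧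
        (∀ i x v, HasDerivAt (fun s => HKBoundary.cov (γ s).q.e i x v)
          (HKBoundary.lieD (fun x => ρ x) (HKBoundary.cov (γ t).q.e i) x v -
            HKBoundary.epsContract
              (fun j x => (γ t).q.Aperp j x - HKBoundary.cov (γ t).q.A j x (ρ x))
              (HKBoundary.cov (γ t).q.e) i x v) t)) ∧
      -- boundary: three-dimensional Euclidean gravity with torsion and cosmological constant
      HKBoundary.IsEuclideanGravityAt
        (-((2 * α.α₁ * α.α₂ - α.α₄ * α.α₅) / (4 * α.α₂ * α.α₃ - α.α₅ ^ 2)))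
        (-((2 * α.α₃ * α.α₄ - α.α₁ * α.α₅) / (4 * α.α₂ * α.α₃ - α.α₅ ^ 2)))
        (fun s i => HKBoundary.pullback ι (HKBoundary.cov (γ s).q.A i))
        (fun s i y => (γ s).q.Aperp i (ι y))
        (fun s i => HKBoundary.pullback ι (HKBoundary.cov (γ s).q.e i))
        (fun s i y => (γ s).q.eperp i (ι y)) t ∧
      -- torsion-free case, with the value of the cosmological constant
      (2 * α.α₃ * α.α₄ - α.α₁ * α.α₅ = 0 →
        HKBoundary.IsEuclideanGravityAt
          (-(((4 * α.α₁ * α.α₂ - 2 * α.α₄ * α.α₅) / (4 * α.α₂ * α.α₃ - α.α₅ ^ 2)) / 2)) 0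
          (fun s i => HKBoundary.pullback ι (HKBoundary.cov (γ s).q.A i))
          (fun s i y => (γ s).q.Aperp i (ι y))
          (fun s i => HKBoundary.pullback ι (HKBoundary.cov (γ s).q.e i))
          (fun s i y => (γ s).q.eperp i (ι y)) t) ∧
      -- partial gauge fixing: exactly one linear condition on the boundary values of `e_⊥`
      (∀ y : N, ∃ n : Fin 3 → ℝ, n ≠ 0 ∧
        (∀ r : Fin 3 → ℝ, HKBoundary.SectorAt ι (γ t).q.e y r ↔ ∑ i, n i * r i = 0) ∧
        ∑ i, n i * (γ t).q.eperp i (ι y) = 0) := by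
  intro t ht
  -- The multiplier forms are defined as remainders, so the decomposition of the velocity holds by
  -- construction; the content is in the equations they satisfy.
  have hXA := HKBoundary.connectionMultiplier_spec (γ t).q (X t).q.A
  have hXe := HKBoundary.triadMultiplier_spec (γ t).q (X t).q.e
  set VA := HKBoundary.connectionMultiplier (γ t).q (X t).q.A
  set Ve := HKBoundary.triadMultiplier (γ t).q (X t).q.e
  have hmult := (hham t ht).areMultiplierForms hor hbulk hXA hXe
  have hcons := (hham t ht).consistency hor hι hbulk hbdry hXA hXe
  have hXA' : ∀ i x v, HKBoundary.cov (X t).q.A i x v =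
      HKBoundary.covD0 (HKBoundary.cov (γ t).q.A) (HKBoundary.fn (γ t).q.Aperp) i x v +
        HKBoundary.cov VA i x v := fun i x v => by rw [hXA]; rfl
  have hXe' : ∀ i x v, HKBoundary.cov (X t).q.e i x v =
      HKBoundary.covD0 (HKBoundary.cov (γ t).q.A) (HKBoundary.fn (γ t).q.eperp) i x v -
        HKBoundary.epsContract (HKBoundary.fn (γ t).q.Aperp) (HKBoundary.cov (γ t).q.e) i x v +
        HKBoundary.cov Ve i x v := fun i x v => by rw [hXe]; rfl
  have hgrav := HKBoundary.isEuclideanGravityAt hι (hsec_bdry t ht) (hvel t ht) hcons hXA' hXe'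
  -- `curvCoeff` and `torsionCoeff` use the opposite sign of the denominator, which absorbs the
  -- minus signs of the statement.
  have hden : α.α₅ ^ 2 - 4 * α.α₂ * α.α₃ = -(4 * α.α₂ * α.α₃ - α.α₅ ^ 2) := by ring
  refine ⟨⟨VA, Ve, hmult, hcons, hXA', hXe'⟩, fun lp mp => (hham t ht).replace lp mp, ?_, ?_,
    fun h0 => ?_, fun y => ⟨HKBoundary.sectorCovector ι (γ t).q.e y,
      hι.sectorCovector_ne_zero (hframe t ht) y, HKBoundary.sectorAt_iff _ y,
      (HKBoundary.sectorAt_iff _ y _).1 (hsector t ht y)⟩⟩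
  · let ρ : HKBoundary.SmoothVectorField S :=
      ⟨HKBoundary.frameVector (γ t).q.e (γ t).q.eperp,
        HKBoundary.smooth_frameVector (hframe t ht) (γ t).q.eperp⟩
    have hρ := (HKBoundary.contMDiff_vector_iff (fun x => ρ x)).1 ρ.contMDiff
    have hr : ∀ i x, HKBoundary.cov (γ t).q.e i x (ρ x) = (γ t).q.eperp i x := fun i x =>
      HKBoundary.frameVector_spec (hframe t ht) (γ t).q.eperp i x
    refine ⟨ρ, hr, fun y => ?_, fun i x v => ?_, fun i x v => ?_⟩
    · refine hι.tangent_of_sectorAt (hframe t ht) ?_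
      have : (fun i => (γ t).q.e i (ι y) (ρ (ι y))) = fun i => (γ t).q.eperp i (ι y) :=
        funext fun i => hr i (ι y)
      exact this ▸ hsector t ht y
    · have hev := HKBoundary.connection_evolution (q := (γ t).q) hρ i x v
      have h := (hvel t ht).2.1 i x v
      rw [hXA'] at h
      refine h.congr_deriv (Eq.trans (add_right_inj _ |>.2 ?_) hev.symm)
      -- What remains is V_A = i_ρ F; the secondary constraint is used after division by α₁ - α₂.
      exact HKBoundary.multiplier_eq_contraction (hframe t ht)
        (HKBoundary.isAlternatingTwoForm_curv _) (fun i x u v => (hmult i x u v).1)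
        (fun i x u v w => (mul_eq_zero.1 (hsec t ht i x u v w).1).resolve_left
          (sub_ne_zero.2 hbulk)) i x v
    · have hev := HKBoundary.triad_evolution (q := (γ t).q) hρ hr i x v
      have h := (hvel t ht).2.2.2.1 i x v
      rw [hXe'] at h
      refine h.congr_deriv (Eq.trans (add_right_inj _ |>.2 ?_) hev.symm)
      exact HKBoundary.multiplier_eq_contraction (hframe t ht)
        (HKBoundary.isAlternatingTwoForm_covD1 _ _) (fun i x u v => (hmult i x u v).2)
        (fun i x u v w => HKBoundary.eps_wedge12_of_eps_wedge21
          (fun i => (mul_eq_zero.1 (hsec t ht i x u v w).2).resolve_left (sub_ne_zero.2 hbulk)) i)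
        i x v
  · convert hgrav using 1 <;>
      simp only [HKBoundary.curvCoeff, HKBoundary.torsionCoeff, hden, div_neg]
  · have hκ : -(((4 * α.α₁ * α.α₂ - 2 * α.α₄ * α.α₅) / (4 * α.α₂ * α.α₃ - α.α₅ ^ 2)) / 2) =
        HKBoundary.curvCoeff α := by
      rw [HKBoundary.curvCoeff, hden, div_neg]
      ring
    have hθ : 0 = HKBoundary.torsionCoeff α := by
      rw [HKBoundary.torsionCoeff, h0, zero_div]
    rw [hκ, hθ]
    exact hgrav
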